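/- **Proposition.** Let $\mathfrak g$ be of type $A_n^{(1)}$ $(n\ge1)$, $B_n^{(1)}$ $(n\ge3)$, $C_n^{(1)}$ $(n\ge2)$, $A_{2n-1}^{(2)}$ $(n\ge3)$, $A_{2n}^{(2)}$ $(n\ge1)$ or $D_{n+1}^{(2)}$ $(n\ge2)$, with index set $I=\{0,\dots,n\}$ and Cartan matrix $a_{ij}=\langle h_i,\alpha_j\rangle$ (normalised so that the null root is $2\alpha_0+\dots+2\alpha_{n-1}+\alpha_n$ in type $A_{2n}^{(2)}$), let $\bar P=\bigoplus_{i\in I}\mathbb Z\Lambda_i$ with $\langle h_i,\Lambda_j\rangle=\delta_{ij}$, and let $l\ge1$. *Columns.* Blocks of colours $i\in I$ are stacked from the ground up following a periodic pattern, whose cycle is, from bottom to top: $s,s+1,\dots,s+n$ modulo $n+1$ for a fixed $s$ (type $A_n^{(1)}$); $(01),2,\dots,n-1,n,n,n-1,\dots,2$ (types $B_n^{(1)},A_{2n-1}^{(2)}$), where the storey $(01)$ consists of a $0$-block and a $1$-block of half-unit depth side by side (the $0$-block in front, or the $1$-block in front, uniformly in the pattern); $0,0,1,\dots,n-1,n,n-1,\dots,1$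 (types $C_n^{(1)},A_{2n}^{(2)}$); $0,0,1,\dots,n-1,n,n,n-1,\dots,1$ (type $D_{n+1}^{(2)}$). A column is a finite such stack; nothing lies on top of a half-filled storey. A block occurring only once in a cycle is both covering and supporting. For the others: in types $B_n^{(1)},A_{2n-1}^{(2)}$ the ascending run $2,\dots,n$ is supporting and the descending run $n,\dots,2$ covering; in the last two patterns the lower $0$ and the descending run (down to $1$) are covering, while the upper $0$ and the ascending run up to $n-1$ (up to the lower $n$ in type $D_{n+1}^{(2)}$) are supporting. An $i$-slot is a place on top of a column where an $i$-block may be added; it is covering or supporting if that block would be. Let $c+\delta$ be $c$ with one full cycle added. *Slices.* Put $L=2l$ for $C_n^{(1)}$ and $L=l$ otherwise. A level-$l$ slice is a tuple $C=(c_1,\dots,c_L)$ of columns (layers; $c_1$ is the front one) with $c_1\subset\dots\subset c_L\subset c_1+\delta$, with an even total number of $n$-blocks for $A_{2n-1}^{(2)}$, with an even total number of $0$-blocks for $C_n^{(1)}$, and with at most one layer whose top is a supporting $n$-block for $D_{n+1}^{(2)}$. Put $C+\delta=(c_2,\dots,c_L,c_1+\delta)$, and let $\tilde{\mathcal B}$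 be the set of slices (for a fixed pattern) modulo $C\sim C+k\delta$ $(k\ge0)$. *Splitting.* In types $B_n^{(1)},A_{2n-1}^{(2)}$, to split an $i$-block ($i=01,2,\dots,n-1$, where a $01$-block is a full $(01)$-storey) means to break off the top half of a supporting $i$-block on top of a layer, chosen in the front-most layer among the highest ones, and to place it in a covering $i$-slot, chosen in the back-most layer among the lowest ones. In types $C_n^{(1)},A_{2n}^{(2)},D_{n+1}^{(2)}$ the words covering and supporting are interchanged, and $i=1,\dots,n$. Broken halves and the layers carrying them offer no blocks or slots. The $i$-split form of $C$ is obtained by splitting all possible $i$-blocks. *Operators.* Let $C'=C$ for $A_n^{(1)}$. For $B_n^{(1)}$ and $A_{2n-1}^{(2)}$ let $C'=C$ if $i=0,1$, the $01$-split form if $i=2$, and the $(i-1)$-split form if $i\ge3$. For $C_n^{(1)},A_{2n}^{(2)},D_{n+1}^{(2)}$ let $C'$ be the $(i+1)$-split form if $i\ne n$, and $C'=C$ if $i=n$. For $A_n^{(1)},B_n^{(1)},A_{2n-1}^{(2)}$: to remove an $i$-block, if some $i$-block on top of a layer of $C'$ is covering, remove one of the covering ones, in the front-most layer among the highest such layers;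 otherwise remove a top $i$-block in the front-most layer among the highest layers with such a block. To add an $i$-block, if some $i$-slot of $C'$ is supporting, add it in a supporting $i$-slot, in the back-most layer among the lowest such layers; otherwise in an $i$-slot, in the back-most layer among the lowest layers with such a slot. (Heights are those of the blocks and slots in question.) For the other types interchange covering and supporting. Then $\tilde e_iC$ (resp. $\tilde f_iC$) arises from $C'$ by removing (resp. adding) one $i$-block, or two successively if $i=n$ in type $A_{2n-1}^{(2)}$ or $i=0$ in type $C_n^{(1)}$, and then putting the broken halves back; it is $0$ if this is impossible. *Claim.* If no layer of $C$ is empty, then $\tilde e_iC$ and $\tilde f_iC$ are slices or $0$, and their classes depend only on the class of $C$; since every class contains such a $C$, this defines $\tilde e_i,\tilde f_i:\tilde{\mathcal B}\to\tilde{\mathcal B}\cup\{0\}$. For every $x\in\tilde{\mathcal B}$ the maxima $\varepsilon_i(x)=\max\{k:\tilde e_i^kx\ne0\}$ and $\varphi_i(x)=\max\{k:\tilde f_i^kx\ne0\}$ exist. With $\overline{\mathrm{wt}}(x)=\sum_{i\in I}(\varphi_i(x)-\varepsilon_i(x))\Lambda_i$, these maps make $\tilde{\mathcal B}$ a $U_q'(\mathfrak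 g)$-crystal (classical crystal): for all $i\in I$ and $x,y\in\tilde{\mathcal B}$, (1) $\varphi_i(x)=\varepsilon_i(x)+\langle h_i,\overline{\mathrm{wt}}(x)\rangle$; (2) if $\tilde e_ix\neq0$, then $\overline{\mathrm{wt}}(\tilde e_ix)=\overline{\mathrm{wt}}(x)+\alpha_i$, $\varepsilon_i(\tilde e_ix)=\varepsilon_i(x)-1$, $\varphi_i(\tilde e_ix)=\varphi_i(x)+1$; (3) if $\tilde f_ix\neq0$, then $\overline{\mathrm{wt}}(\tilde f_ix)=\overline{\mathrm{wt}}(x)-\alpha_i$, $\varepsilon_i(\tilde f_ix)=\varepsilon_i(x)+1$, $\varphi_i(\tilde f_ix)=\varphi_i(x)-1$; (4) $\tilde f_ix=y$ if and only if $x=\tilde e_iy$; (5) if $\varepsilon_i(x)=-\infty$, then $\tilde e_ix=\tilde f_ix=0$ (here vacuous). Here $\alpha_i=\sum_{j\in I}a_{ji}\Lambda_j$. -/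

import Mathlib

namespace YoungSlice

/-! ### Stacking patterns -/

/-- An affine type of rank `n` together with one of its stacking patterns.
For `A_n^(1)` the pattern may start with any colour; for `B_n^(1)` and `A_{2n-1}^(2)` one may choose
whether the half-unit-depth `0`-blocks are the front ones (`zeroFront = true`) or the back ones. -/
inductive Pattern (n : ℕ) : Type
  /-- type `A_n^(1)` -/
  | A1 (hn : 1 ≤ n) (start : Fin (n + 1)) : Pattern n
  /-- type `B_n^(1)` -/
  | B1 (hn : 3 ≤ n) (zeroFront : Bool) : Pattern n
  /-- type `C_n^(1)` -/
  | C1 (hn : 2 ≤ n) : Pattern n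
  /-- type `A_{2n-1}^(2)` -/
  | A2odd (hn : 3 ≤ n) (zeroFront : Bool) : Pattern n
  /-- type `A_{2n}^(2)` -/
  | A2even (hn : 1 ≤ n) : Pattern n
  /-- type `D_{n+1}^(2)` -/
  | D2 (hn : 2 ≤ n) : Pattern n

/-- A storey of a column: either one block of unit depth of the given colour, flagged as covering
and/or supporting (a block occurring once in a cycle is both), or a storey
consisting of a `0`-block and a `1`-block of half-unit depth, side by side (front and back);
the latter occur once in a cycle, so they are both covering and supporting. -/
inductive Storey : Type
  | unit (colour : ℕ) (cov supp : Bool) : Storey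
  | halves : Storey

namespace Pattern

variable {n : ℕ}

/-- The number of storeys in one cycle of the stacking pattern (a `δ`-column). -/
def period : Pattern n → ℕ
  | A1 _ _ => n + 1
  | B1 _ _ => 2 * n - 1
  | C1 _ => 2 * n + 1
  | A2odd _ _ => 2 * n - 1
  | A2even _ => 2 * n + 1
  | D2 _ => 2 * n + 2

/-- Cycle `01, 2, …, n-1, n, n, n-1, …, 2`, from bottom to top. -/
def cycleB (n r : ℕ) : Storey :=
  if r = 0 then .halves
  else if r ≤ n - 1 then .unit (r + 1) false true
  else .unit (2 * n - r) true false

/-- Cycle `0, 0, 1, …, n-1, n, n-1, …, 1`, from bottom to top. -/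
def cycleC (n r : ℕ) : Storey :=
  if r = 0 then .unit 0 true false
  else if r ≤ n then .unit (r - 1) false true
  else if r = n + 1 then .unit n true true
  else .unit (2 * n + 1 - r) true false

/-- Cycle `0, 0, 1, …, n-1, n, n, n-1, …, 1`, from bottom to top. -/
def cycleD (n r : ℕ) : Storey :=
  if r = 0 then .unit 0 true false
  else if r ≤ n + 1 then .unit (r - 1) false true
  else .unit (2 * n + 2 - r) true false

/-- The `k`-th storey (counted from the bottom, starting with `0`) of the stacking pattern. -/
def storey (P : Pattern n) (k : ℕ) : Storey :=
  match P with
  | A1 _ start => .unit ((start.val + k) % (n + 1)) true true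
  | B1 _ _ => cycleB n (k % P.period)
  | C1 _ => cycleC n (k % P.period)
  | A2odd _ _ => cycleB n (k % P.period)
  | A2even _ => cycleC n (k % P.period)
  | D2 _ => cycleD n (k % P.period)

/-- The colour of the half-unit-depth block on the front (`true`) or back (`false`) side. -/
def halfColour : Pattern n → Bool → ℕ
  | B1 _ zeroFront, side => if side = zeroFront then 0 else 1
  | A2odd _ zeroFront, side => if side = zeroFront then 0 else 1
  | _, side => if side then 0 else 1

/-- The side on which the half-unit-depth `i`-blocks (`i = 0, 1`) lie. -/
def sideOf (P : Pattern n) (i : ℕ) : Bool := decide (P.halfColour true = i)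

/-- The number of layers of a level-`l` slice. -/
def layers (P : Pattern n) (l : ℕ) : ℕ :=
  match P with
  | C1 _ => 2 * l
  | _ => l

/-- The affine Cartan matrix `a i j = ⟨h_i, α_j⟩`. -/
def cartan (P : Pattern n) : Matrix (Fin (n + 1)) (Fin (n + 1)) ℤ := fun a b =>
  let i := a.val
  let j := b.val
  if i = j then 2 else
  match P with
  | A1 _ _ =>
      if n = 1 then -2 else if (i + 1) % (n + 1) = j ∨ (j + 1) % (n + 1) = i then -1 else 0
  | B1 _ _ =>
      if i = n ∧ j = n - 1 then -2
      else if (i = 0 ∧ j = 2) ∨ (i = 2 ∧ j = 0) ∨ (1 ≤ i ∧ i + 1 = j) ∨ (1 ≤ j ∧ j + 1 = i) then -1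
      else 0
  | A2odd _ _ =>
      if i = n - 1 ∧ j = n then -2
      else if (i = 0 ∧ j = 2) ∨ (i = 2 ∧ j = 0) ∨ (1 ≤ i ∧ i + 1 = j) ∨ (1 ≤ j ∧ j + 1 = i) then -1
      else 0
  | C1 _ =>
      if (i = 1 ∧ j = 0) ∨ (i = n - 1 ∧ j = n) then -2
      else if i + 1 = j ∨ j + 1 = i then -1 else 0
  | A2even _ =>
      if n = 1 then (if i = 0 then -4 else -1)
      else if (i = 0 ∧ j = 1) ∨ (i = n - 1 ∧ j = n) then -2
      else if i + 1 = j ∨ j + 1 = i then -1 else 0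
  | D2 _ =>
      if (i = 0 ∧ j = 1) ∨ (i = n ∧ j = n - 1) then -2
      else if i + 1 = j ∨ j + 1 = i then -1 else 0

end Pattern

/-! ### Columns (level-1 slices, or level-1/2 slices for `C_n^(1)`) -/

/-- A finite stack of blocks: `full` complete storeys at the bottom and, if `half = some side`,
one block of half-unit depth on the given side of the next storey. Nothing lies on top of a
half-filled storey. -/
@[ext] structure Column : Type where
  full : ℕ
  half : Option Bool

namespace Column

/-- A single half-unit-depth block can only lie in a storey made of two such blocks. -/
def Valid {n : ℕ} (P : Pattern n) (c : Column) : Prop :=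
  c.half.isSome → P.storey c.full = .halves

/-- The column without blocks. -/
def empty : Column := ⟨0, none⟩

/-- The half-depth cells occupied by a column. -/
def cells (c : Column) : Set (ℕ × Bool) :=
  {x | x.1 < c.full ∨ (x.1 = c.full ∧ c.half = some x.2)}

/-- Inclusion of columns as sets of blocks (see `sub_iff_cells`). -/
def Sub (c d : Column) : Prop :=
  c.full < d.full ∨ (c.full = d.full ∧ (c.half = none ∨ c.half = d.half))

theorem sub_iff_cells (c d : Column) : c.Sub d ↔ c.cells ⊆ d.cells := by
  obtain ⟨a, x⟩ := c
  obtain ⟨b, y⟩ := d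
  constructor
  · rintro h ⟨k, s⟩ hk
    simp only [Sub, cells, Set.mem_ofPred_eq] at h hk ⊢
    rcases h with h | ⟨h, h' | h'⟩ <;> rcases hk with hk | ⟨hk, hk'⟩
    · left; omega
    · left; omega
    · left; omega
    · simp [h'] at hk'
    · left; omega
    · right; exact ⟨by omega, by rw [← h', hk']⟩
  · intro h
    have key : ∀ (k : ℕ) (s : Bool), (k < a ∨ (k = a ∧ x = some s)) →
        (k < b ∨ (k = b ∧ y = some s)) := fun k s hk => h (a := (k, s)) hk
    simp only [Sub]
    have hab : a ≤ b := by
      by_contra hlt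
      have h1 := key b true (Or.inl (by omega))
      have h2 := key b false (Or.inl (by omega))
      rcases h1 with h1 | ⟨-, h1⟩
      · omega
      rcases h2 with h2 | ⟨-, h2⟩
      · omega
      simp [h1] at h2
    rcases Nat.lt_or_ge a b with hlt | hge
    · exact Or.inl hlt
    · refine Or.inr ⟨by omega, ?_⟩
      cases x with
      | none => exact Or.inl rfl
      | some s =>
        right
        rcases key a s (Or.inr ⟨rfl, rfl⟩) with h1 | ⟨-, h1⟩
        · omega
        · exact h1.symm

/-- `c + δ`: add one full cycle of the stacking pattern. -/
def addDelta {n : ℕ} (P : Pattern n) (c : Column) : Column := ⟨c.full + P.period, c.half⟩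

end Column

/-- What is moved or split: an `i`-block, or the unit cube `01` glued from a `0`- and a `1`-block. -/
inductive Piece : Type
  | colour (i : ℕ) : Piece
  | cube01 : Piece

/-- The place of a top block or of a slot: the storey it occupies, and whether it is covering
and/or supporting. -/
structure Spot : Type where
  height : ℕ
  cov : Bool
  supp : Bool

section Tops

variable {n : ℕ} (P : Pattern n)

/-- The place of the piece `q` within the `k`-th storey, if that storey contains it. -/
def storeySpot (q : Piece) (k : ℕ) : Option Spot :=
  match P.storey k, q with
  | .unit c cov supp, .colour i => if c = i then some ⟨k, cov, supp⟩ else none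
  | .unit _ _ _, .cube01 => none
  | .halves, .colour i => if i ≤ 1 then some ⟨k, true, true⟩ else none
  | .halves, .cube01 => some ⟨k, true, true⟩

/-- The `q`-block on top of `c`, if any. On top of a complete storey of half-unit-depth blocks lie
a `0`-block, a `1`-block and a `01`-block. -/
def topBlock (q : Piece) (c : Column) : Option Spot :=
  match c.half, q with
  | some s, .colour i => if P.halfColour s = i then some ⟨c.full, true, true⟩ else none
  | some _, .cube01 => none
  | none, q => if c.full = 0 then none else storeySpot P q (c.full - 1)

/-- The `q`-slot on top of `c` (the place where a `q`-block may be added), if any. -/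
def topSlot (q : Piece) (c : Column) : Option Spot :=
  match c.half, q with
  | some s, .colour i => if P.halfColour (!s) = i then some ⟨c.full, true, true⟩ else none
  | some _, .cube01 => none
  | none, q => storeySpot P q c.full

/-- Add an `i`-block in the `i`-slot of `c`. -/
def addBlock (i : ℕ) (c : Column) : Column :=
  match c.half, P.storey c.full with
  | none, .halves => ⟨c.full, some (P.sideOf i)⟩
  | _, _ => ⟨c.full + 1, none⟩

/-- Remove the `i`-block on top of `c`. -/
def removeBlock (i : ℕ) (c : Column) : Column :=
  match c.half, P.storey (c.full - 1) with
  | some _, _ => ⟨c.full, none⟩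
  | none, .halves => ⟨c.full - 1, some (!(P.sideOf i))⟩
  | none, .unit _ _ _ => ⟨c.full - 1, none⟩

/-- The number of `i`-blocks in `c`, for a colour `i` whose blocks have unit depth. -/
def countBlocks (i : ℕ) (c : Column) : ℕ :=
  Nat.count (fun k => (storeySpot P (.colour i) k).isSome = true) c.full

end Tops

/-! ### Level-`l` slices -/

section Slices

variable {n : ℕ} (P : Pattern n)

/-- The top of `c` is a supporting `n`-block. -/
def TopIsSupportingN (c : Column) : Prop :=
  ∃ s ∈ topBlock P (.colour n) c, s.supp = true

/-- The extra condition on slices imposed by the affine type. -/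
def ExtraCondition {L : ℕ} (C : Fin L → Column) : Prop :=
  match P with
  | .A2odd _ _ => Even (∑ j, countBlocks P n (C j))
  | .C1 _ => Even (∑ j, countBlocks P 0 (C j))
  | .D2 _ => ∀ j k, TopIsSupportingN P (C j) → TopIsSupportingN P (C k) → j = k
  | _ => True

/-- A tuple of columns `(c_1, …, c_L)` with `c_1 ⊆ c_2 ⊆ ⋯ ⊆ c_L ⊆ c_1 + δ` satisfying the
extra condition of the affine type. (Given the chain, `c_L ⊆ c_1 + δ` means that
`c_k ⊆ c_j + δ` for all `j` and `k`.) -/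
structure IsSlice {L : ℕ} (C : Fin L → Column) : Prop where
  valid : ∀ j, (C j).Valid P
  mono : ∀ j k, j ≤ k → (C j).Sub (C k)
  sub_addDelta : ∀ j k, (C k).Sub ((C j).addDelta P)
  extra : ExtraCondition P C

/-- The level-`l` slices that use the stacking pattern `P`. -/
def Slice (l : ℕ) : Type := {C : Fin (P.layers l) → Column // IsSlice P C}

/-- `C + δ = (c_2, …, c_L, c_1 + δ)`. -/
def shift {L : ℕ} (C : Fin L → Column) : Fin L → Column := fun j =>
  if h : j.val + 1 < L then C ⟨j.val + 1, h⟩ else (C ⟨0, j.pos⟩).addDelta P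

theorem shift_injective {L : ℕ} :
    Function.Injective (shift P : (Fin L → Column) → (Fin L → Column)) := by
  intro C D h
  funext j
  rcases Nat.eq_zero_or_pos j.val with h0 | h0
  · have hL := j.pos
    have h1 := congrFun h ⟨L - 1, by omega⟩
    have h2 : ¬ (L - 1 + 1 < L) := by omega
    simp only [shift, h2, dite_false, Column.addDelta, Column.mk.injEq] at h1
    have hj : j = ⟨0, hL⟩ := Fin.ext h0
    rw [hj]
    exact Column.ext (by omega) h1.2
  · have h1 := congrFun h ⟨j.val - 1, by omega⟩
    have h2 : j.val - 1 + 1 < L := by omega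
    simp only [shift, h2, dite_true] at h1
    have hj : (⟨j.val - 1 + 1, h2⟩ : Fin L) = j := Fin.ext (by simp; omega)
    rwa [hj] at h1

theorem storey_add_period (k : ℕ) : P.storey (k + P.period) = P.storey k := by
  cases P
  case A1 => simp only [Pattern.storey, Pattern.period, ← Nat.add_assoc]
             rw [Nat.add_assoc, Nat.add_mod_right]
  all_goals simp only [Pattern.storey, Nat.add_mod_right]

theorem storeySpot_isSome_add_period (q : Piece) (k : ℕ) :
    (storeySpot P q (k + P.period)).isSome = (storeySpot P q k).isSome := by
  unfold storeySpot
  rw [storey_add_period]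
  cases P.storey k <;> cases q <;> simp <;> split <;> simp

theorem countBlocks_addDelta (i : ℕ) (c : Column) :
    countBlocks P i (c.addDelta P) =
      countBlocks P i c + countBlocks P i ⟨P.period, none⟩ := by
  unfold countBlocks Column.addDelta
  simp only
  rw [Nat.add_comm c.full, Nat.count_add, Nat.add_comm]
  congr 1
  simp only [Nat.add_comm P.period, storeySpot_isSome_add_period]

theorem even_countBlocks_period_A2odd (hn : 3 ≤ n) (z : Bool) :
    Even (countBlocks (.A2odd hn z) n ⟨(Pattern.A2odd hn z).period, none⟩) := by
  have h : (Finset.range (2 * n - 1)).filter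
      (fun k => (storeySpot (.A2odd hn z) (.colour n) k).isSome = true) = {n - 1, n} := by
    ext k
    simp only [Finset.mem_filter, Finset.mem_range, Finset.mem_insert, Finset.mem_singleton]
    constructor
    · rintro ⟨hk, h⟩
      simp only [storeySpot, Pattern.storey, Pattern.period, Nat.mod_eq_of_lt hk,
        Pattern.cycleB] at h
      by_contra hne
      rcases Nat.eq_zero_or_pos k with h0 | h0
      · have : ¬ n ≤ 1 := by omega
        simp [h0, this] at h
      · rw [if_neg (by omega)] at h
        split_ifs at h with h1
        · have : ¬ k + 1 = n := by omega
          simp [this] at h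
        · have : ¬ 2 * n - k = n := by omega
          simp [this] at h
    · intro h
      have hk : k < 2 * n - 1 := by omega
      refine ⟨hk, ?_⟩
      simp only [storeySpot, Pattern.storey, Pattern.period, Nat.mod_eq_of_lt hk,
        Pattern.cycleB]
      rw [if_neg (by omega)]
      rcases h with h | h
      · have : k + 1 = n := by omega
        simp [h, show n - 1 + 1 = n by omega]
      · have h1 : ¬ k ≤ n - 1 := by omega
        have : 2 * n - k = n := by omega
        simp [h1, this]
  simp only [countBlocks, Nat.count_eq_card_filter_range]
  simp only [Pattern.period] at h ⊢
  rw [h, Finset.card_pair (by omega)]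
  exact even_two

theorem even_countBlocks_period_C1 (hn : 2 ≤ n) :
    Even (countBlocks (.C1 hn) 0 ⟨(Pattern.C1 hn).period, none⟩) := by
  have h : (Finset.range (2 * n + 1)).filter
      (fun k => (storeySpot (.C1 hn) (.colour 0) k).isSome = true) = {0, 1} := by
    ext k
    simp only [Finset.mem_filter, Finset.mem_range, Finset.mem_insert, Finset.mem_singleton]
    constructor
    · rintro ⟨hk, h⟩
      simp only [storeySpot, Pattern.storey, Pattern.period, Nat.mod_eq_of_lt hk,
        Pattern.cycleC] at h
      by_contra hne
      rw [if_neg (by omega)] at h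
      split_ifs at h with h1 h2
      · have : ¬ k - 1 = 0 := by omega
        simp [this] at h
      · have : ¬ n = 0 := by omega
        simp [this] at h
      · have : ¬ 2 * n + 1 - k = 0 := by omega
        simp [this] at h
    · intro h
      have hk : k < 2 * n + 1 := by omega
      refine ⟨hk, ?_⟩
      simp only [storeySpot, Pattern.storey, Pattern.period, Nat.mod_eq_of_lt hk,
        Pattern.cycleC]
      rcases h with h | h
      · simp [h]
      · have : 1 ≤ n := by omega
        simp [h, this]
  simp only [countBlocks, Nat.count_eq_card_filter_range]
  simp only [Pattern.period] at h ⊢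
  rw [h]
  decide

theorem sum_shift {L : ℕ} (f : Column → ℕ) (m : ℕ) (hf : ∀ c, f (c.addDelta P) = f c + m)
    (hm : Even m) (C : Fin L → Column) (h : Even (∑ j, f (C j))) :
    Even (∑ j, f (shift P C j)) := by
  cases L with
  | zero => simp
  | succ L =>
    rw [Fin.sum_univ_castSucc]
    rw [Fin.sum_univ_succ] at h
    have h1 : ∀ j : Fin L, shift P C j.castSucc = C j.succ := fun j => by
      simp [shift, Fin.succ]
    have h2 : shift P C (Fin.last L) = (C 0).addDelta P := by
      simp [shift]
    simp only [h1, h2, hf]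
    rw [← Nat.add_assoc, Nat.add_comm _ (f (C 0))]
    exact h.add hm

theorem topIsSupportingN_of_addDelta (hn : 2 ≤ n) (c : Column)
    (h : TopIsSupportingN (.D2 hn) (c.addDelta (.D2 hn))) : TopIsSupportingN (.D2 hn) c := by
  obtain ⟨a, x⟩ := c
  obtain ⟨s, hs, hs'⟩ := h
  cases x with
  | some b => exact ⟨⟨a, true, true⟩, by
      simp only [topBlock, Column.addDelta] at hs ⊢
      split_ifs at hs ⊢
      · rfl
      · simp at hs, rfl⟩
  | none =>
    rcases Nat.eq_zero_or_pos a with h0 | h0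
    · exfalso
      subst h0
      have h1 : ¬ 2 * n + 1 ≤ n + 1 := by omega
      have h2 : (2 * n + 1) % (2 * n + 2) = 2 * n + 1 := Nat.mod_eq_of_lt (by omega)
      have h3 : ¬ 1 = n := by omega
      have h4 : 2 * n + 2 - (2 * n + 1) = 1 := by omega
      simp [topBlock, Column.addDelta, storeySpot, Pattern.storey, Pattern.period,
        Pattern.cycleD, h1, h2, h3, h4] at hs
    · have h1 : a + (Pattern.D2 hn).period - 1 = (a - 1) + (Pattern.D2 hn).period := by omega
      have h2 : ¬ a + (Pattern.D2 hn).period = 0 := by omega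
      have h3 : ¬ a = 0 := by omega
      simp only [topBlock, Column.addDelta, h1, h2, if_false, storeySpot,
        storey_add_period] at hs
      refine ⟨⟨a - 1, s.cov, s.supp⟩, ?_, hs'⟩
      simp only [topBlock, h3, if_false, storeySpot]
      cases hst : (Pattern.D2 hn).storey (a - 1) with
      | unit c cov supp =>
        simp only [hst] at hs ⊢
        split_ifs at hs ⊢ with hc
        · simp at hs; subst hs; rfl
        · simp at hs
      | halves =>
        simp only [hst] at hs ⊢
        split_ifs at hs ⊢ with hc
        · simp at hs; subst hs; rfl
        · simp at hs

theorem IsSlice.shift {L : ℕ} {C : Fin L → Column} (h : IsSlice P C) :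
    IsSlice P (YoungSlice.shift P C) := by
  have addSub : ∀ {c d : Column}, c.Sub d → (c.addDelta P).Sub (d.addDelta P) := by
    intro c d h
    simp only [Column.Sub, Column.addDelta, Nat.add_right_cancel_iff] at h ⊢
    rcases h with h | h
    · left; omega
    · exact Or.inr h
  have hval : ∀ {c : Column}, c.Valid P → (c.addDelta P).Valid P := by
    intro c h
    simp only [Column.Valid, Column.addDelta, storey_add_period] at h ⊢
    exact h
  have hper : 0 < P.period := by
    cases P <;> simp [Pattern.period] <;> omega
  have self : ∀ c : Column, c.Sub (c.addDelta P) := by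
    intro c
    simp only [Column.Sub, Column.addDelta]
    omega
  have subTrans : ∀ {c d e : Column}, c.Sub d → d.Sub e → c.Sub e := by
    intro c d e h h'
    rw [Column.sub_iff_cells] at h h' ⊢
    exact h.trans h'
  refine ⟨fun j => ?_, fun j k hjk => ?_, fun j k => ?_, ?_⟩
  · simp only [YoungSlice.shift]
    split_ifs
    · exact h.valid _
    · exact hval (h.valid _)
  · simp only [YoungSlice.shift]
    have hjk' : j.val ≤ k.val := hjk
    split_ifs with h1 h2 h2
    · exact h.mono _ _ (by simpa using hjk')
    · exact h.sub_addDelta _ _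
    · omega
    · exact addSub (h.mono _ _ le_rfl)
  · simp only [YoungSlice.shift]
    split_ifs with h1 h2 h2
    · exact h.sub_addDelta _ _
    · exact subTrans (h.sub_addDelta ⟨0, k.pos⟩ ⟨k.val + 1, h1⟩) (self _)
    · exact addSub (h.mono _ _ (Nat.zero_le _))
    · exact self _
  · have hex := h.extra
    cases P with
    | A1 => trivial
    | B1 => trivial
    | A2even => trivial
    | A2odd hn z =>
      exact sum_shift _ _ _ (countBlocks_addDelta _ _) (even_countBlocks_period_A2odd hn z) C hex
    | C1 hn =>
      exact sum_shift _ _ _ (countBlocks_addDelta _ _) (even_countBlocks_period_C1 hn) C hex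
    | D2 hn =>
      have key : ∀ j, TopIsSupportingN (.D2 hn) (YoungSlice.shift (.D2 hn) C j) →
          ∃ m : Fin L, TopIsSupportingN (.D2 hn) (C m) ∧
            ((m.val = j.val + 1) ∨ (m.val = 0 ∧ j.val + 1 = L)) := by
        intro j hj
        simp only [YoungSlice.shift] at hj
        split_ifs at hj with h1
        · exact ⟨_, hj, Or.inl rfl⟩
        · exact ⟨_, topIsSupportingN_of_addDelta hn _ hj, Or.inr ⟨rfl, by omega⟩⟩
      intro j k hj hk
      obtain ⟨m, hm, hm'⟩ := key j hj
      obtain ⟨m2, hm2, hm2'⟩ := key k hk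
      have := congrArg Fin.val (hex m m2 hm hm2)
      exact Fin.ext (by omega)

variable {P}

/-- `C + δ`. -/
def Slice.addDelta {l : ℕ} (C : Slice P l) : Slice P l := ⟨shift P C.1, C.2.shift P⟩

theorem Slice.addDelta_injective {l : ℕ} :
    Function.Injective (Slice.addDelta : Slice P l → Slice P l) := fun _ _ h =>
  Subtype.ext (shift_injective P (congrArg Subtype.val h))

/-- Two slices are related if one is obtained from the other by adding finitely many `δ`'s. -/
def Slice.Related {l : ℕ} (C D : Slice P l) : Prop :=
  ∃ k : ℕ, D = Slice.addDelta^[k] C ∨ C = Slice.addDelta^[k] D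

theorem Slice.related_equivalence {l : ℕ} :
    Equivalence (Slice.Related : Slice P l → Slice P l → Prop) := by
  refine ⟨fun _ => ⟨0, Or.inl rfl⟩, fun ⟨k, h⟩ => ⟨k, h.symm⟩, ?_⟩
  have inj := fun k => (Slice.addDelta_injective (P := P) (l := l)).iterate k
  have common : ∀ {C E : Slice P l} (a b : ℕ),
      Slice.addDelta^[a] C = Slice.addDelta^[b] E → Slice.Related C E := by
    intro C E a b h
    rcases Nat.le_total a b with hab | hab
    · obtain ⟨c, rfl⟩ := Nat.exists_eq_add_of_le hab
      rw [Function.iterate_add_apply] at h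
      exact ⟨c, Or.inr (inj a h)⟩
    · obtain ⟨c, rfl⟩ := Nat.exists_eq_add_of_le hab
      rw [Function.iterate_add_apply] at h
      exact ⟨c, Or.inl (inj b h).symm⟩
  rintro _ _ _ ⟨a, rfl | rfl⟩ ⟨b, rfl | h⟩
  · exact ⟨b + a, Or.inl (by rw [Function.iterate_add_apply])⟩
  · exact common a b h
  · exact common b a (by rw [← Function.iterate_add_apply, ← Function.iterate_add_apply,
      Nat.add_comm])
  · subst h
    exact ⟨a + b, Or.inr (by rw [Function.iterate_add_apply])⟩

instance Slice.setoid (P : Pattern n) (l : ℕ) : Setoid (Slice P l) :=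
  ⟨Slice.Related, Slice.related_equivalence⟩

/-- The set of `δ`-equivalence classes of level-`l` slices. -/
def SliceClass (P : Pattern n) (l : ℕ) : Type := Quotient (Slice.setoid P l)

/-- The class of a slice. -/
def Slice.toClass {l : ℕ} (C : Slice P l) : SliceClass P l := Quotient.mk _ C

end Slices

/-! ### Splitting blocks -/

/-- A layer of a partially split slice: a `whole` column, a column `c` whose top block has `lost`
its top half, or a column `c` on top of which a broken-off half block has been `gained`. -/
inductive Layer : Type
  | whole (c : Column) : Layer
  | lost (c : Column) : Layer
  | gained (c : Column) : Layer

namespace Layer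

/-- The column that results when every broken-off half is put back in its place. -/
def glue : Layer → Column
  | whole c => c
  | lost c => c
  | gained c => c

/-- The column, if it is not affected by splitting. Only such layers have blocks or slots on top
that can be used. -/
def whole? : Layer → Option Column
  | whole c => some c
  | _ => none

end Layer

section Choice

variable {L : ℕ}

/-- Among the layers with a given spot, the fore-front one (smallest index) among those of highest
height. -/
def highFront (spot : Fin L → Option Spot) : Option (Fin L) :=
  (List.finRange L).find? fun j => (spot j).any fun x =>
    (List.finRange L).all fun k => (spot k).all fun y => decide (y.height ≤ x.height)

/-- Among the layers with a given spot, the very back one (largest index) among those of lowest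
height. -/
def lowBack (spot : Fin L → Option Spot) : Option (Fin L) :=
  (List.finRange L).reverse.find? fun j => (spot j).any fun x =>
    (List.finRange L).all fun k => (spot k).all fun y => decide (x.height ≤ y.height)

end Choice

section Operators

variable {n : ℕ} (P : Pattern n)

/-- The types whose rules use the same words as for `B_n^(1)`; for the remaining
types the words "covering" and "supporting" are interchanged. -/
def bLike : Pattern n → Bool
  | .A1 _ _ => true
  | .B1 _ _ => true
  | .A2odd _ _ => true
  | .C1 _ => false
  | .A2even _ => false
  | .D2 _ => false

/-- Covering in the `B`-like types, supporting in the others. -/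
def isFirst (s : Spot) : Bool := if bLike P then s.cov else s.supp

/-- Supporting in the `B`-like types, covering in the others. -/
def isSecond (s : Spot) : Bool := if bLike P then s.supp else s.cov

/-- Split one `q`-block, if possible: the top half of a supporting `q`-block (`B`-like types;
otherwise a covering one), chosen in the fore-front layer among the highest ones, is moved to a
covering `q`-slot (otherwise a supporting one), chosen in the very back layer among the lowest
ones. -/
def splitOnce {L : ℕ} (q : Piece) (D : Fin L → Layer) : Option (Fin L → Layer) :=
  let block := fun j => ((D j).whole?.bind (topBlock P q)).filter (isSecond P)
  let slot := fun j => ((D j).whole?.bind (topSlot P q)).filter (isFirst P)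
  match highFront block, lowBack slot with
  | some j, some k =>
      some (Function.update (Function.update D j (.lost (D j).glue)) k (.gained (D k).glue))
  | _, _ => none

/-- The `q`-split form: split all possible `q`-blocks. Each splitting uses up two of the `L`
layers, so that nothing more can be split after `L` attempts. -/
def splitForm {L : ℕ} (q : Piece) (C : Fin L → Column) : Fin L → Layer :=
  (fun D => (splitOnce P q D).getD D)^[L] (fun j => .whole (C j))

/-- The kind of blocks that have to be split before the `i`-th operators act. (In type
`D_{n+1}^(2)` this is as in type `A_{2n}^(2)`; in particular `n`-blocks are split for `i = n - 1`.) -/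
def splitPiece (i : ℕ) : Option Piece :=
  match P with
  | .A1 _ _ => none
  | .B1 _ _ => if i ≤ 1 then none else if i = 2 then some .cube01 else some (.colour (i - 1))
  | .A2odd _ _ => if i ≤ 1 then none else if i = 2 then some .cube01 else some (.colour (i - 1))
  | .C1 _ => if i = n then none else some (.colour (i + 1))
  | .A2even _ => if i = n then none else some (.colour (i + 1))
  | .D2 _ => if i = n then none else some (.colour (i + 1))

/-- The form `C'` of `C` on which the `i`-th operators act. -/
def preparedForm {L : ℕ} (i : ℕ) (C : Fin L → Column) : Fin L → Layer :=
  match splitPiece P i with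
  | none => fun j => .whole (C j)
  | some q => splitForm P q C

/-- Remove one `i`-block: if some of the top `i`-blocks are covering blocks (supporting blocks
in the types that are not `B`-like), from the fore-front layer among the highest ones with
such blocks; if there are only `i`-blocks of the other kind, from the fore-front layer among
the highest ones with `i`-blocks; impossible if there is no top `i`-block. -/
def eStep {L : ℕ} (i : ℕ) (D : Fin L → Layer) : Option (Fin L → Layer) :=
  let block := fun j => (D j).whole?.bind (topBlock P (.colour i))
  ((highFront fun j => (block j).filter (isFirst P)).or (highFront block)).map fun j =>
    Function.update D j (.whole (removeBlock P i (D j).glue))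

/-- Add one `i`-block: if some of the `i`-slots are supporting slots (covering slots in the types
that are not `B`-like), on top of the very back layer among the lowest ones with such
slots; if there are only `i`-slots of the other kind, on top of the very back layer among the
lowest ones with `i`-slots; impossible if there is no `i`-slot. -/
def fStep {L : ℕ} (i : ℕ) (D : Fin L → Layer) : Option (Fin L → Layer) :=
  let slot := fun j => (D j).whole?.bind (topSlot P (.colour i))
  ((lowBack fun j => (slot j).filter (isSecond P)).or (lowBack slot)).map fun j =>
    Function.update D j (.whole (addBlock P i (D j).glue))

/-- The number of `i`-blocks that are moved by one application of the `i`-th operators. -/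
def blocksMoved (i : ℕ) : ℕ :=
  match P with
  | .A2odd _ _ => if i = n then 2 else 1
  | .C1 _ => if i = 0 then 2 else 1
  | _ => 1

/-- The `k`-fold iterate of a partially defined map (`none` plays the role of `0`). -/
def iterOpt {β : Type*} (g : β → Option β) : ℕ → β → Option β
  | 0, b => some b
  | k + 1, b => (iterOpt g k b).bind g

/-- The rule for `e_i`, on tuples of columns. For the operators that remove two blocks, removing
them one after the other amounts to the usual case distinction (only blocks of the
second kind; exactly one block of the first kind, whose removal uncovers a block of the second
kind; at least two blocks of the first kind). -/
def eTuple {L : ℕ} (i : ℕ) (C : Fin L → Column) : Option (Fin L → Column) :=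
  (iterOpt (eStep P i) (blocksMoved P i) (preparedForm P i C)).map fun D j => (D j).glue

/-- The rule for `f_i`, on tuples of columns. -/
def fTuple {L : ℕ} (i : ℕ) (C : Fin L → Column) : Option (Fin L → Column) :=
  (iterOpt (fStep P i) (blocksMoved P i) (preparedForm P i C)).map fun D j => (D j).glue

variable {P} {l : ℕ}

open Classical in
/-- `e_i` on slices. -/
noncomputable def Slice.e (i : Fin (n + 1)) (C : Slice P l) : Option (Slice P l) :=
  (eTuple P i C.1).bind fun t => if h : IsSlice P t then some ⟨t, h⟩ else none

open Classical in
/-- `f_i` on slices. -/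
noncomputable def Slice.f (i : Fin (n + 1)) (C : Slice P l) : Option (Slice P l) :=
  (fTuple P i C.1).bind fun t => if h : IsSlice P t then some ⟨t, h⟩ else none

/-- No layer of `C` is empty. -/
def Slice.NoEmptyLayer (C : Slice P l) : Prop := ∀ j, C.1 j ≠ Column.empty

/-- A representative of the class `x` each of whose layers contains a `δ`-column. -/
noncomputable def SliceClass.rep (x : SliceClass P l) : Slice P l :=
  Slice.addDelta^[P.layers l] (Quotient.out x)

/-- `e_i` on classes, by means of a representative that is sufficiently high. -/
noncomputable def SliceClass.e (i : Fin (n + 1)) (x : SliceClass P l) : Option (SliceClass P l) :=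
  (x.rep.e i).map Slice.toClass

/-- `f_i` on classes, by means of a representative that is sufficiently high. -/
noncomputable def SliceClass.f (i : Fin (n + 1)) (x : SliceClass P l) : Option (SliceClass P l) :=
  (x.rep.f i).map Slice.toClass

/-- `ε_i(x) = max {k | e_i^k x ≠ 0}`. -/
noncomputable def SliceClass.eps (i : Fin (n + 1)) (x : SliceClass P l) : ℕ :=
  sSup {k | iterOpt (SliceClass.e i) k x ≠ none}

/-- `φ_i(x) = max {k | f_i^k x ≠ 0}`. -/
noncomputable def SliceClass.phi (i : Fin (n + 1)) (x : SliceClass P l) : ℕ :=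
  sSup {k | iterOpt (SliceClass.f i) k x ≠ none}

/-- `wt(x) = ∑ i, (φ_i(x) - ε_i(x)) Λ_i`, as an element of the classical weight lattice
`⊕ i, ℤ Λ_i`, identified with the integer vectors indexed by `0, …, n`. -/
noncomputable def SliceClass.wt (x : SliceClass P l) : Fin (n + 1) → ℤ := fun i =>
  (SliceClass.phi i x : ℤ) - (SliceClass.eps i x : ℤ)

end Operators

/-! ### Classical crystals -/

/-- The simple root `α_i = ∑ j, ⟨h_j, α_i⟩ Λ_j` in the classical weight lattice. -/
def simpleRoot {I : Type*} (A : Matrix I I ℤ) (i : I) : I → ℤ := fun j => A j i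

/-- The pairing `⟨h_i, λ⟩`, i.e. the coefficient of `Λ_i` in `λ`. -/
def coroot {I : Type*} (i : I) (weight : I → ℤ) : ℤ := weight i

/-- The axioms of a classical crystal on the set `B` for the Cartan matrix `A`; the
value `none` of `e i` or `f i` stands for the extra element `0`, and `⊥` for `-∞`. -/
structure IsClassicalCrystal {I B : Type*} (A : Matrix I I ℤ) (wt : B → I → ℤ)
    (eps phi : I → B → WithBot ℤ) (e f : I → B → Option B) : Prop where
  phi_eq : ∀ i b, phi i b = eps i b + ((coroot i (wt b) : ℤ) : WithBot ℤ)
  wt_e : ∀ i b b', e i b = some b' → wt b' = wt b + simpleRoot A i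
  wt_f : ∀ i b b', f i b = some b' → wt b' = wt b - simpleRoot A i
  eps_e : ∀ i b b', e i b = some b' → eps i b' = eps i b + ((-1 : ℤ) : WithBot ℤ)
  phi_e : ∀ i b b', e i b = some b' → phi i b' = phi i b + ((1 : ℤ) : WithBot ℤ)
  eps_f : ∀ i b b', f i b = some b' → eps i b' = eps i b + ((1 : ℤ) : WithBot ℤ)
  phi_f : ∀ i b b', f i b = some b' → phi i b' = phi i b + ((-1 : ℤ) : WithBot ℤ)
  f_iff_e : ∀ i b b', f i b = some b' ↔ e i b' = some b
  eq_none : ∀ i b, eps i b = ⊥ → e i b = none ∧ f i b = none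

end YoungSlice

open YoungSlice

/-! Fix a colour `i`. In one cycle the `i`-blocks occupy at most two storeys: one of the second
kind, preferred when blocks are added, and one of the first kind, preferred when blocks are removed
(`colour_iff_mod`). They coincide, are apart, or are adjacent in one of two orders (`Mode`).

The chain condition `c_1 ⊆ ⋯ ⊆ c_L ⊆ c_1 + δ` leaves no freedom in the choice of the layer. Among
the storeys of one residue class, a block can be added without destroying the chain only in the
lowest, back-most slot, and there it can always be added (`IsChain.slot_min`,
`IsChain.update_addBlock`); dually for removals (`Move.block_max`, `IsChain.update_removeBlock`). So
a rule is determined by the kind of storey it picks.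

Splitting is the cancellation of a signature rule. Let `a` be the number of layers with an `i`-slot
of the second kind and `b` the number of layers with a top `i`-block of the first kind. The piece
that is split is the neighbour of `i` in the cycle: it lies directly below the `i`-slots of the
second kind and directly above the `i`-blocks of the first kind (`splitPiece_spec`). Splitting
therefore disables `min a b` layers of either sort (`splitting_splitForm`), and it does so at the
extreme layers, so that the rules applied to the remaining layers choose as they would in the whole
chain. On unsplit chains the rules become the relations `AddStep` and `RemoveStep`: add in the
second kind if `a > b`, else in the first; remove from the first kind if `b > a`, else from the
second. Adding in the second kind lowers `a`, adding in the first kind raises `b`, so `min a b` does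
not change and the two relations are inverse to one another (`AddStep.removeStep`,
`RemoveStep.addStep`). For the `n`-blocks of `D_{n+1}^(2)` nothing is split; there `a = b`, and the
extra condition `a ≤ 1` gives the same conclusion.

Explicit counts `addable` and `removable` change by one in each step, and a rule gets stuck only
when its count is zero; where two blocks are moved at once, the parity condition makes the counts
even. This gives `φ_i`, `ε_i` and all axioms except those on weights. Everything commutes with `C ↦
C + δ` as long as no empty layer is involved, so it passes to classes.

For the weight, the truncations cancel in `addable - removable`, which is a constant times the
number of `j`-slots minus the number of top `j`-blocks (`addable_sub_removable`). Adding a block of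
unit depth changes this difference by the second difference, along the cycle, of the indicator
function of the colour `j`: `-2` for the colour itself and `1` for each neighbour, which is minus a
Cartan entry up to the factors due to doubled storeys and double moves (`cartan_of_addBlock`). -/

namespace YoungSlice

/-! ### Blocks and slots of a single column -/

section ColumnLemmas

variable {n : ℕ} (P : Pattern n) (i : ℕ)

/-- The `k`-th storey contains an `i`-block. -/
def HasColour (k : ℕ) : Prop := ∃ x, storeySpot P (.colour i) k = some x

/-- The `i`-blocks of the `k`-th storey have priority when blocks are added. -/
def SecondAt (k : ℕ) : Prop := ∃ x, storeySpot P (.colour i) k = some x ∧ isSecond P x = true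

/-- The `i`-blocks of the `k`-th storey have priority when blocks are removed. -/
def FirstAt (k : ℕ) : Prop := ∃ x, storeySpot P (.colour i) k = some x ∧ isFirst P x = true

/-- The column `c` has a slot for an `i`-block, in a storey satisfying `p`. -/
def SlotAt (p : ℕ → Prop) (c : Column) : Prop :=
  p c.full ∧ ∀ s, c.half = some s → P.halfColour s ≠ i

/-- The storey `h` contains the top block of `c`; if it is half-filled, then by an `i`-block. -/
def TopAt (c : Column) (h : ℕ) : Prop :=
  (c.half = none ∧ c.full = h + 1) ∨ (c.full = h ∧ ∃ s, c.half = some s ∧ P.halfColour s = i)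

/-- The column `c` has an `i`-block on top, in a storey satisfying `p`. -/
def BlockAt (p : ℕ → Prop) (c : Column) : Prop := ∃ h, p h ∧ TopAt P i c h

variable {P i}

theorem TopAt.unique {c : Column} {h h' : ℕ} (H : TopAt P i c h) (H' : TopAt P i c h') : h = h' := by
  rcases H with ⟨a, b⟩ | ⟨a, s, b, -⟩ <;> rcases H' with ⟨a', b'⟩ | ⟨a', s', b', -⟩
  · omega
  · simp [a] at b'
  · simp [a'] at b
  · omega

theorem SecondAt.hasColour {k : ℕ} (h : SecondAt P i k) : HasColour P i k := by
  obtain ⟨x, hx, -⟩ := h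
  exact ⟨x, hx⟩

theorem FirstAt.hasColour {k : ℕ} (h : FirstAt P i k) : HasColour P i k := by
  obtain ⟨x, hx, -⟩ := h
  exact ⟨x, hx⟩

theorem storeySpot_height {q : Piece} {k : ℕ} {x : Spot} (h : storeySpot P q k = some x) :
    x.height = k := by
  unfold storeySpot at h
  cases hs : P.storey k <;> cases q <;> simp only [hs] at h <;>
    first
    | (split_ifs at h; simp at h; subst h; rfl)
    | (simp at h; try subst h; try rfl)

theorem halfColour_le_one (s : Bool) : P.halfColour s ≤ 1 := by
  cases P <;> simp only [Pattern.halfColour] <;> split_ifs <;> omega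

theorem halfColour_not (s : Bool) : P.halfColour (!s) = 1 - P.halfColour s := by
  cases P <;> simp only [Pattern.halfColour] <;> cases s <;> simp <;>
    (rename_i z; cases z <;> simp)

theorem sideOf_halfColour {s : Bool} : P.sideOf (P.halfColour s) = s := by
  have h := halfColour_not (P := P) true
  have h1 := halfColour_le_one (P := P) true
  cases s
  · simp only [Bool.not_true] at h
    simp only [Pattern.sideOf, decide_eq_false_iff_not]
    omega
  · simp [Pattern.sideOf]

theorem halfColour_sideOf (hi : i ≤ 1) : P.halfColour (P.sideOf i) = i := by
  have h := halfColour_not (P := P) true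
  have h1 := halfColour_le_one (P := P) true
  by_cases hs : P.halfColour true = i
  · simp [Pattern.sideOf, hs]
  · simp only [Pattern.sideOf, hs, decide_false]
    simp only [Bool.not_true] at h
    omega

theorem storeySpot_halves {k : ℕ} (h : P.storey k = .halves) :
    storeySpot P (.colour i) k = if i ≤ 1 then some ⟨k, true, true⟩ else none := by
  simp [storeySpot, h]

theorem HasColour.le_one {k : ℕ} (h : HasColour P i k) (hk : P.storey k = .halves) : i ≤ 1 := by
  obtain ⟨x, hx⟩ := h
  rw [storeySpot_halves hk] at hx
  by_contra hi
  simp [hi] at hx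

/-- In a half-filled storey the free half has the other one of the colours `0`, `1`; so half-filled
and level columns obey one criterion: the storey contains the colour, and its half-block is not
there yet. -/
theorem topSlot_eq_some {c : Column} (hc : c.Valid P) {x : Spot} :
    topSlot P (.colour i) c = some x ↔
      storeySpot P (.colour i) c.full = some x ∧ ∀ s, c.half = some s → P.halfColour s ≠ i := by
  obtain ⟨k, o⟩ := c
  cases o with
  | none => simp [topSlot]
  | some s =>
    have hk : P.storey k = .halves := hc rfl
    have h1 := halfColour_le_one (P := P) s
    simp only [topSlot, halfColour_not, storeySpot_halves hk, Option.some.injEq, forall_eq']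
    by_cases h : P.halfColour s = i
    · have h2 : ¬ (1 - i = i) := by omega
      simp [h, h2]
    · by_cases h2 : i ≤ 1
      · have : 1 - P.halfColour s = i := by omega
        simp [this, h, h2]
      · have : ¬ (1 - P.halfColour s = i) := by omega
        simp [this, h, h2]

theorem topBlock_eq_some {c : Column} (hc : c.Valid P) {x : Spot} :
    topBlock P (.colour i) c = some x ↔
      storeySpot P (.colour i) x.height = some x ∧ TopAt P i c x.height := by
  obtain ⟨k, o⟩ := c
  cases o with
  | none =>
    simp only [topBlock, TopAt, true_and, reduceCtorEq, false_and, exists_false, and_false, or_false]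
    by_cases hk : k = 0
    · simp [hk]
    · rw [if_neg hk]
      constructor
      · intro h
        have := storeySpot_height h
        rw [this]
        exact ⟨h, by omega⟩
      · rintro ⟨h, h'⟩
        rw [show k - 1 = x.height by omega]
        exact h
  | some s =>
    have hk : P.storey k = .halves := hc rfl
    have h1 := halfColour_le_one (P := P) s
    simp only [topBlock, TopAt, reduceCtorEq, false_and, false_or, Option.some.injEq,
      exists_eq_left']
    by_cases h : P.halfColour s = i
    · have hi : i ≤ 1 := by omega
      simp only [h, if_true, and_true, Option.some.injEq]
      constructor
      · rintro rfl
        refine ⟨?_, rfl⟩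
        rw [storeySpot_halves hk, if_pos hi]
      · rintro ⟨h2, h3⟩
        rw [← h3, storeySpot_halves hk, if_pos hi] at h2
        exact Option.some.inj h2
    · simp [h]

theorem addBlock_cases {c : Column} (hc : c.Valid P) :
    (c.half = none ∧ P.storey c.full = .halves ∧ addBlock P i c = ⟨c.full, some (P.sideOf i)⟩) ∨
    (c.half = none ∧ P.storey c.full ≠ .halves ∧ addBlock P i c = ⟨c.full + 1, none⟩) ∨
    ((∃ s, c.half = some s) ∧ P.storey c.full = .halves ∧ addBlock P i c = ⟨c.full + 1, none⟩) := by
  obtain ⟨k, o⟩ := c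
  cases o with
  | none =>
    cases h : P.storey k
    · right; left; simp [addBlock, h]
    · left; simp [addBlock, h]
  | some s =>
    have hk : P.storey k = .halves := hc rfl
    right; right
    simp [addBlock, hk]

variable {p : ℕ → Prop} {c d : Column}

theorem valid_addBlock (hc : c.Valid P) : (addBlock P i c).Valid P := by
  rcases addBlock_cases (i := i) hc with ⟨h1, h2, h⟩ | ⟨h1, h2, h⟩ | ⟨h1, h2, h⟩ <;> rw [h]
  · intro _; exact h2
  · intro h; simp at h
  · intro h; simp at h

theorem topAt_addBlock (hc : c.Valid P) (hI : HasColour P i c.full) :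
    TopAt P i (addBlock P i c) c.full := by
  rcases addBlock_cases (i := i) hc with ⟨h1, h2, h⟩ | ⟨h1, h2, h⟩ | ⟨h1, h2, h⟩ <;> rw [h]
  · exact Or.inr ⟨rfl, _, rfl, halfColour_sideOf (hI.le_one h2)⟩
  · exact Or.inl ⟨rfl, rfl⟩
  · exact Or.inl ⟨rfl, rfl⟩

theorem removeBlock_addBlock (hc : c.Valid P) (hI : HasColour P i c.full)
    (hs : ∀ s, c.half = some s → P.halfColour s ≠ i) :
    removeBlock P i (addBlock P i c) = c := by
  obtain ⟨k, o⟩ := c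
  rcases addBlock_cases (i := i) hc with ⟨h1, h2, h⟩ | ⟨h1, h2, h⟩ | ⟨h1, h2, h⟩ <;> rw [h]
  · simp only at h1
    simp [removeBlock, h1]
  · simp only at h1 h2
    cases hk : P.storey k with
    | halves => exact absurd hk h2
    | unit => simp [removeBlock, hk, h1]
  · obtain ⟨s, h1⟩ := h1
    simp only at h1 h2 hI hs
    simp only [removeBlock, Nat.add_sub_cancel, h2, h1, Column.mk.injEq, true_and, Option.some.injEq]
    have := hs s h1
    have h3 := hI.le_one h2
    have h4 := halfColour_not (P := P) s
    have h5 := halfColour_le_one (P := P) s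
    have h6 := sideOf_halfColour (P := P) (s := !s)
    rw [show P.halfColour (!s) = i by omega] at h6
    simp [h6]

/-- Removal is treated as the inverse of addition, so that inclusions need to be analysed for
`addBlock` only. -/
theorem removeBlock_spec (hc : c.Valid P) {h : ℕ} (hI : HasColour P i h) (ht : TopAt P i c h) :
    (removeBlock P i c).Valid P ∧ (removeBlock P i c).full = h ∧
      (∀ s, (removeBlock P i c).half = some s → P.halfColour s ≠ i) ∧
      addBlock P i (removeBlock P i c) = c := by
  obtain ⟨k, o⟩ := c
  rcases ht with ⟨h1, h2⟩ | ⟨h1, s, h2, h3⟩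
  · simp only at h1 h2
    subst h1 h2
    cases hk : P.storey h with
    | halves =>
      have hi := hI.le_one hk
      have h4 := halfColour_not (P := P) (P.sideOf i)
      rw [halfColour_sideOf hi] at h4
      simp only [removeBlock, Nat.add_sub_cancel, hk, Column.Valid, addBlock]
      refine ⟨fun _ => trivial, trivial, ?_, trivial⟩
      rintro s hs
      simp only [Option.some.injEq] at hs
      rw [← hs, h4]
      omega
    | unit =>
      simp [removeBlock, hk, Column.Valid, addBlock]
  · simp only at h1 h2
    subst h1 h2
    have hk : P.storey k = .halves := hc rfl
    simp only [removeBlock, Column.Valid, addBlock, hk, ← h3, sideOf_halfColour]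
    simp

theorem sub_addBlock_self (hc : c.Valid P) : c.Sub (addBlock P i c) := by
  rcases addBlock_cases (i := i) hc with ⟨h1, h2, h⟩ | ⟨h1, h2, h⟩ | ⟨h1, h2, h⟩ <;> rw [h] <;>
    simp [Column.Sub, h1]

theorem Column.Sub.trans {c d e : Column} (h : c.Sub d) (h' : d.Sub e) : c.Sub e := by
  rw [sub_iff_cells] at h h' ⊢
  exact Set.Subset.trans h h'

theorem Column.Sub.refl (c : Column) : c.Sub c := Or.inr ⟨rfl, Or.inr rfl⟩

/-- A column above `c` in which the `i`-slot of `c` is filled contains `c` with an `i`-block added. -/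
theorem addBlock_sub (hc : c.Valid P) (hd : d.Valid P) (hcd : c.Sub d) (hs : SlotAt P i p c)
    (hn : ¬ (SlotAt P i p d ∧ d.full = c.full)) : (addBlock P i c).Sub d := by
  rcases hcd with hlt | ⟨heq, hcd⟩
  · rcases addBlock_cases (i := i) hc with ⟨h1, h2, h⟩ | ⟨h1, h2, h⟩ | ⟨h1, h2, h⟩ <;> rw [h] <;>
      simp only [Column.Sub, true_or, and_true] <;> omega
  · have hd' : ∃ s, d.half = some s ∧ P.halfColour s = i := by
      by_contra hne
      push Not at hne
      exact hn ⟨⟨heq ▸ hs.1, hne⟩, heq.symm⟩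
    obtain ⟨s, hs1, hs2⟩ := hd'
    rcases hcd with h0 | h0
    · have hk : P.storey c.full = .halves := by
        rw [heq]; exact hd (by simp [hs1])
      have : addBlock P i c = ⟨c.full, some (P.sideOf i)⟩ := by
        simp [addBlock, h0, hk]
      rw [this, ← hs2, sideOf_halfColour]
      exact Or.inr ⟨heq, Or.inr hs1.symm⟩
    · exact absurd hs2 (hs.2 s (h0.trans hs1))

/-- The cell filled by the new block is missing from `d`, whose `i`-slot is still open at that
height or below. This obstruction forces the choice of the layer. -/
theorem not_addBlock_sub (hc : c.Valid P) (hI : HasColour P i c.full) (hd : SlotAt P i p d)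
    (hle : d.full ≤ c.full) : ¬ (addBlock P i c).Sub d := by
  intro hsub
  rcases addBlock_cases (i := i) hc with ⟨h1, h2, h⟩ | ⟨h1, h2, h⟩ | ⟨h1, h2, h⟩ <;>
    rw [h] at hsub <;> simp only [Column.Sub] at hsub
  · have h3 : some (P.sideOf i) = d.half := by
      rcases hsub with hsub | ⟨-, hsub | hsub⟩
      · omega
      · simp at hsub
      · exact hsub
    exact hd.2 _ h3.symm (halfColour_sideOf (hI.le_one h2))
  · omega
  · omega

/-- A column below `c` plus an `i`-block without an `i`-block at that place is contained in `c`. -/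
theorem sub_of_sub_addBlock (hc : c.Valid P) (hd : d.Valid P) (hI : HasColour P i c.full)
    (hs : ∀ s, c.half = some s → P.halfColour s ≠ i)
    (hsub : d.Sub (addBlock P i c)) (hn : ¬ TopAt P i d c.full) : d.Sub c := by
  have key : d.full < c.full ∨ (d.full = c.full ∧ (d.half = none ∨ d.half = c.half)) ∨
      (d.full = c.full ∧ ∃ s, d.half = some s ∧ d.half ≠ c.half) ∨ (d.full = c.full + 1) ∨
      c.full + 1 < d.full := by
    by_cases h1 : d.full = c.full
    · cases h2 : d.half with
      | none => simp [h1]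
      | some s => by_cases h3 : some s = c.half <;> simp [h1, h3]
    · omega
  rcases key with h | h | ⟨h, s, h1, h2⟩ | h | h
  · exact Or.inl h
  · exact Or.inr h
  · exfalso
    have hk : P.storey c.full = .halves := by rw [← h]; exact hd (by simp [h1])
    have hi := hI.le_one hk
    have hsi : P.halfColour s ≠ i := fun hsi => hn (Or.inr ⟨h, s, h1, hsi⟩)
    rcases addBlock_cases (i := i) hc with ⟨h3, -, h4⟩ | ⟨h3, h4, -⟩ | ⟨⟨t, h3⟩, -, h4⟩
    · rw [h4] at hsub
      simp only [Column.Sub, h1] at hsub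
      rcases hsub with hsub | ⟨-, hsub | hsub⟩
      · omega
      · simp at hsub
      · simp only [Option.some.injEq] at hsub
        rw [hsub] at hsi
        exact hsi (halfColour_sideOf hi)
    · exact h4 hk
    · have hti := hs t h3
      have : s ≠ t := by rintro rfl; exact h2 (h1.trans h3.symm)
      -- The two halves carry the colours `0` and `1`, so one of `s`, `t` has colour `i`, against
      -- both `hsi` and `hti`.
      have hst : t = !s := by cases s <;> cases t <;> simp_all
      have h5 := halfColour_not (P := P) s
      have h6 := halfColour_le_one (P := P) s
      rw [hst] at hti
      omega
  · exfalso
    cases h1 : d.half with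
    | none => exact hn (Or.inl ⟨h1, h⟩)
    | some s =>
      rcases addBlock_cases (i := i) hc with ⟨-, -, h4⟩ | ⟨-, -, h4⟩ | ⟨-, -, h4⟩ <;>
      · rw [h4] at hsub
        simp only [Column.Sub, h1] at hsub
        rcases hsub with hsub | ⟨hsub', hsub | hsub⟩
        · omega
        · simp at hsub
        · first
          | omega
          | simp at hsub
  · exfalso
    rcases addBlock_cases (i := i) hc with ⟨-, -, h4⟩ | ⟨-, -, h4⟩ | ⟨-, -, h4⟩ <;>
    · rw [h4] at hsub
      simp only [Column.Sub] at hsub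
      omega

/-- The top `i`-block of `d` occupies a cell that `c` lacks. -/
theorem not_sub_of_topAt {h : ℕ} (hs : ∀ s, c.half = some s → P.halfColour s ≠ i)
    (ht : TopAt P i d h) (hle : c.full ≤ h) : ¬ d.Sub c := by
  intro hsub
  rcases ht with ⟨h1, h2⟩ | ⟨h1, s, h2, h3⟩ <;> simp only [Column.Sub] at hsub
  · omega
  · rcases hsub with hsub | ⟨-, hsub | hsub⟩
    · omega
    · simp [h2] at hsub
    · exact hs s (hsub ▸ h2) h3

/-! #### Adding a cycle -/

theorem storeySpot_add_period (q : Piece) (k : ℕ) :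
    storeySpot P q (k + P.period) =
      (storeySpot P q k).map fun x => ⟨x.height + P.period, x.cov, x.supp⟩ := by
  unfold storeySpot
  rw [storey_add_period]
  cases P.storey k <;> cases q <;> simp

theorem hasColour_add_period (k : ℕ) : HasColour P i (k + P.period) ↔ HasColour P i k := by
  simp only [HasColour, storeySpot_add_period]
  cases storeySpot P (.colour i) k <;> simp

theorem secondAt_add_period (k : ℕ) : SecondAt P i (k + P.period) ↔ SecondAt P i k := by
  simp only [SecondAt, storeySpot_add_period]
  cases storeySpot P (.colour i) k <;> simp [isSecond]

theorem firstAt_add_period (k : ℕ) : FirstAt P i (k + P.period) ↔ FirstAt P i k := by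
  simp only [FirstAt, storeySpot_add_period]
  cases storeySpot P (.colour i) k <;> simp [isFirst]

theorem valid_addDelta : (c.addDelta P).Valid P ↔ c.Valid P := by
  simp only [Column.Valid, Column.addDelta, storey_add_period]

theorem addBlock_addDelta : addBlock P i (c.addDelta P) = (addBlock P i c).addDelta P := by
  obtain ⟨k, o⟩ := c
  simp only [addBlock, Column.addDelta, storey_add_period]
  cases o <;> cases P.storey k <;> simp [Nat.add_right_comm]

theorem slotAt_addDelta (hp : ∀ k, p (k + P.period) ↔ p k) :
    SlotAt P i p (c.addDelta P) ↔ SlotAt P i p c := by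
  simp [SlotAt, Column.addDelta, hp]

theorem topAt_addDelta {h : ℕ} : TopAt P i (c.addDelta P) (h + P.period) ↔ TopAt P i c h := by
  simp only [TopAt, Column.addDelta]
  constructor
  · rintro (⟨h1, h2⟩ | ⟨h1, h2⟩)
    · exact Or.inl ⟨h1, by omega⟩
    · exact Or.inr ⟨by omega, h2⟩
  · rintro (⟨h1, h2⟩ | ⟨h1, h2⟩)
    · exact Or.inl ⟨h1, by omega⟩
    · exact Or.inr ⟨by omega, h2⟩

theorem addDelta_sub_addDelta : (c.addDelta P).Sub (d.addDelta P) ↔ c.Sub d := by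
  simp only [Column.Sub, Column.addDelta]
  constructor <;> rintro (h | h)
  · left; omega
  · right; exact ⟨by omega, h.2⟩
  · left; omega
  · right; exact ⟨by omega, h.2⟩

theorem period_pos : 0 < P.period := by
  cases P <;> simp [Pattern.period] <;> omega

theorem sub_addDelta_self : c.Sub (c.addDelta P) := by
  have := period_pos (P := P)
  simp only [Column.Sub, Column.addDelta]
  omega

end ColumnLemmas

end YoungSlice

namespace YoungSlice

/-! ### Choosing a layer -/

section ChoiceLemmas

variable {L : ℕ} {spot : Fin L → Option Spot}

/-- Every index passing the test has minimal height, and in the reversed list larger indices come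
first, so an equally low spot further back would have been found earlier. -/
theorem lowBack_eq_some {j : Fin L} (h : lowBack spot = some j) :
    ∃ x, spot j = some x ∧ ∀ k y, spot k = some y →
      x.height < y.height ∨ (x.height = y.height ∧ k ≤ j) := by
  rw [lowBack, List.find?_eq_some_iff_append] at h
  obtain ⟨hp, as, bs, hab, has⟩ := h
  rw [Option.any_eq_true] at hp
  obtain ⟨x, hx, hall⟩ := hp
  have hmin : ∀ k y, spot k = some y → x.height ≤ y.height := by
    intro k y hy
    rw [List.all_eq_true] at hall
    have := hall k (List.mem_finRange k)
    simpa [hy] using this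
  refine ⟨x, hx, fun k y hy => ?_⟩
  rcases (hmin k y hy).lt_or_eq with h | h
  · exact Or.inl h
  · refine Or.inr ⟨h, ?_⟩
    by_contra hlt
    push Not at hlt
    have hk : k ∈ (List.finRange L).reverse := by simp
    have hsort : (List.finRange L).reverse.Pairwise (· > ·) := by
      rw [List.pairwise_reverse]
      exact List.pairwise_lt_finRange L
    rw [hab] at hk hsort
    rw [List.mem_append, List.mem_cons] at hk
    rcases hk with hk | hk | hk
    · have h1 := has k hk
      simp only [Bool.not_eq_true', Option.any_eq_false] at h1
      have h2 := h1 y hy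
      rw [List.all_eq_true] at hall
      rw [← Bool.not_eq_true, List.all_eq_true] at h2
      refine absurd ?_ h2
      intro m hm
      have h3 := hall m hm
      rw [h] at h3
      exact h3
    · exact absurd hk hlt.ne'
    · rw [List.pairwise_append, List.pairwise_cons] at hsort
      exact absurd (hsort.2.1.1 k hk) (not_lt.mpr hlt.le)

theorem highFront_eq_some {j : Fin L} (h : highFront spot = some j) :
    ∃ x, spot j = some x ∧ ∀ k y, spot k = some y →
      y.height < x.height ∨ (y.height = x.height ∧ j ≤ k) := by
  rw [highFront, List.find?_eq_some_iff_append] at h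
  obtain ⟨hp, as, bs, hab, has⟩ := h
  rw [Option.any_eq_true] at hp
  obtain ⟨x, hx, hall⟩ := hp
  have hmin : ∀ k y, spot k = some y → y.height ≤ x.height := by
    intro k y hy
    rw [List.all_eq_true] at hall
    have := hall k (List.mem_finRange k)
    simpa [hy] using this
  refine ⟨x, hx, fun k y hy => ?_⟩
  rcases (hmin k y hy).lt_or_eq with h | h
  · exact Or.inl h
  · refine Or.inr ⟨h, ?_⟩
    by_contra hlt
    push Not at hlt
    have hk : k ∈ List.finRange L := by simp
    have hsort : (List.finRange L).Pairwise (· < ·) := List.pairwise_lt_finRange L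
    rw [hab] at hk hsort
    rw [List.mem_append, List.mem_cons] at hk
    rcases hk with hk | hk | hk
    · have h1 := has k hk
      simp only [Bool.not_eq_true', Option.any_eq_false] at h1
      have h2 := h1 y hy
      rw [List.all_eq_true] at hall
      rw [← Bool.not_eq_true, List.all_eq_true] at h2
      refine absurd ?_ h2
      intro m hm
      have h3 := hall m hm
      rw [← h] at h3
      exact h3
    · exact absurd hk hlt.ne
    · rw [List.pairwise_append, List.pairwise_cons] at hsort
      exact absurd (hsort.2.1.1 k hk) (not_lt.mpr hlt.le)

theorem lowBack_eq_none : lowBack spot = none ↔ ∀ k, spot k = none := by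
  constructor
  · intro h k
    rw [lowBack, List.find?_eq_none] at h
    by_contra hk
    -- The default height `0` plays no role, since the minimum is taken over the indices that do
    -- have a spot.
    obtain ⟨j, hj, hmin⟩ := Finset.exists_min_image
      (Finset.univ.filter fun k => spot k ≠ none) (fun k => ((spot k).map Spot.height).getD 0)
      ⟨k, by simpa using hk⟩
    simp only [Finset.mem_filter, Finset.mem_univ, true_and] at hj hmin
    obtain ⟨x, hx⟩ := Option.ne_none_iff_exists'.mp hj
    apply h j (by simp)
    rw [Option.any_eq_true]
    refine ⟨x, hx, ?_⟩
    rw [List.all_eq_true]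
    intro m _
    cases hm : spot m with
    | none => rfl
    | some y => simpa [hx, hm] using hmin m (by simp [hm])
  · intro h
    simp [lowBack, List.find?_eq_none, h]

theorem highFront_eq_none : highFront spot = none ↔ ∀ k, spot k = none := by
  constructor
  · intro h k
    rw [highFront, List.find?_eq_none] at h
    by_contra hk
    obtain ⟨j, hj, hmin⟩ := Finset.exists_max_image
      (Finset.univ.filter fun k => spot k ≠ none) (fun k => ((spot k).map Spot.height).getD 0)
      ⟨k, by simpa using hk⟩
    simp only [Finset.mem_filter, Finset.mem_univ, true_and] at hj hmin
    obtain ⟨x, hx⟩ := Option.ne_none_iff_exists'.mp hj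
    apply h j (by simp)
    rw [Option.any_eq_true]
    refine ⟨x, hx, ?_⟩
    rw [List.all_eq_true]
    intro m _
    cases hm : spot m with
    | none => rfl
    | some y => simpa [hx, hm] using hmin m (by simp [hm])
  · intro h
    simp [highFront, List.find?_eq_none, h]

end ChoiceLemmas

/-! ### Chains of columns -/

section Chains

variable {n : ℕ} (P : Pattern n) (i : ℕ) {L : ℕ}

/-- A tuple of columns `c_1 ⊆ ⋯ ⊆ c_L ⊆ c_1 + δ`. -/
structure IsChain (C : Fin L → Column) : Prop where
  valid : ∀ j, (C j).Valid P
  mono : ∀ j k, j ≤ k → (C j).Sub (C k)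
  sub_addDelta : ∀ j k, (C k).Sub ((C j).addDelta P)

/-- The chain `C'` arises from the chain `C` by adding an `i`-block in the storey `k`. -/
def Move (C C' : Fin L → Column) (k : ℕ) : Prop :=
  IsChain P C ∧ IsChain P C' ∧ ∃ j, SlotAt P i (HasColour P i) (C j) ∧ (C j).full = k ∧
    C' = Function.update C j (addBlock P i (C j))

variable {P i} {C C' C₁ C₂ : Fin L → Column} {p : ℕ → Prop}

theorem IsSlice.isChain (h : IsSlice P C) : IsChain P C := ⟨h.valid, h.mono, h.sub_addDelta⟩

theorem IsChain.isSlice (h : IsChain P C) (h' : ExtraCondition P C) : IsSlice P C :=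
  ⟨h.valid, h.mono, h.sub_addDelta, h'⟩

theorem SlotAt.imp {p q : ℕ → Prop} {c : Column} (h : SlotAt P i p c) (hpq : p c.full → q c.full) :
    SlotAt P i q c := ⟨hpq h.1, h.2⟩

/-- An inclusion can break only if the enlarged column is the smaller one and the larger one has the
same slot open in the same storey. For `C j ⊆ C m` that slot would be equally low and further back;
for `C j ⊆ C k + δ` it would be a slot of `C k` one period lower. Minimality of `j` excludes both.
-/
theorem IsChain.update_addBlock (hC : IsChain P C) (hper : ∀ k, p (k + P.period) ↔ p k)
    {j : Fin L} (hj : SlotAt P i p (C j))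
    (hmin : ∀ k, SlotAt P i p (C k) →
      (C j).full < (C k).full ∨ ((C j).full = (C k).full ∧ k ≤ j)) :
    IsChain P (Function.update C j (addBlock P i (C j))) := by
  have hv := hC.valid
  refine ⟨fun k => ?_, fun k m hkm => ?_, fun k m => ?_⟩
  · rcases eq_or_ne k j with rfl | hk
    · simpa using valid_addBlock (hv k)
    · simpa [hk] using hv k
  · rcases eq_or_ne k j with rfl | hk <;> rcases eq_or_ne m k with rfl | hm
    · exact Column.Sub.refl _
    · simp only [Function.update_self, Function.update_of_ne hm]
      refine addBlock_sub (hv k) (hv m) (hC.mono k m hkm) hj ?_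
      rintro ⟨h1, h2⟩
      have := hmin m h1
      have h3 : k < m := lt_of_le_of_ne hkm (Ne.symm hm)
      omega
    · exact Column.Sub.refl _
    · rcases eq_or_ne m j with rfl | hmj
      · simp only [Function.update_self, Function.update_of_ne hk]
        exact (hC.mono k m hkm).trans (sub_addBlock_self (hv m))
      · simpa [hk, hmj] using hC.mono k m hkm
  · rcases eq_or_ne k m with rfl | hkm
    · exact sub_addDelta_self
    · rcases eq_or_ne m j with rfl | hm
      · simp only [Function.update_self, Function.update_of_ne hkm]
        refine addBlock_sub (hv m) (valid_addDelta.mpr (hv k)) (hC.sub_addDelta k m) hj ?_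
        rintro ⟨h1, h2⟩
        rw [slotAt_addDelta hper] at h1
        have := hmin k h1
        have := period_pos (P := P)
        simp only [Column.addDelta] at h2
        omega
      · rcases eq_or_ne k j with rfl | hk
        · simp only [Function.update_self, Function.update_of_ne hm]
          exact (hC.sub_addDelta k m).trans (addDelta_sub_addDelta.mpr (sub_addBlock_self (hv k)))
        · simpa [hk, hm] using hC.sub_addDelta k m

/-- Converse of `IsChain.update_addBlock`. A lower slot of the same residue class is lower by at
least a period, so the enlarged `C j` would leave `C j' + δ`; an equally low slot further back would
break the chain itself. -/
theorem IsChain.slot_min (hC : IsChain P C) (hper : ∀ k, p (k + P.period) ↔ p k)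
    (hres : ∀ k k', p k → p k' → k % P.period = k' % P.period) {j j' : Fin L}
    (hI : HasColour P i (C j).full)
    (hC' : IsChain P (Function.update C j (addBlock P i (C j))))
    (hj : SlotAt P i p (C j)) (hj' : SlotAt P i p (C j')) :
    (C j).full < (C j').full ∨ ((C j).full = (C j').full ∧ j' ≤ j) := by
  rcases eq_or_ne j j' with rfl | hne
  · exact Or.inr ⟨rfl, le_rfl⟩
  by_contra hcon
  push Not at hcon
  rcases lt_or_eq_of_le hcon.1 with hlt | heq
  · have h1 := hC'.sub_addDelta j' j
    simp only [Function.update_self, Function.update_of_ne hne.symm] at h1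
    refine not_addBlock_sub (hC.valid j) hI ((slotAt_addDelta hper).mpr hj') ?_ h1
    have h2 := hres _ _ hj.1 hj'.1
    simp only [Column.addDelta]
    have h3 : (C j).full ≡ (C j').full [MOD P.period] := h2
    have h4 := (Nat.modEq_iff_dvd' hlt.le).mp h3.symm
    have h5 := Nat.le_of_dvd (by omega) h4
    omega
  · have h1 := hC'.mono j j' (hcon.2 heq.symm).le
    simp only [Function.update_self, Function.update_of_ne hne.symm] at h1
    exact not_addBlock_sub (hC.valid j) hI hj' heq.le h1

/-- Both layers are extremal among the `p`-slots, hence equal: the residue class of the storey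
determines the result. -/
theorem Move.unique (h₁ : Move P i C C₁ k₁) (h₂ : Move P i C C₂ k₂)
    (hper : ∀ k, p (k + P.period) ↔ p k)
    (hres : ∀ k k', p k → p k' → k % P.period = k' % P.period) (hp₁ : p k₁) (hp₂ : p k₂) :
    C₁ = C₂ := by
  obtain ⟨hC, hC₁, j₁, hs₁, rfl, rfl⟩ := h₁
  obtain ⟨-, hC₂, j₂, hs₂, rfl, rfl⟩ := h₂
  have h1 := hC.slot_min hper hres hs₁.1 hC₁ ⟨hp₁, hs₁.2⟩ (j' := j₂) ⟨hp₂, hs₂.2⟩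
  have h2 := hC.slot_min hper hres hs₂.1 hC₂ ⟨hp₂, hs₂.2⟩ (j' := j₁) ⟨hp₁, hs₁.2⟩
  have : j₁ = j₂ := by
    apply le_antisymm <;> omega
  rw [this]

theorem IsChain.update_removeBlock (hC : IsChain P C) (hper : ∀ k, p (k + P.period) ↔ p k)
    {j : Fin L} {h : ℕ} (hI : HasColour P i h) (hp : p h) (hj : TopAt P i (C j) h)
    (hmax : ∀ k h', p h' → TopAt P i (C k) h' → h' < h ∨ (h' = h ∧ j ≤ k)) :
    IsChain P (Function.update C j (removeBlock P i (C j))) := by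
  have hv := hC.valid
  obtain ⟨r1, r2, r3, r4⟩ := removeBlock_spec (hv j) hI hj
  have hsub : (removeBlock P i (C j)).Sub (C j) := by
    conv_rhs => rw [← r4]
    exact sub_addBlock_self r1
  have hI' : HasColour P i (removeBlock P i (C j)).full := r2 ▸ hI
  refine ⟨fun k => ?_, fun k m hkm => ?_, fun k m => ?_⟩
  · rcases eq_or_ne k j with rfl | hk
    · simpa using r1
    · simpa [hk] using hv k
  · rcases eq_or_ne k m with rfl | hne
    · exact Column.Sub.refl _
    · rcases eq_or_ne k j with rfl | hk
      · simp only [Function.update_self, Function.update_of_ne hne.symm]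
        exact hsub.trans (hC.mono k m hkm)
      · rcases eq_or_ne m j with rfl | hm
        · simp only [Function.update_self, Function.update_of_ne hk]
          refine sub_of_sub_addBlock r1 (hv k) hI' r3 (r4.symm ▸ hC.mono k m hkm) ?_
          intro ht
          have := hmax k _ (r2 ▸ hp) ht
          have h3 : k < m := lt_of_le_of_ne hkm hne
          omega
        · simpa [hk, hm] using hC.mono k m hkm
  · rcases eq_or_ne k m with rfl | hne
    · exact sub_addDelta_self
    · rcases eq_or_ne m j with rfl | hm
      · simp only [Function.update_self, Function.update_of_ne hne]
        exact hsub.trans (hC.sub_addDelta k m)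
      · rcases eq_or_ne k j with rfl | hk
        · simp only [Function.update_self, Function.update_of_ne hm]
          -- Removal is compatible with `δ` because addition is; this turns the bound by `C k + δ`
          -- into one to which `sub_of_sub_addBlock` applies.
          have e1 : addBlock P i ((removeBlock P i (C k)).addDelta P) = (C k).addDelta P := by
            rw [addBlock_addDelta, r4]
          refine sub_of_sub_addBlock (valid_addDelta.mpr r1) (hv m)
            ((hasColour_add_period _).mpr hI') r3 (e1.symm ▸ hC.sub_addDelta k m) ?_
          intro ht
          have := hmax m _ ((hper _).mpr (r2 ▸ hp)) ht
          have := period_pos (P := P)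
          omega
        · simpa [hk, hm] using hC.sub_addDelta k m

/-- Dual of `IsChain.slot_min`: in `C'` the new block is the highest, front-most one of its residue
class. A higher one would be at least a period above, outside `C j + δ`, and an equally high one
further forward would not lie in `C j`; here the chain condition of `C`, not of `C'`, is used. -/
theorem Move.block_max (hm : Move P i C C' k)
    (hres : ∀ k k', p k → p k' → k % P.period = k' % P.period) (hp : p k) :
    ∃ j, TopAt P i (C' j) k ∧ C = Function.update C' j (removeBlock P i (C' j)) ∧
      ∀ j' h', p h' → TopAt P i (C' j') h' → h' < k ∨ (h' = k ∧ j ≤ j') := by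
  obtain ⟨hC, hC', j, hs, rfl, rfl⟩ := hm
  refine ⟨j, ?_, ?_, fun j' h' hp' ht => ?_⟩
  · simpa using topAt_addBlock (hC.valid j) hs.1
  · simp [removeBlock_addBlock (hC.valid j) hs.1 hs.2]
  · rcases eq_or_ne j' j with rfl | hne
    · simp only [Function.update_self] at ht
      exact Or.inr ⟨ht.unique (topAt_addBlock (hC.valid j') hs.1), le_rfl⟩
    · rw [Function.update_of_ne hne] at ht
      by_contra hcon
      push Not at hcon
      rcases lt_or_eq_of_le hcon.1 with hlt | heq
      · refine not_sub_of_topAt (c := (C j).addDelta P) hs.2 ht ?_ (hC.sub_addDelta j j')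
        have h3 : (C j).full ≡ h' [MOD P.period] := hres _ _ hp hp'
        have h4 := (Nat.modEq_iff_dvd' hlt.le).mp h3
        have h5 := Nat.le_of_dvd (by omega) h4
        simp only [Column.addDelta]
        omega
      · exact not_sub_of_topAt hs.2 ht heq.le (hC.mono j' j (hcon.2 heq.symm).le)

theorem Move.unique_left (h₁ : Move P i C₁ C k₁) (h₂ : Move P i C₂ C k₂)
    (hres : ∀ k k', p k → p k' → k % P.period = k' % P.period) (hp₁ : p k₁) (hp₂ : p k₂) :
    C₁ = C₂ := by
  obtain ⟨j₁, t₁, e₁, m₁⟩ := h₁.block_max hres hp₁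
  obtain ⟨j₂, t₂, e₂, m₂⟩ := h₂.block_max hres hp₂
  have h1 := m₁ j₂ k₂ hp₂ t₂
  have h2 := m₂ j₁ k₁ hp₁ t₁
  have : j₁ = j₂ := by
    apply le_antisymm <;> omega
  rw [e₁, e₂, this]

theorem IsChain.move_add (hC : IsChain P C) (hper : ∀ k, p (k + P.period) ↔ p k)
    {j : Fin L} (hI : HasColour P i (C j).full) (hj : SlotAt P i p (C j))
    (hmin : ∀ k, SlotAt P i p (C k) →
      (C j).full < (C k).full ∨ ((C j).full = (C k).full ∧ k ≤ j)) :
    Move P i C (Function.update C j (addBlock P i (C j))) (C j).full :=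
  ⟨hC, hC.update_addBlock hper hj hmin, j, ⟨hI, hj.2⟩, rfl, rfl⟩

theorem IsChain.move_remove (hC : IsChain P C) (hper : ∀ k, p (k + P.period) ↔ p k)
    {j : Fin L} {h : ℕ} (hI : HasColour P i h) (hp : p h) (hj : TopAt P i (C j) h)
    (hmax : ∀ k h', p h' → TopAt P i (C k) h' → h' < h ∨ (h' = h ∧ j ≤ k)) :
    Move P i (Function.update C j (removeBlock P i (C j))) C h := by
  obtain ⟨r1, r2, r3, r4⟩ := removeBlock_spec (hC.valid j) hI hj
  refine ⟨hC.update_removeBlock hper hI hp hj hmax, hC, j, ?_⟩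
  simp only [Function.update_self, SlotAt, r2, r4]
  exact ⟨⟨hI, r3⟩, trivial, by simp⟩

/-! #### Shifting -/

theorem IsChain.shift (h : IsChain P C) : IsChain P (shift P C) := by
  refine ⟨fun j => ?_, fun j k hjk => ?_, fun j k => ?_⟩
  · simp only [YoungSlice.shift]
    split_ifs
    · exact h.valid _
    · exact valid_addDelta.mpr (h.valid _)
  · simp only [YoungSlice.shift]
    have hjk' : j.val ≤ k.val := hjk
    split_ifs with h1 h2 h2
    · exact h.mono _ _ (by simpa using hjk')
    · exact h.sub_addDelta _ _
    · omega
    · exact Column.Sub.refl _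
  · simp only [YoungSlice.shift]
    split_ifs with h1 h2 h2
    · exact h.sub_addDelta _ _
    · exact (h.sub_addDelta ⟨0, k.pos⟩ ⟨k.val + 1, h1⟩).trans sub_addDelta_self
    · exact addDelta_sub_addDelta.mpr (h.mono _ _ (Nat.zero_le _))
    · exact sub_addDelta_self

theorem shift_apply_of_succ {j k : Fin L} (h : k.val + 1 = j.val) : shift P C k = C j := by
  simp only [YoungSlice.shift, show k.val + 1 < L by omega, dite_true]
  congr 1
  exact Fin.ext h

theorem shift_apply_last {j k : Fin L} (hj : j.val = 0) (hk : k.val + 1 = L) :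
    shift P C k = (C j).addDelta P := by
  simp only [YoungSlice.shift, show ¬ k.val + 1 < L by omega, dite_false]
  congr 2
  exact Fin.ext hj.symm

theorem exists_shift_index (j : Fin L) :
    ∃ k : Fin L, k.val + 1 = j.val ∨ (j.val = 0 ∧ k.val + 1 = L) := by
  rcases Nat.eq_zero_or_pos j.val with h0 | h0
  · exact ⟨⟨L - 1, by omega⟩, Or.inr ⟨h0, by simp only; omega⟩⟩
  · exact ⟨⟨j.val - 1, by omega⟩, Or.inl (by simp only; omega)⟩

theorem shift_update_of_succ {j k : Fin L} (h : k.val + 1 = j.val) (x : Column) :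
    shift P (Function.update C j x) = Function.update (shift P C) k x := by
  funext m
  obtain rfl | hm := eq_or_ne m k
  · rw [shift_apply_of_succ h, Function.update_self, Function.update_self]
  · rw [Function.update_of_ne hm]
    have hm' : m.val ≠ k.val := fun h => hm (Fin.ext h)
    simp only [YoungSlice.shift]
    split_ifs with h1
    · rw [Function.update_of_ne]
      exact fun h2 => hm' (by have := congrArg Fin.val h2; simp only at this; omega)
    · rw [Function.update_of_ne]
      exact fun h2 => hm' (by have := congrArg Fin.val h2; simp only at this; omega)

theorem shift_update_last {j k : Fin L} (hj : j.val = 0) (hk : k.val + 1 = L) (x : Column) :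
    shift P (Function.update C j x) = Function.update (shift P C) k (x.addDelta P) := by
  funext m
  obtain rfl | hm := eq_or_ne m k
  · rw [shift_apply_last hj hk, Function.update_self, Function.update_self]
  · rw [Function.update_of_ne hm]
    have hm' : m.val ≠ k.val := fun h => hm (Fin.ext h)
    have h1 : m.val + 1 < L := by omega
    rw [shift_apply_of_succ (j := ⟨m.val + 1, h1⟩) rfl,
      shift_apply_of_succ (j := ⟨m.val + 1, h1⟩) rfl, Function.update_of_ne]
    exact fun h2 => by have := congrArg Fin.val h2; simp only at this; omega

/-- Storeys are renumbered only when the block lies in the front layer, which moves to the back with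
a cycle added. -/
theorem Move.shift (h : Move P i C C' k) :
    ∃ k', (k' = k ∨ k' = k + P.period) ∧ Move P i (shift P C) (shift P C') k' := by
  obtain ⟨hC, hC', j, hs, rfl, rfl⟩ := h
  obtain ⟨m, hm | ⟨hj, hm⟩⟩ := exists_shift_index j
  · refine ⟨_, Or.inl rfl, hC.shift, hC'.shift, m, ?_, ?_, ?_⟩ <;> rw [shift_apply_of_succ hm]
    · exact hs
    · rw [shift_update_of_succ hm]
  · refine ⟨_, Or.inr rfl, hC.shift, hC'.shift, m, ?_, ?_, ?_⟩ <;> rw [shift_apply_last hj hm]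
    · exact (slotAt_addDelta fun k => hasColour_add_period k).mpr hs
    · rfl
    · rw [addBlock_addDelta, shift_update_last hj hm]

end Chains

end YoungSlice

namespace YoungSlice

/-! ### Adding and removing blocks in partially split slices -/

section Steps

variable {n : ℕ} (P : Pattern n) (i : ℕ) {L : ℕ}

/-- The `i`-blocks of the `k`-th storey have no priority when blocks are added. -/
def NotSecondAt (k : ℕ) : Prop := HasColour P i k ∧ ¬ SecondAt P i k

/-- The `i`-blocks of the `k`-th storey have no priority when blocks are removed. -/
def NotFirstAt (k : ℕ) : Prop := HasColour P i k ∧ ¬ FirstAt P i k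

open Classical in
/-- The number of layers with an `i`-slot in a storey satisfying `p`. -/
noncomputable def slotCount (p : ℕ → Prop) (C : Fin L → Column) : ℕ :=
  (Finset.univ.filter fun j => SlotAt P i p (C j)).card

open Classical in
/-- The number of layers with an `i`-block on top, in a storey satisfying `p`. -/
noncomputable def blockCount (p : ℕ → Prop) (C : Fin L → Column) : ℕ :=
  (Finset.univ.filter fun j => BlockAt P i p (C j)).card

open Classical in
/-- The number of layers that have lost half a block. -/
noncomputable def lostCount (D : Fin L → Layer) : ℕ :=
  (Finset.univ.filter fun j => ∃ c, D j = .lost c).card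

open Classical in
/-- The number of layers that have gained half a block. -/
noncomputable def gainedCount (D : Fin L → Layer) : ℕ :=
  (Finset.univ.filter fun j => ∃ c, D j = .gained c).card

/-- The columns obtained when all broken halves are put back. -/
def glued (D : Fin L → Layer) : Fin L → Column := fun j => (D j).glue

/-- The broken layers of `D` do not interfere with the addition of `i`-blocks: the layers that have
lost half a block are the last ones of those with a slot of the second kind. -/
structure SlotReady (D : Fin L → Layer) : Prop where
  lost_slot : ∀ j c, D j = .lost c → SlotAt P i (SecondAt P i) c
  lost_up : ∀ j k c d, D j = .lost c → D k = .whole d → SlotAt P i (SecondAt P i) d →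
    d.full < c.full ∨ (d.full = c.full ∧ j < k)
  gained : ∀ j c, D j = .gained c → ¬ SlotAt P i (HasColour P i) c

/-- The broken layers of `D` do not interfere with the removal of `i`-blocks: the layers that have
gained half a block are the last ones of those with a block of the first kind. -/
structure BlockReady (D : Fin L → Layer) : Prop where
  gained_block : ∀ j c, D j = .gained c → BlockAt P i (FirstAt P i) c
  gained_low : ∀ j k c d h h', D j = .gained c → D k = .whole d → FirstAt P i h → FirstAt P i h' →
    TopAt P i c h → TopAt P i d h' → h < h' ∨ (h = h' ∧ k < j)
  lost : ∀ j c, D j = .lost c → ¬ BlockAt P i (HasColour P i) c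

variable {P i} {D D' : Fin L → Layer}

theorem BlockAt.imp {p q : ℕ → Prop} {c : Column} (h : BlockAt P i p c) (hpq : ∀ k, p k → q k) :
    BlockAt P i q c := by
  obtain ⟨k, hk, ht⟩ := h
  exact ⟨k, hpq k hk, ht⟩

theorem whole_bind_eq_some {g : Column → Option Spot} {X : Layer} {x : Spot} :
    X.whole?.bind g = some x ↔ ∃ c, X = .whole c ∧ g c = some x := by
  cases X <;> simp [Layer.whole?]

theorem whole_bind_filter_eq_some {g : Column → Option Spot} {f : Spot → Bool} {X : Layer}
    {x : Spot} : (X.whole?.bind g).filter f = some x ↔ ∃ c, X = .whole c ∧ g c = some x ∧ f x := by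
  rw [Option.filter_eq_some_iff, whole_bind_eq_some]
  constructor
  · rintro ⟨⟨c, h1, h2⟩, h3⟩
    exact ⟨c, h1, h2, h3⟩
  · rintro ⟨c, h1, h2, h3⟩
    exact ⟨⟨c, h1, h2⟩, h3⟩

theorem glued_update {j : Fin L} {X : Layer} :
    glued (Function.update D j X) = Function.update (glued D) j X.glue := by
  funext k
  rcases eq_or_ne k j with rfl | h <;> simp [glued, *]

theorem secondAt_iff {k : ℕ} {x : Spot} (h : storeySpot P (.colour i) k = some x) :
    SecondAt P i k ↔ isSecond P x = true := by
  simp [SecondAt, h]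

theorem firstAt_iff {k : ℕ} {x : Spot} (h : storeySpot P (.colour i) k = some x) :
    FirstAt P i k ↔ isFirst P x = true := by
  simp [FirstAt, h]

theorem SlotAt.exists_topSlot {c : Column} (hc : c.Valid P) (h : SlotAt P i (HasColour P i) c) :
    ∃ x, topSlot P (.colour i) c = some x ∧ storeySpot P (.colour i) c.full = some x ∧
      x.height = c.full := by
  obtain ⟨⟨x, hx⟩, hs⟩ := h
  exact ⟨x, (topSlot_eq_some hc).mpr ⟨hx, hs⟩, hx, storeySpot_height hx⟩

theorem TopAt.exists_topBlock {c : Column} {h : ℕ} (hc : c.Valid P) (ht : TopAt P i c h)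
    (hI : HasColour P i h) :
    ∃ x, topBlock P (.colour i) c = some x ∧ storeySpot P (.colour i) h = some x ∧
      x.height = h := by
  obtain ⟨x, hx⟩ := hI
  have := storeySpot_height hx
  exact ⟨x, (topBlock_eq_some hc).mpr ⟨this.symm ▸ hx, this.symm ▸ ht⟩, hx, this⟩

/-- The layers that have lost a half are among those with a slot of the second kind. A strict
inequality of cardinalities leaves such a layer over, and it must be whole, because layers that have
gained a half have no `i`-slot. -/
theorem SlotReady.lostCount_lt_iff (hD : SlotReady P i D) :
    lostCount D < slotCount P i (SecondAt P i) (glued D) ↔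
      ∃ j c, D j = .whole c ∧ SlotAt P i (SecondAt P i) c := by
  constructor
  · intro h
    obtain ⟨j, hj, hj'⟩ := Finset.exists_mem_notMem_of_card_lt_card h
    simp only [Finset.mem_filter, Finset.mem_univ, true_and] at hj hj'
    cases hX : D j with
    | whole c => exact ⟨j, c, hX, by simpa [glued, hX, Layer.glue] using hj⟩
    | lost c => exact absurd ⟨c, hX⟩ hj'
    | gained c =>
      refine absurd ?_ (hD.gained j c hX)
      simp only [glued, hX, Layer.glue] at hj
      exact hj.imp fun h => h.hasColour
  · rintro ⟨j, c, hX, hs⟩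
    apply Finset.card_lt_card
    rw [Finset.ssubset_iff_of_subset]
    · refine ⟨j, ?_, ?_⟩
      · simp only [Finset.mem_filter, Finset.mem_univ, true_and]
        simpa [glued, hX, Layer.glue] using hs
      · simp [hX]
    · intro k hk
      simp only [Finset.mem_filter, Finset.mem_univ, true_and] at hk ⊢
      obtain ⟨d, hd⟩ := hk
      simpa [glued, hd, Layer.glue] using hD.lost_slot k d hd

theorem BlockReady.gainedCount_lt_iff (hD : BlockReady P i D) :
    gainedCount D < blockCount P i (FirstAt P i) (glued D) ↔
      ∃ j c, D j = .whole c ∧ BlockAt P i (FirstAt P i) c := by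
  constructor
  · intro h
    obtain ⟨j, hj, hj'⟩ := Finset.exists_mem_notMem_of_card_lt_card h
    simp only [Finset.mem_filter, Finset.mem_univ, true_and] at hj hj'
    cases hX : D j with
    | whole c => exact ⟨j, c, hX, by simpa [glued, hX, Layer.glue] using hj⟩
    | gained c => exact absurd ⟨c, hX⟩ hj'
    | lost c =>
      refine absurd ?_ (hD.lost j c hX)
      simp only [glued, hX, Layer.glue] at hj
      exact hj.imp fun k h => h.hasColour
  · rintro ⟨j, c, hX, hs⟩
    apply Finset.card_lt_card
    rw [Finset.ssubset_iff_of_subset]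
    · refine ⟨j, ?_, ?_⟩
      · simp only [Finset.mem_filter, Finset.mem_univ, true_and]
        simpa [glued, hX, Layer.glue] using hs
      · simp [hX]
    · intro k hk
      simp only [Finset.mem_filter, Finset.mem_univ, true_and] at hk ⊢
      obtain ⟨d, hd⟩ := hk
      simpa [glued, hd, Layer.glue] using hD.gained_block k d hd

/-- The slot chosen among the unbroken layers is also the lowest, back-most one of its kind in the
glued chain: layers that have lost a half lie higher or further forward, layers that have gained one
have no `i`-slot. So the result of gluing is again a chain. -/
theorem SlotReady.fStep_some (hD : SlotReady P i D) (hC : IsChain P (glued D))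
    (h : fStep P i D = some D') :
    ∃ j c, D j = .whole c ∧ D' = Function.update D j (.whole (addBlock P i c)) ∧
      SlotAt P i (HasColour P i) c ∧
      Move P i (glued D) (glued D') c.full ∧
      ((lostCount D < slotCount P i (SecondAt P i) (glued D) ∧ SecondAt P i c.full) ∨
        (slotCount P i (SecondAt P i) (glued D) ≤ lostCount D ∧ ¬ SecondAt P i c.full)) := by
  rw [fStep] at h
  simp only [Option.map_eq_some_iff] at h
  obtain ⟨j, hj, rfl⟩ := h
  have hv : ∀ {k c}, D k = .whole c → c.Valid P := fun {k c} hk => by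
    simpa [glued, hk, Layer.glue] using hC.valid k
  rw [Option.or_eq_some_iff] at hj
  rcases hj with hj | ⟨hn, hj⟩
  · obtain ⟨x, hx, hmin⟩ := lowBack_eq_some hj
    simp only [whole_bind_filter_eq_some] at hx hmin
    obtain ⟨c, hc, hx, hx2⟩ := hx
    rw [topSlot_eq_some (hv hc)] at hx
    have hS := (secondAt_iff hx.1).mpr hx2
    have hglue : glued D j = c := by simp [glued, hc, Layer.glue]
    refine ⟨j, c, hc, by simp [hc, Layer.glue], ⟨hS.hasColour, hx.2⟩, ?_, Or.inl ⟨?_, hS⟩⟩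
    · rw [glued_update, hc, Layer.glue, Layer.glue]
      rw [← hglue] at hx hS ⊢
      refine hC.move_add (p := SecondAt P i) secondAt_add_period hS.hasColour ⟨hS, hx.2⟩ ?_
      intro k hk
      rw [hglue]
      cases hX : D k with
      | whole d =>
        simp only [glued, hX, Layer.glue] at hk ⊢
        obtain ⟨y, h1, h2, h3⟩ := (hk.imp SecondAt.hasColour).exists_topSlot (hv hX)
        have := hmin k y ⟨d, hX, h1, (secondAt_iff h2).mp hk.1⟩
        rw [hglue] at hx
        rwa [h3, storeySpot_height hx.1] at this
      | lost d =>
        simp only [glued, hX, Layer.glue] at hk ⊢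
        have := hD.lost_up k j d c hX hc ⟨hglue ▸ hS, hglue ▸ hx.2⟩
        omega
      | gained d =>
        simp only [glued, hX, Layer.glue] at hk
        exact absurd (hk.imp SecondAt.hasColour) (hD.gained k d hX)
    · exact hD.lostCount_lt_iff.mpr ⟨j, c, hc, hS, hx.2⟩
  · obtain ⟨x, hx, hmin⟩ := lowBack_eq_some hj
    simp only [whole_bind_eq_some] at hx hmin
    rw [lowBack_eq_none] at hn
    obtain ⟨c, hc, hx⟩ := hx
    have hx' := hx
    rw [topSlot_eq_some (hv hc)] at hx
    have hI : HasColour P i c.full := ⟨x, hx.1⟩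
    have hglue : glued D j = c := by simp [glued, hc, Layer.glue]
    -- This branch is reached only when no unbroken layer has a slot of the second kind; minimality
    -- among all remaining slots is then minimality among those not of the second kind.
    have hnS : ∀ k d, D k = .whole d → ¬ SlotAt P i (SecondAt P i) d := by
      intro k d hd hs
      obtain ⟨y, h1, h2, h3⟩ := (hs.imp SecondAt.hasColour).exists_topSlot (hv hd)
      have := whole_bind_filter_eq_some (f := isSecond P).mpr
        ⟨d, hd, h1, (secondAt_iff h2).mp hs.1⟩
      rw [hn k] at this
      simp at this
    have hS : ¬ SecondAt P i c.full := fun h => hnS j c hc ⟨h, hx.2⟩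
    refine ⟨j, c, hc, by simp [hc, Layer.glue], ⟨hI, hx.2⟩, ?_, Or.inr ⟨?_, hS⟩⟩
    · rw [glued_update, hc, Layer.glue, Layer.glue]
      rw [← hglue] at hx hI hS ⊢
      refine hC.move_add (p := NotSecondAt P i) ?_ hI ⟨⟨hI, hS⟩, hx.2⟩ ?_
      · intro k
        simp [NotSecondAt, hasColour_add_period, secondAt_add_period]
      intro k hk
      cases hX : D k with
      | whole d =>
        rw [hglue]
        simp only [glued, hX, Layer.glue] at hk ⊢
        obtain ⟨y, h1, h2, h3⟩ := (hk.imp And.left).exists_topSlot (hv hX)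
        have := hmin k y ⟨d, hX, h1⟩
        rw [hglue] at hx
        rwa [h3, storeySpot_height hx.1] at this
      | lost d =>
        simp only [glued, hX, Layer.glue] at hk
        exact absurd (hD.lost_slot k d hX).1 hk.1.2
      | gained d =>
        simp only [glued, hX, Layer.glue] at hk
        exact absurd (hk.imp And.left) (hD.gained k d hX)
    · rw [← not_lt, hD.lostCount_lt_iff]
      rintro ⟨k, d, hd, hs⟩
      exact hnS k d hd hs

theorem SlotReady.fStep_none (hD : SlotReady P i D) (hC : IsChain P (glued D))
    (h : fStep P i D = none) :
    slotCount P i (SecondAt P i) (glued D) ≤ lostCount D ∧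
      slotCount P i (NotSecondAt P i) (glued D) = 0 := by
  rw [fStep] at h
  simp only [Option.map_eq_none_iff, Option.or_eq_none_iff, lowBack_eq_none] at h
  have hv : ∀ {k c}, D k = .whole c → c.Valid P := fun {k c} hk => by
    simpa [glued, hk, Layer.glue] using hC.valid k
  have key : ∀ k d, D k = .whole d → ¬ SlotAt P i (HasColour P i) d := by
    intro k d hd hs
    obtain ⟨y, h1, -⟩ := hs.exists_topSlot (hv hd)
    have := whole_bind_eq_some.mpr ⟨d, hd, h1⟩
    rw [h.2 k] at this
    simp at this
  constructor
  · rw [← not_lt, hD.lostCount_lt_iff]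
    rintro ⟨k, d, hd, hs⟩
    exact key k d hd (hs.imp SecondAt.hasColour)
  · classical
    rw [slotCount, Finset.card_eq_zero, Finset.filter_eq_empty_iff]
    rintro k - hk
    cases hX : D k with
    | whole d =>
      simp only [glued, hX, Layer.glue] at hk
      exact key k d hX (hk.imp And.left)
    | lost d =>
      simp only [glued, hX, Layer.glue] at hk
      exact absurd (hD.lost_slot k d hX).1 hk.1.2
    | gained d =>
      simp only [glued, hX, Layer.glue] at hk
      exact absurd (hk.imp And.left) (hD.gained k d hX)

/-- Mirror image of `SlotReady.fStep_some`: layers that have gained a half lie lower or further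
back, layers that have lost one have no `i`-block on top. -/
theorem BlockReady.eStep_some (hD : BlockReady P i D) (hC : IsChain P (glued D))
    (h : eStep P i D = some D') :
    ∃ j c k, D j = .whole c ∧ D' = Function.update D j (.whole (removeBlock P i c)) ∧
      HasColour P i k ∧ TopAt P i c k ∧
      Move P i (glued D') (glued D) k ∧
      ((gainedCount D < blockCount P i (FirstAt P i) (glued D) ∧ FirstAt P i k) ∨
        (blockCount P i (FirstAt P i) (glued D) ≤ gainedCount D ∧ ¬ FirstAt P i k)) := by
  rw [eStep] at h
  simp only [Option.map_eq_some_iff] at h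
  obtain ⟨j, hj, rfl⟩ := h
  have hv : ∀ {k c}, D k = .whole c → c.Valid P := fun {k c} hk => by
    simpa [glued, hk, Layer.glue] using hC.valid k
  rw [Option.or_eq_some_iff] at hj
  rcases hj with hj | ⟨hn, hj⟩
  · obtain ⟨x, hx, hmin⟩ := highFront_eq_some hj
    simp only [whole_bind_filter_eq_some] at hx hmin
    obtain ⟨c, hc, hx, hx2⟩ := hx
    rw [topBlock_eq_some (hv hc)] at hx
    have hS := (firstAt_iff hx.1).mpr hx2
    have hglue : glued D j = c := by simp [glued, hc, Layer.glue]
    refine ⟨j, c, x.height, hc, by simp [hc, Layer.glue], hS.hasColour, hx.2, ?_,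
      Or.inl ⟨?_, hS⟩⟩
    · rw [glued_update, hc, Layer.glue, Layer.glue]
      rw [← hglue] at hx ⊢
      refine hC.move_remove (p := FirstAt P i) firstAt_add_period hS.hasColour hS hx.2 ?_
      intro k h' hp' hk
      cases hX : D k with
      | whole d =>
        simp only [glued, hX, Layer.glue] at hk ⊢
        obtain ⟨y, h1, h2, h3⟩ := hk.exists_topBlock (hv hX) hp'.hasColour
        have := hmin k y ⟨d, hX, h1, (firstAt_iff h2).mp hp'⟩
        rwa [h3] at this
      | gained d =>
        simp only [glued, hX, Layer.glue] at hk ⊢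
        have := hD.gained_low k j d c h' x.height hX hc hp' hS hk (hglue ▸ hx.2)
        omega
      | lost d =>
        simp only [glued, hX, Layer.glue] at hk
        exact absurd ⟨h', hp'.hasColour, hk⟩ (hD.lost k d hX)
    · exact hD.gainedCount_lt_iff.mpr ⟨j, c, hc, _, hS, hx.2⟩
  · obtain ⟨x, hx, hmin⟩ := highFront_eq_some hj
    simp only [whole_bind_eq_some] at hx hmin
    rw [highFront_eq_none] at hn
    obtain ⟨c, hc, hx⟩ := hx
    rw [topBlock_eq_some (hv hc)] at hx
    have hI : HasColour P i x.height := ⟨x, hx.1⟩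
    have hglue : glued D j = c := by simp [glued, hc, Layer.glue]
    have hnS : ∀ k d, D k = .whole d → ¬ BlockAt P i (FirstAt P i) d := by
      rintro k d hd ⟨h', hp', ht⟩
      obtain ⟨y, h1, h2, h3⟩ := ht.exists_topBlock (hv hd) hp'.hasColour
      have := whole_bind_filter_eq_some (f := isFirst P).mpr
        ⟨d, hd, h1, (firstAt_iff h2).mp hp'⟩
      rw [hn k] at this
      simp at this
    have hS : ¬ FirstAt P i x.height := fun h => hnS j c hc ⟨_, h, hx.2⟩
    refine ⟨j, c, x.height, hc, by simp [hc, Layer.glue], hI, hx.2, ?_, Or.inr ⟨?_, hS⟩⟩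
    · rw [glued_update, hc, Layer.glue, Layer.glue]
      rw [← hglue] at hx ⊢
      refine hC.move_remove (p := NotFirstAt P i) ?_ hI ⟨hI, hS⟩ hx.2 ?_
      · intro k
        simp [NotFirstAt, hasColour_add_period, firstAt_add_period]
      intro k h' hp' hk
      cases hX : D k with
      | whole d =>
        simp only [glued, hX, Layer.glue] at hk ⊢
        obtain ⟨y, h1, h2, h3⟩ := hk.exists_topBlock (hv hX) hp'.1
        have := hmin k y ⟨d, hX, h1⟩
        rwa [h3] at this
      | gained d =>
        simp only [glued, hX, Layer.glue] at hk
        obtain ⟨h'', hp'', ht⟩ := hD.gained_block k d hX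
        rw [ht.unique hk] at hp''
        exact absurd hp'' hp'.2
      | lost d =>
        simp only [glued, hX, Layer.glue] at hk
        exact absurd ⟨h', hp'.1, hk⟩ (hD.lost k d hX)
    · rw [← not_lt, hD.gainedCount_lt_iff]
      rintro ⟨k, d, hd, hs⟩
      exact hnS k d hd hs

theorem BlockReady.eStep_none (hD : BlockReady P i D) (hC : IsChain P (glued D))
    (h : eStep P i D = none) :
    blockCount P i (FirstAt P i) (glued D) ≤ gainedCount D ∧
      blockCount P i (NotFirstAt P i) (glued D) = 0 := by
  rw [eStep] at h
  simp only [Option.map_eq_none_iff, Option.or_eq_none_iff, highFront_eq_none] at h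
  have hv : ∀ {k c}, D k = .whole c → c.Valid P := fun {k c} hk => by
    simpa [glued, hk, Layer.glue] using hC.valid k
  have key : ∀ k d, D k = .whole d → ¬ BlockAt P i (HasColour P i) d := by
    rintro k d hd ⟨h', hI, hs⟩
    obtain ⟨y, h1, -⟩ := hs.exists_topBlock (hv hd) hI
    have := whole_bind_eq_some.mpr ⟨d, hd, h1⟩
    rw [h.2 k] at this
    simp at this
  constructor
  · rw [← not_lt, hD.gainedCount_lt_iff]
    rintro ⟨k, d, hd, hs⟩
    exact key k d hd (hs.imp fun _ => FirstAt.hasColour)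
  · classical
    rw [blockCount, Finset.card_eq_zero, Finset.filter_eq_empty_iff]
    rintro k - hk
    cases hX : D k with
    | whole d =>
      simp only [glued, hX, Layer.glue] at hk
      exact key k d hX (hk.imp fun _ => And.left)
    | gained d =>
      simp only [glued, hX, Layer.glue] at hk
      obtain ⟨h1, hp1, ht1⟩ := hD.gained_block k d hX
      obtain ⟨h2, hp2, ht2⟩ := hk
      rw [ht1.unique ht2] at hp1
      exact hp2.2 hp1
    | lost d =>
      simp only [glued, hX, Layer.glue] at hk
      exact absurd (hk.imp fun _ => And.left) (hD.lost k d hX)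

/-- After an `i`-block has been added, another one can be added by the same rule. -/
theorem SlotReady.update_whole (hD : SlotReady P i D) {j : Fin L} {c : Column}
    (hc : ¬ SlotAt P i (SecondAt P i) c) :
    SlotReady P i (Function.update D j (.whole c)) := by
  refine ⟨fun k d hd => ?_, fun k m d d' hd hd' hs => ?_, fun k d hd => ?_⟩
  · rcases eq_or_ne k j with rfl | hk
    · simp at hd
    · rw [Function.update_of_ne hk] at hd
      exact hD.lost_slot k d hd
  · rcases eq_or_ne k j with rfl | hk
    · simp at hd
    · rcases eq_or_ne m j with rfl | hm
      · simp only [Function.update_self, Layer.whole.injEq] at hd'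
        exact absurd (hd' ▸ hs) hc
      · rw [Function.update_of_ne hk] at hd
        rw [Function.update_of_ne hm] at hd'
        exact hD.lost_up k m d d' hd hd' hs
  · rcases eq_or_ne k j with rfl | hk
    · simp at hd
    · rw [Function.update_of_ne hk] at hd
      exact hD.gained k d hd

theorem BlockReady.update_whole (hD : BlockReady P i D) {j : Fin L} {c : Column}
    (hc : ¬ BlockAt P i (FirstAt P i) c) :
    BlockReady P i (Function.update D j (.whole c)) := by
  refine ⟨fun k d hd => ?_, fun k m d d' h h' hd hd' hp hp' hs hs' => ?_, fun k d hd => ?_⟩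
  · rcases eq_or_ne k j with rfl | hk
    · simp at hd
    · rw [Function.update_of_ne hk] at hd
      exact hD.gained_block k d hd
  · rcases eq_or_ne k j with rfl | hk
    · simp at hd
    · rcases eq_or_ne m j with rfl | hm
      · simp only [Function.update_self, Layer.whole.injEq] at hd'
        exact absurd (hd' ▸ ⟨h', hp', hs'⟩) hc
      · rw [Function.update_of_ne hk] at hd
        rw [Function.update_of_ne hm] at hd'
        exact hD.gained_low k m d d' h h' hd hd' hp hp' hs hs'
  · rcases eq_or_ne k j with rfl | hk
    · simp at hd
    · rw [Function.update_of_ne hk] at hd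
      exact hD.lost k d hd

theorem lostCount_update_whole {j : Fin L} {c d : Column} (hj : D j = .whole c) :
    lostCount (Function.update D j (.whole d)) = lostCount D := by
  unfold lostCount
  congr 1
  ext k
  rcases eq_or_ne k j with rfl | hk <;> simp [*]

theorem gainedCount_update_whole {j : Fin L} {c d : Column} (hj : D j = .whole c) :
    gainedCount (Function.update D j (.whole d)) = gainedCount D := by
  unfold gainedCount
  congr 1
  ext k
  rcases eq_or_ne k j with rfl | hk <;> simp [*]

end Steps

end YoungSlice

namespace YoungSlice

/-! ### The split form -/

section Splitting

variable {n : ℕ} (P : Pattern n) (i : ℕ) {L : ℕ}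

/-- Splitting `q`-blocks uses up the layers with an `i`-slot of the second kind together with the
layers with an `i`-block of the first kind. -/
structure Splits (q : Piece) : Prop where
  block_iff : ∀ c : Column, c.Valid P → c ≠ Column.empty →
    ((∃ x, topBlock P q c = some x ∧ isSecond P x = true) ↔ SlotAt P i (SecondAt P i) c)
  block_height : ∀ c x, topBlock P q c = some x → isSecond P x = true → c.Valid P →
    x.height + 1 = c.full
  slot_iff : ∀ c : Column, c.Valid P → c ≠ Column.empty →
    ((∃ x, topSlot P q c = some x ∧ isFirst P x = true) ↔ BlockAt P i (FirstAt P i) c)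
  slot_height : ∀ c x, topSlot P q c = some x → isFirst P x = true → c.Valid P →
    x.height = c.full ∧ c.half = none
  not_secondAt_succ : ∀ k, HasColour P i k → ¬ SecondAt P i (k + 1)
  not_hasColour_succ : ∀ k, FirstAt P i k → ¬ HasColour P i (k + 1)

variable {P i} {q : Piece} {C : Fin L → Column} {D D' : Fin L → Layer}

/-- The state of affairs while blocks are being split. -/
structure Splitting (P : Pattern n) (i : ℕ) (C : Fin L → Column) (D : Fin L → Layer) : Prop where
  glued_eq : glued D = C
  slotReady : SlotReady P i D
  blockReady : BlockReady P i D
  card_eq : lostCount D = gainedCount D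

/-- Such a block would lie directly below the slot of the second kind, or be the half-block filling
it. Hence no layer can be both source and target of a splitting. -/
theorem Splits.slot_not_block (hq : Splits P i q) {c : Column}
    (hs : SlotAt P i (SecondAt P i) c) : ¬ BlockAt P i (HasColour P i) c := by
  rintro ⟨h, hI, ⟨h1, h2⟩ | ⟨h1, s, h2, h3⟩⟩
  · have := hs.1
    rw [h2] at this
    exact hq.not_secondAt_succ h hI this
  · exact hs.2 s h2 h3

theorem Splits.block_not_slot (hq : Splits P i q) {c : Column}
    (hs : BlockAt P i (FirstAt P i) c) : ¬ SlotAt P i (HasColour P i) c := by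
  obtain ⟨h, hI, ⟨h1, h2⟩ | ⟨h1, s, h2, h3⟩⟩ := hs
  · rintro ⟨h4, -⟩
    rw [h2] at h4
    exact hq.not_hasColour_succ h hI h4
  · rintro ⟨-, h4⟩
    exact h4 s h2 h3

theorem splitting_whole (hC : glued D = C) (hD : ∀ j, ∃ c, D j = .whole c) :
    Splitting P i C D ∧ lostCount D = 0 := by
  have h1 : ∀ j c, D j ≠ .lost c := fun j c h => by
    obtain ⟨d, hd⟩ := hD j
    rw [hd] at h
    cases h
  have h2 : ∀ j c, D j ≠ .gained c := fun j c h => by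
    obtain ⟨d, hd⟩ := hD j
    rw [hd] at h
    cases h
  refine ⟨⟨hC, ⟨?_, ?_, ?_⟩, ⟨?_, ?_, ?_⟩, ?_⟩, ?_⟩
  · exact fun j c h => absurd h (h1 j c)
  · exact fun j k c d h => absurd h (h1 j c)
  · exact fun j c h => absurd h (h2 j c)
  · exact fun j c h => absurd h (h2 j c)
  · exact fun j k c d _ _ h => absurd h (h2 j c)
  · exact fun j c h => absurd h (h1 j c)
  · simp [lostCount, gainedCount, h1, h2]
  · simp [lostCount, h1]

/-- Taking the source from the highest, front-most layer preserves `lost_up`, and taking the target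
in the lowest, back-most layer preserves `gained_low`; the heights of `q`-pieces and of the
corresponding `i`-slots and `i`-blocks differ by one. -/
theorem Splitting.splitOnce_some (hD : Splitting P i C D) (hq : Splits P i q)
    (hv : ∀ j, (C j).Valid P) (hne : ∀ j, C j ≠ Column.empty) (h : splitOnce P q D = some D') :
    Splitting P i C D' ∧ lostCount D' = lostCount D + 1 := by
  have hglue : ∀ {k X}, D k = X → X.glue = C k := fun {k X} hk => by
    rw [← hD.glued_eq, ← hk]; rfl
  unfold splitOnce at h
  simp only at h
  split at h
  rotate_left
  · cases h
  rename_i j k hj hk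
  simp only [Option.some.injEq] at h
  obtain ⟨x, hx, hmax⟩ := highFront_eq_some hj
  obtain ⟨y, hy, hmin⟩ := lowBack_eq_some hk
  simp only [whole_bind_filter_eq_some] at hx hmax hy hmin
  obtain ⟨c, hc, hx1, hx2⟩ := hx
  obtain ⟨d, hd, hy1, hy2⟩ := hy
  have hcv : c.Valid P ∧ c ≠ Column.empty := by
    have := hglue hc
    simp only [Layer.glue] at this
    exact this ▸ ⟨hv j, hne j⟩
  have hdv : d.Valid P ∧ d ≠ Column.empty := by
    have := hglue hd
    simp only [Layer.glue] at this
    exact this ▸ ⟨hv k, hne k⟩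
  have hcs := (hq.block_iff c hcv.1 hcv.2).mp ⟨x, hx1, hx2⟩
  have hds := (hq.slot_iff d hdv.1 hdv.2).mp ⟨y, hy1, hy2⟩
  have hjk : j ≠ k := by
    rintro rfl
    rw [hc] at hd
    cases hd
    exact hq.slot_not_block hcs (hds.imp fun _ => FirstAt.hasColour)
  have hxh := hq.block_height c x hx1 hx2 hcv.1
  have hyh := hq.slot_height d y hy1 hy2 hdv.1
  have eD : ∀ m, D' m = if m = k then .gained d else if m = j then .lost c else D m := by
    intro m
    rw [← h, hc, hd]
    simp only [Function.update_apply, Layer.glue]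
  have elost : ∀ m e, D' m = .lost e ↔ ((m = j ∧ e = c) ∨ D m = .lost e) := by
    intro m e
    rw [eD]
    rcases eq_or_ne m k with rfl | hmk
    · simp [hjk.symm, hd]
    · rcases eq_or_ne m j with rfl | hmj
      · simp [hmk, hc, eq_comm]
      · simp [hmk, hmj]
  have egained : ∀ m e, D' m = .gained e ↔ ((m = k ∧ e = d) ∨ D m = .gained e) := by
    intro m e
    rw [eD]
    rcases eq_or_ne m k with rfl | hmk
    · simp [hd, eq_comm]
    · rcases eq_or_ne m j with rfl | hmj
      · simp [hmk, hc]
      · simp [hmk, hmj]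
  have ewhole : ∀ m e, D' m = .whole e → m ≠ k ∧ m ≠ j ∧ D m = .whole e := by
    intro m e hm
    rw [eD] at hm
    split_ifs at hm with h1 h2
    exact ⟨h1, h2, hm⟩
  have hvalid : ∀ {m e}, D m = .whole e → e.Valid P ∧ e ≠ Column.empty := fun {m e} hm => by
    have := hglue hm
    simp only [Layer.glue] at this
    exact this ▸ ⟨hv m, hne m⟩
  have hlostcard : lostCount D' = lostCount D + 1 := by
    classical
    unfold lostCount
    rw [← Finset.card_insert_of_notMem (a := j) (by simp [hc])]
    congr 1
    ext m
    simp only [Finset.mem_filter, Finset.mem_univ, true_and, Finset.mem_insert, elost]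
    constructor
    · rintro ⟨e, ⟨h1, -⟩ | h1⟩
      · exact Or.inl h1
      · exact Or.inr ⟨e, h1⟩
    · rintro (h1 | ⟨e, h1⟩)
      · exact ⟨c, Or.inl ⟨h1, rfl⟩⟩
      · exact ⟨e, Or.inr h1⟩
  have hgainedcard : gainedCount D' = gainedCount D + 1 := by
    classical
    unfold gainedCount
    rw [← Finset.card_insert_of_notMem (a := k) (by simp [hd])]
    congr 1
    ext m
    simp only [Finset.mem_filter, Finset.mem_univ, true_and, Finset.mem_insert, egained]
    constructor
    · rintro ⟨e, ⟨h1, -⟩ | h1⟩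
      · exact Or.inl h1
      · exact Or.inr ⟨e, h1⟩
    · rintro (h1 | ⟨e, h1⟩)
      · exact ⟨d, Or.inl ⟨h1, rfl⟩⟩
      · exact ⟨e, Or.inr h1⟩
  refine ⟨⟨?_, ⟨?_, ?_, ?_⟩, ⟨?_, ?_, ?_⟩, ?_⟩, hlostcard⟩
  · rw [← hD.glued_eq]
    funext m
    simp only [glued, eD]
    split_ifs with h1 h2
    · rw [h1, hd]; rfl
    · rw [h2, hc]; rfl
    · rfl
  · intro m e hm
    rcases (elost m e).mp hm with ⟨-, rfl⟩ | hm
    · exact hcs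
    · exact hD.slotReady.lost_slot m e hm
  · intro m m' e e' hm hm' hs
    obtain ⟨h1, h2, hm'⟩ := ewhole m' e' hm'
    rcases (elost m e).mp hm with ⟨rfl, rfl⟩ | hm
    · have hve := hvalid hm'
      obtain ⟨z, hz1, hz2⟩ := (hq.block_iff e' hve.1 hve.2).mpr hs
      have h3 := hmax m' z ⟨e', hm', hz1, hz2⟩
      have h4 := hq.block_height e' z hz1 hz2 hve.1
      have : m ≠ m' := h2.symm
      omega
    · exact hD.slotReady.lost_up m m' e e' hm hm' hs
  · intro m e hm
    rcases (egained m e).mp hm with ⟨rfl, rfl⟩ | hm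
    · exact hq.block_not_slot hds
    · exact hD.slotReady.gained m e hm
  · intro m e hm
    rcases (egained m e).mp hm with ⟨rfl, rfl⟩ | hm
    · exact hds
    · exact hD.blockReady.gained_block m e hm
  · intro m m' e e' p p' hm hm' hp hp' ht ht'
    obtain ⟨h1, h2, hm'⟩ := ewhole m' e' hm'
    rcases (egained m e).mp hm with ⟨rfl, rfl⟩ | hm
    · have hve := hvalid hm'
      obtain ⟨z, hz1, hz2⟩ := (hq.slot_iff e' hve.1 hve.2).mpr ⟨p', hp', ht'⟩
      have h3 := hmin m' z ⟨e', hm', hz1, hz2⟩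
      have h4 := hq.slot_height e' z hz1 hz2 hve.1
      -- The `q`-slot of `e` is in the storey `e.full`, so the `i`-block beneath it is in the storey
      -- `e.full - 1`; the subtraction is genuine by `t3`.
      have t1 := ht.unique (h' := e.full - 1)
        (Or.inl ⟨hyh.2, by rcases ht with ht | ⟨-, s, ht, -⟩ <;> [omega; simp [hyh.2] at ht]⟩)
      have t2 := ht'.unique (h' := e'.full - 1)
        (Or.inl ⟨h4.2, by rcases ht' with ht | ⟨-, s, ht, -⟩ <;> [omega; simp [h4.2] at ht]⟩)
      have t3 : e.full ≠ 0 := by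
        rcases ht with ht | ⟨-, s, ht, -⟩ <;> [omega; simp [hyh.2] at ht]
      have t4 : e'.full ≠ 0 := by
        rcases ht' with ht | ⟨-, s, ht, -⟩ <;> [omega; simp [h4.2] at ht]
      omega
    · exact hD.blockReady.gained_low m m' e e' p p' hm hm' hp hp' ht ht'
  · intro m e hm
    rcases (elost m e).mp hm with ⟨-, rfl⟩ | hm
    · exact hq.slot_not_block hcs
    · exact hD.blockReady.lost m e hm
  · rw [hlostcard, hgainedcard, hD.card_eq]

/-- Splitting stops exactly when sources or targets are used up, and equally many of both have been
used; that number is the minimum. -/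
theorem Splitting.splitOnce_none (hD : Splitting P i C D) (hq : Splits P i q)
    (hv : ∀ j, (C j).Valid P) (hne : ∀ j, C j ≠ Column.empty) (h : splitOnce P q D = none) :
    lostCount D = min (slotCount P i (SecondAt P i) C) (blockCount P i (FirstAt P i) C) := by
  have hvalid : ∀ {m e}, D m = .whole e → e.Valid P ∧ e ≠ Column.empty := fun {m e} hm => by
    have : e = C m := by
      rw [← hD.glued_eq, glued, hm]; rfl
    exact this ▸ ⟨hv m, hne m⟩
  have hle1 : lostCount D ≤ slotCount P i (SecondAt P i) C := by
    apply Finset.card_le_card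
    intro m hm
    simp only [Finset.mem_filter, Finset.mem_univ, true_and] at hm ⊢
    obtain ⟨e, he⟩ := hm
    have := hD.slotReady.lost_slot m e he
    rw [← hD.glued_eq, glued, he]
    exact this
  have hle2 : gainedCount D ≤ blockCount P i (FirstAt P i) C := by
    apply Finset.card_le_card
    intro m hm
    simp only [Finset.mem_filter, Finset.mem_univ, true_and] at hm ⊢
    obtain ⟨e, he⟩ := hm
    have := hD.blockReady.gained_block m e he
    rw [← hD.glued_eq, glued, he]
    exact this
  have key : ¬ (lostCount D < slotCount P i (SecondAt P i) C ∧
      gainedCount D < blockCount P i (FirstAt P i) C) := by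
    rintro ⟨h1, h2⟩
    rw [← hD.glued_eq] at h1 h2
    obtain ⟨j, c, hc, hs⟩ := hD.slotReady.lostCount_lt_iff.mp h1
    obtain ⟨k, d, hd, hs'⟩ := hD.blockReady.gainedCount_lt_iff.mp h2
    obtain ⟨x, hx⟩ := (hq.block_iff c (hvalid hc).1 (hvalid hc).2).mpr hs
    obtain ⟨y, hy⟩ := (hq.slot_iff d (hvalid hd).1 (hvalid hd).2).mpr hs'
    unfold splitOnce at h
    simp only at h
    split at h
    · cases h
    · rename_i h3
      cases h4 : highFront fun j => ((D j).whole?.bind (topBlock P q)).filter (isSecond P) with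
      | none =>
        have h5 := highFront_eq_none.mp h4 j
        have h6 := whole_bind_filter_eq_some (f := isSecond P).mpr ⟨c, hc, hx⟩
        rw [h5] at h6
        cases h6
      | some j' =>
        cases h7 : lowBack fun j => ((D j).whole?.bind (topSlot P q)).filter (isFirst P) with
        | none =>
          have h5 := lowBack_eq_none.mp h7 k
          have h6 := whole_bind_filter_eq_some (f := isFirst P).mpr ⟨d, hd, hy⟩
          rw [h5] at h6
          cases h6
        | some k' => exact h3 j' k' h4 h7
  have := hD.card_eq
  omega

theorem splitting_splitForm (hq : Splits P i q)
    (hv : ∀ j, (C j).Valid P) (hne : ∀ j, C j ≠ Column.empty) :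
    Splitting P i C (splitForm P q C) ∧ lostCount (splitForm P q C) =
      min (slotCount P i (SecondAt P i) C) (blockCount P i (FirstAt P i) C) := by
  have hle : ∀ D : Fin L → Layer, lostCount D ≤ L := fun D => by
    unfold lostCount
    exact (Finset.card_le_univ _).trans (by simp)
  have key : ∀ m, Splitting P i C ((fun D => (splitOnce P q D).getD D)^[m] fun j => .whole (C j)) ∧
      (splitOnce P q ((fun D => (splitOnce P q D).getD D)^[m] fun j => .whole (C j)) = none ∨
        m ≤ lostCount ((fun D => (splitOnce P q D).getD D)^[m] fun j => .whole (C j))) := by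
    intro m
    induction m with
    | zero =>
      exact ⟨(splitting_whole rfl fun j => ⟨_, rfl⟩).1, Or.inr (Nat.zero_le _)⟩
    | succ m ih =>
      rw [Function.iterate_succ_apply']
      generalize ((fun D => (splitOnce P q D).getD D)^[m] fun j => .whole (C j)) = D at ih ⊢
      cases h : splitOnce P q D with
      | none =>
        simp only [Option.getD_none, h]
        exact ⟨ih.1, Or.inl trivial⟩
      | some D' =>
        simp only [Option.getD_some]
        obtain ⟨h1, h2⟩ := ih.1.splitOnce_some hq hv hne h
        refine ⟨h1, Or.inr ?_⟩
        rcases ih.2 with h3 | h3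
        · rw [h] at h3; cases h3
        · omega
  obtain ⟨h1, h2⟩ := key L
  refine ⟨h1, ?_⟩
  unfold splitForm
  cases h3 : splitOnce P q ((fun D => (splitOnce P q D).getD D)^[L] fun j => .whole (C j)) with
  | none => exact h1.splitOnce_none hq hv hne h3
  | some D' =>
    -- If `L` attempts all succeeded, a further splitting would yield more than `L` layers that have
    -- lost a half.
    obtain ⟨-, h4⟩ := h1.splitOnce_some hq hv hne h3
    have := hle D'
    rw [h3] at h2
    simp only [reduceCtorEq, false_or] at h2
    omega

end Splitting

end YoungSlice

namespace YoungSlice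

/-! ### The positions of the `i`-blocks in a cycle -/

section Residues

variable {n : ℕ} (P : Pattern n) (i : ℕ)

/-- The position in the cycle of the `i`-blocks having priority when blocks are added. -/
def secondRes : ℕ :=
  match P with
  | .A1 _ s => (i + (n + 1) - s.val) % (n + 1)
  | .B1 _ _ => if i ≤ 1 then 0 else i - 1
  | .A2odd _ _ => if i ≤ 1 then 0 else i - 1
  | .C1 _ => if i = 0 then 0 else 2 * n + 1 - i
  | .A2even _ => if i = 0 then 0 else 2 * n + 1 - i
  | .D2 _ => if i = 0 then 0 else 2 * n + 2 - i

/-- The position in the cycle of the `i`-blocks having priority when blocks are removed. -/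
def firstRes : ℕ :=
  match P with
  | .A1 _ s => (i + (n + 1) - s.val) % (n + 1)
  | .B1 _ _ => if i ≤ 1 then 0 else 2 * n - i
  | .A2odd _ _ => if i ≤ 1 then 0 else 2 * n - i
  | .C1 _ => i + 1
  | .A2even _ => i + 1
  | .D2 _ => i + 1

/-- The four ways in which the `i`-blocks may be arranged in a cycle: `single` if there is one
storey of `i`-blocks, `doubled` (`tight`) if there are two consecutive storeys, of which the lower
(upper) one has priority when blocks are added, and `generic` if there are two storeys that are
not consecutive. -/
inductive Mode : Type
  | single : Mode
  | generic : Mode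
  | doubled : Mode
  | tight : Mode

/-- The arrangement of the `i`-blocks. -/
def mode : Mode :=
  match P with
  | .A1 _ _ => .single
  | .B1 _ _ => if i ≤ 1 then .single else if i = n then .doubled else .generic
  | .A2odd _ _ => if i ≤ 1 then .single else if i = n then .doubled else .generic
  | .C1 _ => if i = n then .single else if i = 0 then .doubled else .generic
  | .A2even _ => if i = n then .single else if i = 0 then .doubled else .generic
  | .D2 _ => if i = n then .tight else if i = 0 then .doubled else .generic

variable {P i}

theorem add_one_mod_eq {m : ℕ} (hm : 0 < m) (k : ℕ) :
    (k + 1) % m = if k % m + 1 = m then 0 else k % m + 1 := by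
  split_ifs with h
  · rw [← Nat.mod_add_mod, h, Nat.mod_self]
  · rw [← Nat.mod_add_mod]
    exact Nat.mod_eq_of_lt (by have := Nat.mod_lt k hm; omega)

theorem unit_spot {k c : ℕ} {cov supp : Bool} (h : P.storey k = .unit c cov supp) :
    storeySpot P (.colour i) k = if c = i then some ⟨k, cov, supp⟩ else none := by
  simp [storeySpot, h]

theorem add_mod_eq_iff {m s k i : ℕ} (hs : s < m) (hi : i < m) :
    (s + k) % m = i ↔ k % m = (i + m - s) % m := by
  have h1 : (s + k) % m = i ↔ s + k ≡ i [MOD m] := by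
    rw [Nat.ModEq, Nat.mod_eq_of_lt hi]
  rw [h1]
  have h2 : s + (i + m - s) ≡ i [MOD m] := by
    rw [show s + (i + m - s) = i + m by omega]
    exact Nat.add_modEq_right
  constructor
  · intro h
    exact Nat.ModEq.add_left_cancel' s (h.trans h2.symm)
  · intro h
    exact (Nat.ModEq.add_left s h).trans h2

theorem spot_cycleB {k : ℕ} (hi : i ≤ n) (hn : 3 ≤ n)
    (h : P.storey k = Pattern.cycleB n (k % (2 * n - 1))) :
    (i ≤ 1 → storeySpot P (.colour i) k =
      if k % (2 * n - 1) = 0 then some ⟨k, true, true⟩ else none) ∧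
    (2 ≤ i → storeySpot P (.colour i) k =
      if k % (2 * n - 1) = i - 1 then some ⟨k, false, true⟩
      else if k % (2 * n - 1) = 2 * n - i then some ⟨k, true, false⟩ else none) := by
  have hr : k % (2 * n - 1) < 2 * n - 1 := Nat.mod_lt _ (by omega)
  unfold storeySpot
  rw [h]
  generalize k % (2 * n - 1) = r at *
  unfold Pattern.cycleB
  by_cases h0 : r = 0
  · subst h0
    refine ⟨fun hi => by simp [hi], fun hi' => ?_⟩
    simp [show ¬ i ≤ 1 by omega, show 0 ≠ i - 1 by omega, show 0 ≠ 2 * n - i by omega]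
  · by_cases h1 : r ≤ n - 1
    · simp only [h0, h1, if_false, if_true]
      refine ⟨fun hi => ?_, fun hi' => ?_⟩
      · rw [if_neg (by omega)]
      · by_cases h2 : r + 1 = i
        · rw [if_pos h2, if_pos (by omega)]
        · rw [if_neg h2, if_neg (by omega), if_neg (by omega)]
    · simp only [h0, h1, if_false]
      refine ⟨fun hi => ?_, fun hi' => ?_⟩
      · rw [if_neg (by omega)]
      · rw [if_neg (show ¬ r = i - 1 by omega)]
        by_cases h2 : r = 2 * n - i
        · rw [if_pos h2, if_pos (by omega)]
        · rw [if_neg h2, if_neg (by omega)]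

theorem spot_cycleC {k : ℕ} (hi : i ≤ n) (hn : 1 ≤ n)
    (h : P.storey k = Pattern.cycleC n (k % (2 * n + 1))) :
    (i = n → storeySpot P (.colour i) k =
      if k % (2 * n + 1) = n + 1 then some ⟨k, true, true⟩ else none) ∧
    (i < n → storeySpot P (.colour i) k =
      if k % (2 * n + 1) = i + 1 then some ⟨k, false, true⟩
      else if k % (2 * n + 1) = if i = 0 then 0 else 2 * n + 1 - i then some ⟨k, true, false⟩
      else none) := by
  have hr : k % (2 * n + 1) < 2 * n + 1 := Nat.mod_lt _ (by omega)
  unfold storeySpot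
  rw [h]
  generalize k % (2 * n + 1) = r at *
  unfold Pattern.cycleC
  by_cases h0 : r = 0
  · subst h0
    refine ⟨fun hi => ?_, fun hi' => ?_⟩
    · simp [show 0 ≠ i by omega]
    · by_cases hi0 : i = 0
      · simp [hi0]
      · simp [hi0, show 0 ≠ i by omega, show 0 ≠ 2 * n + 1 - i by omega]
  · by_cases h1 : r ≤ n
    · simp only [h0, h1, if_false, if_true]
      refine ⟨fun hi => ?_, fun hi' => ?_⟩
      · rw [if_neg (by omega), if_neg (by omega)]
      · by_cases h2 : r = i + 1
        · rw [if_pos h2, if_pos (by omega)]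
        · rw [if_neg h2, if_neg (by omega), if_neg]
          split_ifs <;> omega
    · by_cases h2 : r = n + 1
      · subst h2
        simp only [h0, h1, if_false, if_true]
        refine ⟨fun hi => by rw [if_pos hi.symm], fun hi' => ?_⟩
        have h3 : n + 1 ≠ if i = 0 then 0 else 2 * n + 1 - i := by split_ifs <;> omega
        rw [if_neg (show ¬ n = i by omega), if_neg (show ¬ n + 1 = i + 1 by omega), if_neg h3]
      · simp only [h0, h1, h2, if_false]
        refine ⟨fun hi => ?_, fun hi' => ?_⟩
        · rw [if_neg (by omega)]
        · rw [if_neg (show ¬ r = i + 1 by omega)]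
          by_cases hi0 : i = 0
          · subst hi0
            rw [if_neg (by omega), if_neg (by simp [h0])]
          · rw [if_neg hi0]
            by_cases h3 : r = 2 * n + 1 - i
            · rw [if_pos h3, if_pos (by omega)]
            · rw [if_neg h3, if_neg (by omega)]

theorem spot_cycleD {k : ℕ} (hi : i ≤ n)
    (h : P.storey k = Pattern.cycleD n (k % (2 * n + 2))) :
    storeySpot P (.colour i) k =
      if k % (2 * n + 2) = i + 1 then some ⟨k, false, true⟩
      else if k % (2 * n + 2) = if i = 0 then 0 else 2 * n + 2 - i then some ⟨k, true, false⟩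
      else none := by
  have hr : k % (2 * n + 2) < 2 * n + 2 := Nat.mod_lt _ (by omega)
  unfold storeySpot
  rw [h]
  generalize k % (2 * n + 2) = r at *
  unfold Pattern.cycleD
  by_cases h0 : r = 0
  · subst h0
    by_cases hi0 : i = 0
    · simp [hi0]
    · simp [hi0, show 0 ≠ i by omega, show 0 ≠ 2 * n + 2 - i by omega]
  · by_cases h1 : r ≤ n + 1
    · simp only [h0, h1, if_false, if_true]
      by_cases h2 : r = i + 1
      · rw [if_pos h2, if_pos (by omega)]
      · rw [if_neg h2, if_neg (by omega), if_neg]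
        split_ifs <;> omega
    · simp only [h0, h1, if_false]
      rw [if_neg (show ¬ r = i + 1 by omega)]
      by_cases hi0 : i = 0
      · subst hi0
        rw [if_neg (by omega), if_neg (by simp [h0])]
      · rw [if_neg hi0]
        by_cases h3 : r = 2 * n + 2 - i
        · rw [if_pos h3, if_pos (by omega)]
        · rw [if_neg h3, if_neg (by omega)]

/-- For pieces occurring twice in a cycle, `a` is the supporting position and `b` the covering one;
the type decides which of them is of the second kind. -/
theorem exists_spot_iff {q : Piece} {k r a b : ℕ} (hab : a ≠ b)
    (e : storeySpot P q k = if r = a then some ⟨k, false, true⟩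
      else if r = b then some ⟨k, true, false⟩ else none) :
    ((∃ x, storeySpot P q k = some x ∧ isSecond P x = true) ↔ r = if bLike P then a else b) ∧
    ((∃ x, storeySpot P q k = some x ∧ isFirst P x = true) ↔ r = if bLike P then b else a) ∧
    ((∃ x, storeySpot P q k = some x) ↔ r = a ∨ r = b) := by
  rw [e]
  by_cases h2 : r = a
  · cases hb : bLike P <;> simp [h2, isSecond, isFirst, hab, hb]
  · by_cases h3 : r = b
    · cases hb : bLike P <;> simp [h3, isSecond, isFirst, hab.symm, hb]
    · cases hb : bLike P <;> simp [h2, h3]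

/-- The positions of the `i`-blocks, in terms of residues. -/
theorem colour_iff_mod (hi : i ≤ n) (k : ℕ) :
    (SecondAt P i k ↔ k % P.period = secondRes P i) ∧
    (FirstAt P i k ↔ k % P.period = firstRes P i) ∧
    (HasColour P i k ↔ k % P.period = secondRes P i ∨ k % P.period = firstRes P i) := by
  unfold SecondAt FirstAt HasColour
  cases P with
  | A1 hn s =>
    have e : storeySpot (.A1 hn s) (.colour i) k =
        if (s.val + k) % (n + 1) = i then some ⟨k, true, true⟩ else none := by
      simp [storeySpot, Pattern.storey]
    have e2 := add_mod_eq_iff (m := n + 1) (k := k) (i := i) s.isLt (by omega)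
    rw [e]
    simp only [Pattern.period, secondRes, firstRes, or_self, ← e2]
    split_ifs with h <;> simp [h, isSecond, isFirst, bLike]
  | B1 hn z =>
    have e := spot_cycleB (P := .B1 hn z) hi hn (k := k) rfl
    simp only [Pattern.period, secondRes, firstRes]
    split_ifs with h
    · rw [e.1 h]
      split_ifs with h2 <;> simp [h2, isSecond, isFirst, bLike]
    · exact exists_spot_iff (by omega) (e.2 (by omega))
  | A2odd hn z =>
    have e := spot_cycleB (P := .A2odd hn z) hi hn (k := k) rfl
    simp only [Pattern.period, secondRes, firstRes]
    split_ifs with h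
    · rw [e.1 h]
      split_ifs with h2 <;> simp [h2, isSecond, isFirst, bLike]
    · exact exists_spot_iff (by omega) (e.2 (by omega))
  | C1 hn =>
    have e := spot_cycleC (P := .C1 hn) hi (by omega) (k := k) rfl
    simp only [Pattern.period, secondRes, firstRes]
    by_cases h : i = n
    · rw [e.1 h, if_neg (show ¬ i = 0 by omega), show 2 * n + 1 - i = n + 1 by omega, h]
      split_ifs with h2 <;> simp [h2, isSecond, isFirst, bLike]
    · rw [or_comm]
      exact exists_spot_iff (b := if i = 0 then 0 else 2 * n + 1 - i) (by split_ifs <;> omega)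
        (e.2 (by omega))
  | A2even hn =>
    have e := spot_cycleC (P := .A2even hn) hi (by omega) (k := k) rfl
    simp only [Pattern.period, secondRes, firstRes]
    by_cases h : i = n
    · rw [e.1 h, if_neg (show ¬ i = 0 by omega), show 2 * n + 1 - i = n + 1 by omega, h]
      split_ifs with h2 <;> simp [h2, isSecond, isFirst, bLike]
    · rw [or_comm]
      exact exists_spot_iff (b := if i = 0 then 0 else 2 * n + 1 - i) (by split_ifs <;> omega)
        (e.2 (by omega))
  | D2 hn =>
    have e := spot_cycleD (P := .D2 hn) hi (k := k) rfl
    simp only [Pattern.period, secondRes, firstRes]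
    rw [or_comm]
    exact exists_spot_iff (b := if i = 0 then 0 else 2 * n + 2 - i) (by split_ifs <;> omega) e

theorem residue_lt (hi : i ≤ n) : secondRes P i < P.period ∧ firstRes P i < P.period := by
  cases P with
  | A1 hn s => exact ⟨Nat.mod_lt _ (by simp), Nat.mod_lt _ (by simp)⟩
  | _ => simp only [secondRes, firstRes, Pattern.period]; split_ifs <;> omega

theorem period_ge_two : 2 ≤ P.period := by
  cases P <;> simp only [Pattern.period] <;> omega

/-- What the arrangement of the `i`-blocks means for the residues. -/
theorem mode_residues (hi : i ≤ n) :
    (mode P i = .single → firstRes P i = secondRes P i) ∧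
    (mode P i = .generic → firstRes P i ≠ secondRes P i ∧ firstRes P i + 1 ≠ secondRes P i ∧
      secondRes P i + 1 ≠ firstRes P i ∧ 0 < firstRes P i ∧ 0 < secondRes P i) ∧
    (mode P i = .doubled → firstRes P i = secondRes P i + 1 ∧ 3 ≤ P.period) ∧
    (mode P i = .tight → secondRes P i = firstRes P i + 1 ∧ 3 ≤ P.period) := by
  cases P <;> simp only [mode, secondRes, firstRes, Pattern.period, reduceCtorEq, false_imp_iff, and_true, imp_true_iff] <;>
    split_ifs <;> simp <;> omega


end Residues

end YoungSlice

namespace YoungSlice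

/-! ### Adjacency of the `i`-storeys, and the piece to be split for each colour. -/

section SplitPieces

variable {n : ℕ} {P : Pattern n} {i : ℕ} {q : Piece}

/-- Only the tight arrangement has an `i`-storey directly below one of the second kind. In all
others, adding an `i`-block never opens a slot of the second kind. -/
theorem not_secondAt_succ (hi : i ≤ n) (hm : mode P i ≠ .tight) {k : ℕ} (hk : HasColour P i k) :
    ¬ SecondAt P i (k + 1) := by
  have h1 := mode_residues (P := P) hi
  have h2 := residue_lt (P := P) hi
  have h3 := period_ge_two (P := P)
  rw [(colour_iff_mod hi _).2.2] at hk
  rw [(colour_iff_mod hi _).1, add_one_mod_eq (by omega)]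
  cases h : mode P i <;> simp only [h, reduceCtorEq, false_imp_iff, forall_const, and_true, true_and] at h1
  · split_ifs <;> omega
  · split_ifs <;> omega
  · split_ifs <;> omega
  · exact absurd h hm

theorem not_firstAt_succ (hi : i ≤ n) (hm : mode P i ≠ .doubled) {k : ℕ} (hk : HasColour P i k) :
    ¬ FirstAt P i (k + 1) := by
  have h1 := mode_residues (P := P) hi
  have h2 := residue_lt (P := P) hi
  have h3 := period_ge_two (P := P)
  rw [(colour_iff_mod hi _).2.2] at hk
  rw [(colour_iff_mod hi _).2.1, add_one_mod_eq (by omega)]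
  cases h : mode P i <;> simp only [h, reduceCtorEq, false_imp_iff, forall_const, and_true, true_and] at h1
  · split_ifs <;> omega
  · split_ifs <;> omega
  · exact absurd h hm
  · split_ifs <;> omega

theorem not_hasColour_succ (hi : i ≤ n) (hm : mode P i ≠ .tight) {k : ℕ} (hk : FirstAt P i k) :
    ¬ HasColour P i (k + 1) := by
  have h1 := mode_residues (P := P) hi
  have h2 := residue_lt (P := P) hi
  have h3 := period_ge_two (P := P)
  rw [(colour_iff_mod hi _).2.1] at hk
  rw [(colour_iff_mod hi _).2.2, add_one_mod_eq (by omega)]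
  cases h : mode P i <;> simp only [h, reduceCtorEq, false_imp_iff, forall_const, and_true, true_and] at h1
  · split_ifs <;> omega
  · split_ifs <;> omega
  · split_ifs <;> omega
  · exact absurd h hm

theorem secondAt_iff_firstAt (hi : i ≤ n) (hm : mode P i = .single) (k : ℕ) :
    SecondAt P i k ↔ FirstAt P i k := by
  rw [(colour_iff_mod hi _).1, (colour_iff_mod hi _).2.1, (mode_residues hi).1 hm]

theorem not_secondAt_and_firstAt (hi : i ≤ n) (hm : mode P i ≠ .single) (k : ℕ) :
    ¬ (SecondAt P i k ∧ FirstAt P i k) := by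
  have h1 := mode_residues (P := P) hi
  rw [(colour_iff_mod hi _).1, (colour_iff_mod hi _).2.1]
  cases h : mode P i <;> simp only [h, reduceCtorEq, false_imp_iff, forall_const, and_true, true_and] at h1
  · exact absurd h hm
  all_goals omega

theorem hasColour_iff (hi : i ≤ n) (k : ℕ) : HasColour P i k ↔ SecondAt P i k ∨ FirstAt P i k := by
  rw [(colour_iff_mod hi _).1, (colour_iff_mod hi _).2.1, (colour_iff_mod hi _).2.2]

theorem firstAt_succ_iff (hi : i ≤ n) (hm : mode P i = .doubled) (k : ℕ) :
    FirstAt P i (k + 1) ↔ SecondAt P i k := by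
  have h1 := (mode_residues (P := P) hi).2.2.1 hm
  have h2 := residue_lt (P := P) hi
  rw [(colour_iff_mod hi _).1, (colour_iff_mod hi _).2.1, add_one_mod_eq (by omega)]
  split_ifs <;> omega

theorem secondAt_succ_iff (hi : i ≤ n) (hm : mode P i = .tight) (k : ℕ) :
    SecondAt P i (k + 1) ↔ FirstAt P i k := by
  have h1 := (mode_residues (P := P) hi).2.2.2 hm
  have h2 := residue_lt (P := P) hi
  rw [(colour_iff_mod hi _).1, (colour_iff_mod hi _).2.1, add_one_mod_eq (by omega)]
  split_ifs <;> omega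

theorem not_firstAt_zero (hi : i ≤ n) (hm : mode P i = .doubled) : ¬ FirstAt P i 0 := by
  have h1 := (mode_residues (P := P) hi).2.2.1 hm
  rw [(colour_iff_mod hi _).2.1, Nat.zero_mod]
  omega

theorem not_secondAt_zero (hi : i ≤ n) (hm : mode P i = .tight) : ¬ SecondAt P i 0 := by
  have h1 := (mode_residues (P := P) hi).2.2.2 hm
  rw [(colour_iff_mod hi _).1, Nat.zero_mod]
  omega

/-- Needed for shifts: taking an `i`-block from the bottom storey can empty a layer, and an empty
layer with a cycle added shows the last storey of the cycle. If that were an `i`-storey, a new top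
`i`-block would appear. -/
theorem not_hasColour_last (hi : i ≤ n) (h0 : HasColour P i 0) :
    ¬ HasColour P i (P.period - 1) := by
  have h1 := mode_residues (P := P) hi
  have h2 := residue_lt (P := P) hi
  have h3 := period_ge_two (P := P)
  rw [(colour_iff_mod hi _).2.2, Nat.zero_mod] at h0
  rw [(colour_iff_mod hi _).2.2, Nat.mod_eq_of_lt (by omega)]
  cases h : mode P i <;>
    simp only [h, reduceCtorEq, false_imp_iff, forall_const, and_true, true_and] at h1 <;> omega

theorem secondAt_mod_eq (hi : i ≤ n) {k k' : ℕ} (h : SecondAt P i k) (h' : SecondAt P i k') :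
    k % P.period = k' % P.period := by
  rw [(colour_iff_mod hi _).1] at h h'
  rw [h, h']

theorem firstAt_mod_eq (hi : i ≤ n) {k k' : ℕ} (h : FirstAt P i k) (h' : FirstAt P i k') :
    k % P.period = k' % P.period := by
  rw [(colour_iff_mod hi _).2.1] at h h'
  rw [h, h']

theorem notSecondAt_firstAt (hi : i ≤ n) {k : ℕ} (h : NotSecondAt P i k) : FirstAt P i k :=
  ((hasColour_iff hi k).mp h.1).resolve_left h.2

theorem notFirstAt_secondAt (hi : i ≤ n) {k : ℕ} (h : NotFirstAt P i k) : SecondAt P i k :=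
  ((hasColour_iff hi k).mp h.1).resolve_right h.2

theorem storey_halves_cases {k : ℕ} (h : P.storey k = .halves) :
    k % P.period = 0 ∧ ((∃ hn z, P = .B1 hn z) ∨ ∃ hn z, P = .A2odd hn z) := by
  cases P with
  | A1 => cases h
  | B1 hn z =>
    refine ⟨?_, Or.inl ⟨hn, z, rfl⟩⟩
    simp only [Pattern.storey, Pattern.cycleB] at h
    split_ifs at h
    assumption
  | A2odd hn z =>
    refine ⟨?_, Or.inr ⟨hn, z, rfl⟩⟩
    simp only [Pattern.storey, Pattern.cycleB] at h
    split_ifs at h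
    assumption
  | C1 => simp only [Pattern.storey, Pattern.cycleC] at h; split_ifs at h
  | A2even => simp only [Pattern.storey, Pattern.cycleC] at h; split_ifs at h
  | D2 => simp only [Pattern.storey, Pattern.cycleD] at h; split_ifs at h

theorem mode_of_halves {k : ℕ} (h : P.storey k = .halves) (hk : HasColour P i k) :
    mode P i = .single := by
  have hi := hk.le_one h
  obtain ⟨-, ⟨hn, z, rfl⟩ | ⟨hn, z, rfl⟩⟩ := storey_halves_cases h <;> simp [mode, hi]

/-- A criterion for `q`-blocks to be split before the `i`-th operators act. -/
theorem splits_of (hi : i ≤ n) (hm : mode P i = .generic ∨ mode P i = .doubled)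
    (h1 : ∀ k, (∃ x, storeySpot P q k = some x ∧ isSecond P x = true) ↔ SecondAt P i (k + 1))
    (h2 : ∀ k, (∃ x, storeySpot P q (k + 1) = some x ∧ isFirst P x = true) ↔ FirstAt P i k)
    (h3 : ∀ k, P.storey k = .halves → 2 ≤ i ∧ ∀ j, q = .colour j → 2 ≤ j) : Splits P i q := by
  have hmt : mode P i ≠ .tight := by rcases hm with h | h <;> simp [h]
  have t1 : ∀ c : Column, c.Valid P → ∀ s, c.half = some s →
      topBlock P q c = none ∧ topSlot P q c = none ∧ 2 ≤ i := by
    intro c hc s hs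
    obtain ⟨h4, h5⟩ := h3 _ (hc (by simp [hs]))
    refine ⟨?_, ?_, h4⟩
    · cases q with
      | cube01 => simp [topBlock, hs]
      | colour j =>
        have := h5 j rfl
        have := halfColour_le_one (P := P) s
        simp only [topBlock, hs]
        rw [if_neg (by omega)]
    · cases q with
      | cube01 => simp [topSlot, hs]
      | colour j =>
        have := h5 j rfl
        have := halfColour_le_one (P := P) (!s)
        simp only [topSlot, hs]
        rw [if_neg (by omega)]
  refine ⟨fun c hc hne => ?_, fun c x hx hx' hc => ?_, fun c hc hne => ?_, fun c x hx hx' hc => ?_,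
    fun k hk => not_secondAt_succ hi hmt hk, fun k hk => not_hasColour_succ hi hmt hk⟩
  · obtain ⟨k, o⟩ := c
    cases o with
    | some s =>
      obtain ⟨h4, -, h6⟩ := t1 _ hc s rfl
      simp only [h4, reduceCtorEq, false_and, exists_false, false_iff]
      rintro ⟨h7, -⟩
      have := h7.hasColour.le_one (hc rfl)
      omega
    | none =>
      -- The empty column may have an `i`-slot in the storey `0`, but nothing lies below that could
      -- be split.
      have hk : k ≠ 0 := fun h => hne (by rw [h, Column.empty])
      simp only [topBlock, hk, if_false, h1, SlotAt, Nat.sub_add_cancel (Nat.pos_of_ne_zero hk)]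
      simp
  · obtain ⟨k, o⟩ := c
    cases o with
    | some s =>
      rw [(t1 _ hc s rfl).1] at hx
      cases hx
    | none =>
      simp only [topBlock] at hx
      split_ifs at hx with h
      rw [storeySpot_height hx]
      simp only
      omega
  · obtain ⟨k, o⟩ := c
    cases o with
    | some s =>
      obtain ⟨-, h4, h6⟩ := t1 _ hc s rfl
      simp only [h4, reduceCtorEq, false_and, exists_false, false_iff]
      rintro ⟨h, h7, ⟨h8, -⟩ | ⟨-, s', -, h8⟩⟩
      · cases h8
      · have := halfColour_le_one (P := P) s'
        omega
    | none =>
      have hk : k ≠ 0 := fun h => hne (by rw [h, Column.empty])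
      obtain ⟨k, rfl⟩ := Nat.exists_eq_succ_of_ne_zero hk
      simp only [topSlot, Nat.succ_eq_add_one, h2, BlockAt, TopAt]
      simp
  · obtain ⟨k, o⟩ := c
    cases o with
    | some s =>
      rw [(t1 _ hc s rfl).2.1] at hx
      cases hx
    | none =>
      simp only [topSlot] at hx
      exact ⟨storeySpot_height hx, rfl⟩

theorem succ_mod_eq_iff {m a b : ℕ} (h : (a + 1 = m ∧ b = 0) ∨ (a + 1 < m ∧ b = a + 1)) (k : ℕ) :
    k % m = a ↔ (k + 1) % m = b := by
  have hm : 0 < m := by omega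
  have := Nat.mod_lt k hm
  rw [add_one_mod_eq hm]
  split_ifs <;> omega

/-- The hypotheses say that, cyclically, the second `j`-storey is directly below the second
`i`-storey and the first `j`-storey directly above the first `i`-storey. This singles out `j = i -
1` in the `B`-like types and `j = i + 1` in the others. -/
theorem splits_colour {j : ℕ} (hi : i ≤ n) (hj : j ≤ n)
    (hm : mode P i = .generic ∨ mode P i = .doubled)
    (h1 : (secondRes P j + 1 = P.period ∧ secondRes P i = 0) ∨
      (secondRes P j + 1 < P.period ∧ secondRes P i = secondRes P j + 1))
    (h2 : (firstRes P i + 1 = P.period ∧ firstRes P j = 0) ∨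
      (firstRes P i + 1 < P.period ∧ firstRes P j = firstRes P i + 1))
    (h3 : ∀ k, P.storey k = .halves → 2 ≤ i ∧ 2 ≤ j) : Splits P i (.colour j) := by
  refine splits_of hi hm (fun k => ?_) (fun k => ?_) fun k hk => ⟨(h3 k hk).1, ?_⟩
  · exact (colour_iff_mod hj k).1.trans ((succ_mod_eq_iff h1 k).trans (colour_iff_mod hi _).1.symm)
  · exact (colour_iff_mod hj (k + 1)).2.1.trans
      ((succ_mod_eq_iff h2 k).symm.trans (colour_iff_mod hi _).2.1.symm)
  · rintro _ ⟨⟩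
    exact (h3 k hk).2

/-- The storey `01` is both below the ascending `2` and, cyclically, above the descending `2`; being
covering and supporting, it serves as source and as target. -/
theorem splits_cube (hi : 2 ≤ n) (hm : mode P 2 = .generic ∨ mode P 2 = .doubled)
    (hb : bLike P = true) (hper : P.period = 2 * n - 1)
    (h : ∀ k, P.storey k = Pattern.cycleB n (k % (2 * n - 1)))
    (h1 : secondRes P 2 = 1) (h2 : firstRes P 2 + 1 = P.period) : Splits P 2 .cube01 := by
  have key : ∀ k, ((∃ x, storeySpot P .cube01 k = some x ∧ isSecond P x = true) ↔
        k % P.period = 0) ∧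
      ((∃ x, storeySpot P .cube01 k = some x ∧ isFirst P x = true) ↔ k % P.period = 0) := by
    intro k
    unfold storeySpot
    rw [h, hper]
    unfold Pattern.cycleB
    by_cases h0 : k % (2 * n - 1) = 0
    · simp [h0, isSecond, isFirst, hb]
    · by_cases h1 : k % (2 * n - 1) ≤ n - 1 <;> simp [h0, h1]
  refine splits_of hi hm (fun k => ?_) (fun k => ?_) fun k _ => ⟨le_rfl, by rintro _ ⟨⟩⟩
  · exact (key k).1.trans ((succ_mod_eq_iff (Or.inr ⟨by omega, h1⟩) k).trans
      (colour_iff_mod hi _).1.symm)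
  · exact (key (k + 1)).2.trans ((succ_mod_eq_iff (Or.inl ⟨h2, rfl⟩) k).symm.trans
      (colour_iff_mod hi _).2.1.symm)

theorem splitPiece_spec (hi : i ≤ n) :
    match splitPiece P i with
    | none => mode P i = .single ∨ mode P i = .tight
    | some q => (mode P i = .generic ∨ mode P i = .doubled) ∧ Splits P i q := by
  cases P with
  | A1 hn s => simp [splitPiece, mode]
  | D2 hn | C1 hn | A2even hn =>
    by_cases h : i = n
    · simp [h, mode, splitPiece]
    · simp only [splitPiece, h, if_false]
      refine ⟨by simp only [mode, h, if_false]; split_ifs <;> simp,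
        splits_colour hi (by omega) (by simp only [mode, h, if_false]; split_ifs <;> simp) ?_ ?_ ?_⟩
      · simp only [Pattern.period, secondRes, if_neg (Nat.succ_ne_zero i)]
        split_ifs <;> (try simp only [and_true]) <;> omega
      · simp only [Pattern.period, firstRes]
        simp only [and_true]
        omega
      · intro k hk
        obtain ⟨-, ⟨_, _, h⟩ | ⟨_, _, h⟩⟩ := storey_halves_cases hk <;> cases h
  | B1 hn z | A2odd hn z =>
    by_cases h : i ≤ 1
    · simp [h, mode, splitPiece]
    by_cases h2 : i = 2
    · subst h2
      simp only [splitPiece, h, if_false, if_true]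
      refine ⟨by simp only [mode, h, if_false]; split_ifs <;> simp,
        splits_cube hi (by simp only [mode, h, if_false]; split_ifs <;> simp) rfl rfl
          (fun _ => rfl) ?_ ?_⟩
      · simp [secondRes]
      · simp only [Pattern.period, firstRes]
        split_ifs; omega
    · simp only [splitPiece, h, h2, if_false]
      refine ⟨by simp only [mode, h, if_false]; split_ifs <;> simp,
        splits_colour hi (by omega) (by simp only [mode, h, if_false]; split_ifs <;> simp) ?_ ?_ ?_⟩
      · simp only [Pattern.period, secondRes]
        split_ifs <;> omega
      · simp only [Pattern.period, firstRes]
        split_ifs <;> omega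
      · intro k hk
        omega

end SplitPieces

end YoungSlice

namespace YoungSlice

/-! ### Counting slots and blocks -/

section Counts

variable {n : ℕ} (P : Pattern n) (i : ℕ) {L : ℕ}

/-- The number of `i`-block splittings. -/
noncomputable def splitCount (C : Fin L → Column) : ℕ :=
  match mode P i with
  | .single => 0
  | .tight => 0
  | _ => min (slotCount P i (SecondAt P i) C) (blockCount P i (FirstAt P i) C)

/-- The number of times that an `i`-block can be added. -/
noncomputable def addable (C : Fin L → Column) : ℕ :=
  match mode P i with
  | .single => slotCount P i (SecondAt P i) C
  | .generic => (slotCount P i (SecondAt P i) C - blockCount P i (FirstAt P i) C) +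
      slotCount P i (NotSecondAt P i) C
  | .doubled => 2 * (slotCount P i (SecondAt P i) C - blockCount P i (FirstAt P i) C) +
      slotCount P i (NotSecondAt P i) C
  | .tight => slotCount P i (SecondAt P i) C + 2 * slotCount P i (NotSecondAt P i) C

/-- The number of times that an `i`-block can be removed. -/
noncomputable def removable (C : Fin L → Column) : ℕ :=
  match mode P i with
  | .single => blockCount P i (FirstAt P i) C
  | .generic => (blockCount P i (FirstAt P i) C - slotCount P i (SecondAt P i) C) +
      blockCount P i (NotFirstAt P i) C
  | .doubled => 2 * (blockCount P i (FirstAt P i) C - slotCount P i (SecondAt P i) C) +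
      blockCount P i (NotFirstAt P i) C
  | .tight => blockCount P i (FirstAt P i) C + 2 * blockCount P i (NotFirstAt P i) C

/-- The rule for adding an `i`-block turns `C` into `C'`. -/
def AddStep (C C' : Fin L → Column) : Prop :=
  ∃ k, Move P i C C' k ∧
    ((splitCount P i C < slotCount P i (SecondAt P i) C ∧ SecondAt P i k) ∨
      (slotCount P i (SecondAt P i) C ≤ splitCount P i C ∧ ¬ SecondAt P i k))

/-- The rule for removing an `i`-block turns `C'` into `C`. -/
def RemoveStep (C' C : Fin L → Column) : Prop :=
  ∃ k, Move P i C C' k ∧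
    ((splitCount P i C' < blockCount P i (FirstAt P i) C' ∧ FirstAt P i k) ∨
      (blockCount P i (FirstAt P i) C' ≤ splitCount P i C' ∧ ¬ FirstAt P i k))

variable {P i} {C C' C₁ C₂ : Fin L → Column} {p : ℕ → Prop} {k : ℕ}

open Classical in
theorem card_filter_update (Q : Column → Prop) (C : Fin L → Column) (j : Fin L) (d : Column) :
    (Finset.univ.filter fun m => Q (Function.update C j d m)).card + (if Q (C j) then 1 else 0) =
      (Finset.univ.filter fun m => Q (C m)).card + (if Q d then 1 else 0) := by
  simp only [Finset.card_filter]
  rw [← Finset.add_sum_erase _ _ (Finset.mem_univ j),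
    ← Finset.add_sum_erase _ (fun m => if Q (C m) then 1 else 0) (Finset.mem_univ j)]
  have : ∑ x ∈ Finset.univ.erase j, (if Q (Function.update C j d x) then 1 else 0) =
      ∑ x ∈ Finset.univ.erase j, if Q (C x) then 1 else 0 := by
    refine Finset.sum_congr rfl fun x hx => ?_
    rw [Function.update_of_ne (Finset.ne_of_mem_erase hx)]
  rw [this, Function.update_self]
  omega

theorem not_hasColour_succ_of_halves (hi : i ≤ n) (hk : HasColour P i k)
    (hs : P.storey k = .halves) : ¬ HasColour P i (k + 1) := by
  have hm := mode_of_halves hs hk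
  refine not_hasColour_succ hi (by simp [hm]) ?_
  rcases (hasColour_iff hi k).mp hk with h | h
  · exact (secondAt_iff_firstAt hi hm k).mp h
  · exact h

theorem not_hasColour_of_succ_halves (hi : i ≤ n) (hk : HasColour P i (k + 1))
    (hs : P.storey (k + 1) = .halves) : ¬ HasColour P i k := by
  have hm := mode_of_halves hs hk
  intro h
  rw [hasColour_iff hi, secondAt_iff_firstAt hi hm, or_self] at h
  exact not_hasColour_succ hi (by simp [hm]) h hk

theorem slotAt_iff_of_slot {c : Column} (hs : SlotAt P i (HasColour P i) c) :
    SlotAt P i p c ↔ p c.full := ⟨fun h => h.1, fun h => ⟨h, hs.2⟩⟩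

theorem blockAt_addBlock_iff {c : Column} (hc : c.Valid P) (hs : SlotAt P i (HasColour P i) c) :
    BlockAt P i p (addBlock P i c) ↔ p c.full := by
  have ht := topAt_addBlock hc hs.1
  constructor
  · rintro ⟨h, hp, ht'⟩
    rwa [ht.unique ht']
  · exact fun h => ⟨_, h, ht⟩

/-- When only a half is filled, the column stays in the same storey and both sides are false: the
slot is taken, and a colour of half-unit depth does not recur one storey higher. -/
theorem slotAt_addBlock_iff (hi : i ≤ n) {c : Column} (hc : c.Valid P)
    (hs : SlotAt P i (HasColour P i) c) (hp : ∀ k, p k → HasColour P i k) :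
    SlotAt P i p (addBlock P i c) ↔ p (c.full + 1) := by
  rcases addBlock_cases (i := i) hc with ⟨h1, h2, h⟩ | ⟨h1, h2, h⟩ | ⟨h1, h2, h⟩ <;> rw [h]
  · constructor
    · rintro ⟨-, h3⟩
      exact absurd (halfColour_sideOf (hs.1.le_one h2)) (h3 _ rfl)
    · exact fun h3 => absurd (hp _ h3) (not_hasColour_succ_of_halves hi hs.1 h2)
  · simp [SlotAt]
  · simp [SlotAt]

theorem blockAt_iff_of_slot (hi : i ≤ n) {c : Column} (hc : c.Valid P)
    (hs : SlotAt P i (HasColour P i) c) (hp : ∀ k, p k → HasColour P i k) :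
    BlockAt P i p c ↔ ∃ h, c.full = h + 1 ∧ p h := by
  constructor
  · rintro ⟨h, hph, ⟨-, h1⟩ | ⟨-, s, h1, h2⟩⟩
    · exact ⟨h, h1, hph⟩
    · exact absurd h2 (hs.2 s h1)
  · rintro ⟨h, h1, hph⟩
    refine ⟨h, hph, Or.inl ⟨?_, h1⟩⟩
    cases h2 : c.half with
    | none => rfl
    | some s =>
      have h3 := hc (by simp [h2])
      have h4 := hs.1
      rw [h1] at h3 h4
      exact absurd (hp h hph) (not_hasColour_of_succ_halves hi h4 h3)

open Classical in
theorem Move.slotCount_eq (hi : i ≤ n) (hm : Move P i C C' k) (hp : ∀ k, p k → HasColour P i k) :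
    slotCount P i p C' + (if p k then 1 else 0) =
      slotCount P i p C + (if p (k + 1) then 1 else 0) := by
  obtain ⟨hC, hC', j, hs, rfl, rfl⟩ := hm
  have := card_filter_update (SlotAt P i p) C j (addBlock P i (C j))
  simp only [slotAt_iff_of_slot hs, slotAt_addBlock_iff hi (hC.valid j) hs hp] at this
  exact this

-- Only one layer changes: it gains a top block in the storey `k` and has its former top block, in
-- the storey below, covered. The existential avoids `k - 1`, which would be wrong at the ground.
open Classical in
theorem Move.blockCount_eq (hi : i ≤ n) (hm : Move P i C C' k) (hp : ∀ k, p k → HasColour P i k) :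
    blockCount P i p C' + (if ∃ h, k = h + 1 ∧ p h then 1 else 0) =
      blockCount P i p C + (if p k then 1 else 0) := by
  obtain ⟨hC, hC', j, hs, rfl, rfl⟩ := hm
  have := card_filter_update (BlockAt P i p) C j (addBlock P i (C j))
  simp only [blockAt_addBlock_iff (hC.valid j) hs, blockAt_iff_of_slot hi (hC.valid j) hs hp] at this
  exact this

theorem Move.hasColour (hm : Move P i C C' k) : HasColour P i k := by
  obtain ⟨-, -, j, hs, rfl, -⟩ := hm
  exact hs.1

theorem slotCount_eq_zero (h : ∀ k, ¬ p k) : slotCount P i p C = 0 := by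
  classical
  rw [slotCount, Finset.card_eq_zero, Finset.filter_eq_empty_iff]
  exact fun j _ hj => h _ hj.1

theorem blockCount_eq_zero (h : ∀ k, ¬ p k) : blockCount P i p C = 0 := by
  classical
  rw [blockCount, Finset.card_eq_zero, Finset.filter_eq_empty_iff]
  rintro j - ⟨k, hk, -⟩
  exact h k hk

/-- How the numbers of slots and blocks change when an `i`-block is added. -/
theorem Move.counts (hi : i ≤ n) (hm : Move P i C C' k) :
    match mode P i with
    | .single => SecondAt P i k ∧ FirstAt P i k ∧
        slotCount P i (SecondAt P i) C = slotCount P i (SecondAt P i) C' + 1 ∧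
        blockCount P i (FirstAt P i) C' = blockCount P i (FirstAt P i) C + 1
    | .generic =>
        (SecondAt P i k ∧ ¬ FirstAt P i k ∧
          slotCount P i (SecondAt P i) C = slotCount P i (SecondAt P i) C' + 1 ∧
          blockCount P i (FirstAt P i) C' = blockCount P i (FirstAt P i) C ∧
          slotCount P i (NotSecondAt P i) C' = slotCount P i (NotSecondAt P i) C ∧
          blockCount P i (NotFirstAt P i) C' = blockCount P i (NotFirstAt P i) C + 1) ∨
        (¬ SecondAt P i k ∧ FirstAt P i k ∧
          slotCount P i (SecondAt P i) C = slotCount P i (SecondAt P i) C' ∧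
          blockCount P i (FirstAt P i) C' = blockCount P i (FirstAt P i) C + 1 ∧
          slotCount P i (NotSecondAt P i) C = slotCount P i (NotSecondAt P i) C' + 1 ∧
          blockCount P i (NotFirstAt P i) C' = blockCount P i (NotFirstAt P i) C)
    | .doubled =>
        (SecondAt P i k ∧ ¬ FirstAt P i k ∧
          slotCount P i (SecondAt P i) C = slotCount P i (SecondAt P i) C' + 1 ∧
          blockCount P i (FirstAt P i) C' = blockCount P i (FirstAt P i) C ∧
          slotCount P i (NotSecondAt P i) C' = slotCount P i (NotSecondAt P i) C + 1 ∧
          blockCount P i (NotFirstAt P i) C' = blockCount P i (NotFirstAt P i) C + 1) ∨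
        (¬ SecondAt P i k ∧ FirstAt P i k ∧
          slotCount P i (SecondAt P i) C = slotCount P i (SecondAt P i) C' ∧
          blockCount P i (FirstAt P i) C' = blockCount P i (FirstAt P i) C + 1 ∧
          slotCount P i (NotSecondAt P i) C = slotCount P i (NotSecondAt P i) C' + 1 ∧
          blockCount P i (NotFirstAt P i) C = blockCount P i (NotFirstAt P i) C' + 1)
    | .tight =>
        (SecondAt P i k ∧ ¬ FirstAt P i k ∧
          slotCount P i (SecondAt P i) C = slotCount P i (SecondAt P i) C' + 1 ∧
          blockCount P i (FirstAt P i) C = blockCount P i (FirstAt P i) C' + 1 ∧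
          slotCount P i (NotSecondAt P i) C' = slotCount P i (NotSecondAt P i) C ∧
          blockCount P i (NotFirstAt P i) C' = blockCount P i (NotFirstAt P i) C + 1) ∨
        (¬ SecondAt P i k ∧ FirstAt P i k ∧
          slotCount P i (SecondAt P i) C' = slotCount P i (SecondAt P i) C + 1 ∧
          blockCount P i (FirstAt P i) C' = blockCount P i (FirstAt P i) C + 1 ∧
          slotCount P i (NotSecondAt P i) C = slotCount P i (NotSecondAt P i) C' + 1 ∧
          blockCount P i (NotFirstAt P i) C' = blockCount P i (NotFirstAt P i) C) := by
  have hI := hm.hasColour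
  have ea := hm.slotCount_eq hi (p := SecondAt P i) fun _ h => h.hasColour
  have es := hm.slotCount_eq hi (p := NotSecondAt P i) fun _ h => h.1
  have eb := hm.blockCount_eq hi (p := FirstAt P i) fun _ h => h.hasColour
  have ek := hm.blockCount_eq hi (p := NotFirstAt P i) fun _ h => h.1
  have hSF := (hasColour_iff hi k).mp hI
  cases h : mode P i with
  | single =>
    have hS : SecondAt P i k ∧ FirstAt P i k := by
      rw [secondAt_iff_firstAt hi h, or_self] at hSF
      exact ⟨(secondAt_iff_firstAt hi h k).mpr hSF, hSF⟩
    have h1 : ¬ SecondAt P i (k + 1) := not_secondAt_succ hi (by simp [h]) hI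
    have h2 : ¬ ∃ h, k = h + 1 ∧ FirstAt P i h := by
      rintro ⟨m, rfl, hx⟩
      exact not_hasColour_succ hi (by simp [h]) hx hI
    simp only [if_pos hS.1, if_pos hS.2, if_neg h1, if_neg h2] at ea eb
    exact ⟨hS.1, hS.2, by omega, by omega⟩
  | generic =>
    have h1 : ¬ SecondAt P i (k + 1) := not_secondAt_succ hi (by simp [h]) hI
    have h2 : ¬ ∃ h, k = h + 1 ∧ FirstAt P i h := by
      rintro ⟨m, rfl, hx⟩
      exact not_hasColour_succ hi (by simp [h]) hx hI
    have h3 : ¬ NotSecondAt P i (k + 1) := fun h4 =>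
      not_firstAt_succ hi (by simp [h]) hI (notSecondAt_firstAt hi h4)
    have h4 : ¬ ∃ h, k = h + 1 ∧ NotFirstAt P i h := by
      rintro ⟨m, rfl, hx⟩
      rcases hSF with h5 | h5
      · exact not_secondAt_succ hi (by simp [h]) hx.1 h5
      · exact not_firstAt_succ hi (by simp [h]) hx.1 h5
    have h5 := not_secondAt_and_firstAt hi (by simp [h] : mode P i ≠ .single) k
    simp only [if_neg h1, if_neg h2, if_neg h3, if_neg h4] at ea eb es ek
    by_cases hS : SecondAt P i k
    · have hF : ¬ FirstAt P i k := fun h6 => h5 ⟨hS, h6⟩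
      simp only [NotSecondAt, NotFirstAt, hS, hF, not_true, not_false_iff, and_true, and_false, hI,
        if_true, if_false] at ea eb es ek
      exact Or.inl ⟨hS, hF, by omega, by omega, by omega, by omega⟩
    · have hF := hSF.resolve_left hS
      simp only [NotSecondAt, NotFirstAt, hS, hF, not_true, not_false_iff, and_true, and_false, hI,
        if_true, if_false] at ea eb es ek
      exact Or.inr ⟨hS, hF, by omega, by omega, by omega, by omega⟩
  | doubled =>
    have h1 : ¬ SecondAt P i (k + 1) := not_secondAt_succ hi (by simp [h]) hI
    have h2 : ¬ ∃ h, k = h + 1 ∧ FirstAt P i h := by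
      rintro ⟨m, rfl, hx⟩
      exact not_hasColour_succ hi (by simp [h]) hx hI
    have h5 := not_secondAt_and_firstAt hi (by simp [h] : mode P i ≠ .single)
    -- Filling the lower storey of a pair opens a slot in the upper one; `h4` says that filling the
    -- upper storey covers the block in the lower one.
    have h3 : NotSecondAt P i (k + 1) ↔ SecondAt P i k := by
      rw [← firstAt_succ_iff hi h]
      exact ⟨notSecondAt_firstAt hi, fun h => ⟨h.hasColour, h1⟩⟩
    have h4 : (∃ h, k = h + 1 ∧ NotFirstAt P i h) ↔ FirstAt P i k := by
      constructor
      · rintro ⟨m, rfl, hx⟩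
        exact (firstAt_succ_iff hi h m).mpr (notFirstAt_secondAt hi hx)
      · intro hF
        obtain ⟨m, rfl⟩ := Nat.exists_eq_succ_of_ne_zero
          (fun h0 => not_firstAt_zero hi h (h0 ▸ hF) : k ≠ 0)
        have := (firstAt_succ_iff hi h m).mp hF
        exact ⟨m, rfl, this.hasColour, fun h6 => h5 m ⟨this, h6⟩⟩
    have h5 := h5 k
    rw [if_neg h1] at ea
    rw [if_neg h2] at eb
    by_cases hS : SecondAt P i k
    · have hF : ¬ FirstAt P i k := fun h6 => h5 ⟨hS, h6⟩
      rw [if_pos (h3.mpr hS)] at es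
      rw [if_neg (h4.not.mpr hF)] at ek
      simp only [NotSecondAt, NotFirstAt, hS, hF, not_true, not_false_iff, and_true, and_false, hI,
        if_true, if_false] at ea eb es ek
      exact Or.inl ⟨hS, hF, by omega, by omega, by omega, by omega⟩
    · have hF := hSF.resolve_left hS
      rw [if_neg (h3.not.mpr hS)] at es
      rw [if_pos (h4.mpr hF)] at ek
      simp only [NotSecondAt, NotFirstAt, hS, hF, not_true, not_false_iff, and_true, and_false, hI,
        if_true, if_false] at ea eb es ek
      exact Or.inr ⟨hS, hF, by omega, by omega, by omega, by omega⟩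
  | tight =>
    have h5 := not_secondAt_and_firstAt hi (by simp [h] : mode P i ≠ .single)
    have h1 : SecondAt P i (k + 1) ↔ FirstAt P i k := secondAt_succ_iff hi h k
    have h3 : ¬ NotSecondAt P i (k + 1) := fun h4 =>
      not_firstAt_succ hi (by simp [h]) hI (notSecondAt_firstAt hi h4)
    -- Here the first kind is the lower storey of the pair: by `h1`, filling it opens a slot of the
    -- second kind, and filling the upper storey covers a block of the first kind.
    have h2 : (∃ h, k = h + 1 ∧ FirstAt P i h) ↔ SecondAt P i k := by
      constructor
      · rintro ⟨m, rfl, hx⟩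
        exact (secondAt_succ_iff hi h m).mpr hx
      · intro hF
        obtain ⟨m, rfl⟩ := Nat.exists_eq_succ_of_ne_zero
          (fun h0 => not_secondAt_zero hi h (h0 ▸ hF) : k ≠ 0)
        exact ⟨m, rfl, (secondAt_succ_iff hi h m).mp hF⟩
    have h4 : ¬ ∃ h, k = h + 1 ∧ NotFirstAt P i h := by
      rintro ⟨m, rfl, hx⟩
      rcases hSF with h6 | h6
      · exact hx.2 ((secondAt_succ_iff hi h m).mp h6)
      · exact not_firstAt_succ hi (by simp [h]) hx.1 h6
    have h5 := h5 k
    rw [if_neg h3] at es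
    rw [if_neg h4] at ek
    by_cases hS : SecondAt P i k
    · have hF : ¬ FirstAt P i k := fun h6 => h5 ⟨hS, h6⟩
      rw [if_neg (h1.not.mpr hF)] at ea
      rw [if_pos (h2.mpr hS)] at eb
      simp only [NotSecondAt, NotFirstAt, hS, hF, not_true, not_false_iff, and_true, and_false, hI,
        if_true, if_false] at ea eb es ek
      exact Or.inl ⟨hS, hF, by omega, by omega, by omega, by omega⟩
    · have hF := hSF.resolve_left hS
      rw [if_pos (h1.mpr hF)] at ea
      rw [if_neg (h2.not.mpr hS)] at eb
      simp only [NotSecondAt, NotFirstAt, hS, hF, not_true, not_false_iff, and_true, and_false, hI,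
        if_true, if_false] at ea eb es ek
      exact Or.inr ⟨hS, hF, by omega, by omega, by omega, by omega⟩

/-- In the case of two consecutive storeys, a layer between them has a slot and a block. -/
theorem slotCount_eq_blockCount_of_tight (hi : i ≤ n) (hC : IsChain P C)
    (h : mode P i = .tight) :
    slotCount P i (SecondAt P i) C = blockCount P i (FirstAt P i) C := by
  classical
  unfold slotCount blockCount
  congr 1
  refine Finset.filter_congr fun j _ => ?_
  have hhalf : HasColour P i (C j).full → (C j).half = none := by
    intro hI
    cases h2 : (C j).half with
    | none => rfl
    | some s => simpa [h] using mode_of_halves (hC.valid j (by simp [h2])) hI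
  constructor
  · intro hs
    rw [blockAt_iff_of_slot hi (hC.valid j) (hs.imp SecondAt.hasColour) fun _ h => h.hasColour]
    obtain ⟨m, hm⟩ := Nat.exists_eq_succ_of_ne_zero
      (fun h0 => not_secondAt_zero hi h (h0 ▸ hs.1) : (C j).full ≠ 0)
    have := hs.1
    rw [hm] at this
    exact ⟨m, hm, (secondAt_succ_iff hi h m).mp this⟩
  · rintro ⟨m, hm, ⟨h1, h2⟩ | ⟨h1, s, h2, -⟩⟩
    · have := (secondAt_succ_iff hi h m).mpr hm
      exact ⟨h2 ▸ this, by simp [h1]⟩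
    · rw [← h1] at hm
      simp [hhalf hm.hasColour] at h2

/-- A layer whose slot is in the upper storey of a pair is one whose top block is in the lower
storey. -/
theorem slotCount_eq_blockCount_of_doubled (hi : i ≤ n) (hC : IsChain P C)
    (h : mode P i = .doubled) :
    slotCount P i (NotSecondAt P i) C = blockCount P i (NotFirstAt P i) C := by
  classical
  have hne := not_secondAt_and_firstAt hi (by simp [h] : mode P i ≠ .single)
  unfold slotCount blockCount
  congr 1
  refine Finset.filter_congr fun j _ => ?_
  have hhalf : HasColour P i (C j).full → (C j).half = none := by
    intro hI
    cases h2 : (C j).half with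
    | none => rfl
    | some s => simpa [h] using mode_of_halves (hC.valid j (by simp [h2])) hI
  constructor
  · intro hs
    rw [blockAt_iff_of_slot hi (hC.valid j) (hs.imp And.left) fun _ h => h.1]
    have h1 := notSecondAt_firstAt hi hs.1
    obtain ⟨m, hm⟩ := Nat.exists_eq_succ_of_ne_zero
      (fun h0 => not_firstAt_zero hi h (h0 ▸ h1) : (C j).full ≠ 0)
    rw [hm] at h1
    have h2 := (firstAt_succ_iff hi h m).mp h1
    exact ⟨m, hm, h2.hasColour, fun h3 => hne m ⟨h2, h3⟩⟩
  · rintro ⟨m, hm, ⟨h1, h2⟩ | ⟨h1, s, h2, -⟩⟩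
    · have := (firstAt_succ_iff hi h m).mpr (notFirstAt_secondAt hi hm)
      refine ⟨h2 ▸ ⟨this.hasColour, fun h3 => hne (m + 1) ⟨h3, this⟩⟩, by simp [h1]⟩
    · rw [← h1] at hm
      simp [hhalf hm.1] at h2

/-- At most one layer between two consecutive storeys of which the upper one has priority when
blocks are added. -/
def TightBound (P : Pattern n) (i : ℕ) (C : Fin L → Column) : Prop :=
  mode P i = .tight → blockCount P i (FirstAt P i) C ≤ 1

/-- Let `a` count slots of the second kind and `b` blocks of the first. If `a > b`, the step lowers
`a` and still `b ≤ a`, so the removal rule looks for a block not of the first kind, which is the one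
just added. If `a ≤ b`, the step raises `b` above `a`, and the rule removes a block of the first
kind. In the tight case `a = b ≤ 1`, and `a` alternates between `0` and `1`. -/
theorem AddStep.removeStep (hi : i ≤ n) (h : AddStep P i C C') (hb : TightBound P i C) :
    RemoveStep P i C' C := by
  obtain ⟨k, hm, h⟩ := h
  refine ⟨k, hm, ?_⟩
  have hc := hm.counts hi
  unfold TightBound at hb
  unfold splitCount at h ⊢
  have e := slotCount_eq_blockCount_of_tight hi hm.1
  cases hmode : mode P i <;>
    simp only [hmode, reduceCtorEq, false_imp_iff, forall_const] at h hc hb e ⊢ <;> grind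

theorem RemoveStep.addStep (hi : i ≤ n) (h : RemoveStep P i C' C) (hb : TightBound P i C') :
    AddStep P i C C' := by
  obtain ⟨k, hm, h⟩ := h
  refine ⟨k, hm, ?_⟩
  have hc := hm.counts hi
  unfold TightBound at hb
  unfold splitCount at h ⊢
  have e := slotCount_eq_blockCount_of_tight hi hm.1
  cases hmode : mode P i <;>
    simp only [hmode, reduceCtorEq, false_imp_iff, forall_const] at h hc hb e ⊢ <;> grind

/-- The weights `2` in the counts reflect adjacency. In the doubled case, filling the lower storey
of a pair replaces a slot worth two additions by a slot worth one; in the tight case, an untouched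
pair is worth two and a half-filled pair one. -/
theorem AddStep.addable_removable (hi : i ≤ n) (h : AddStep P i C C') (hb : TightBound P i C) :
    addable P i C = addable P i C' + 1 ∧ removable P i C' = removable P i C + 1 ∧
      TightBound P i C' := by
  obtain ⟨k, hm, h⟩ := h
  have hc := hm.counts hi
  unfold TightBound at hb ⊢
  unfold addable removable
  unfold splitCount at h
  have e := slotCount_eq_blockCount_of_tight hi hm.1
  cases hmode : mode P i <;>
    simp only [hmode, reduceCtorEq, false_imp_iff, forall_const, and_true] at h hc hb e ⊢ <;>
    grind

theorem RemoveStep.tightBound (hi : i ≤ n) (h : RemoveStep P i C' C) (hb : TightBound P i C') :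
    TightBound P i C := by
  obtain ⟨k, hm, h⟩ := h
  have hc := hm.counts hi
  unfold TightBound at hb ⊢
  unfold splitCount at h
  cases hmode : mode P i <;>
    simp only [hmode, reduceCtorEq, false_imp_iff, forall_const] at h hc hb ⊢
  grind

/-- In `min a b`, the entry `a` is lowered only if `a > b`, and `b` is raised only if `a ≤ b`. Hence
the same broken halves serve for a second block, without splitting anew. -/
theorem AddStep.splitCount_eq (hi : i ≤ n) (h : AddStep P i C C') :
    splitCount P i C' = splitCount P i C := by
  obtain ⟨k, hm, h⟩ := h
  have hc := hm.counts hi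
  unfold splitCount at h ⊢
  cases hmode : mode P i <;> simp only [hmode] at h hc ⊢ <;> grind

theorem RemoveStep.splitCount_eq (hi : i ≤ n) (h : RemoveStep P i C' C) :
    splitCount P i C = splitCount P i C' := by
  obtain ⟨k, hm, h⟩ := h
  have hc := hm.counts hi
  unfold splitCount at h ⊢
  cases hmode : mode P i <;> simp only [hmode] at h hc ⊢ <;> grind

/-- The counts decide between the second kind and the rest, and an `i`-storey not of the second kind
is of the first; within one residue class the move is unique. -/
theorem AddStep.unique (hi : i ≤ n) (h₁ : AddStep P i C C₁) (h₂ : AddStep P i C C₂) : C₁ = C₂ := by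
  obtain ⟨k₁, m₁, h₁⟩ := h₁
  obtain ⟨k₂, m₂, h₂⟩ := h₂
  by_cases hs : splitCount P i C < slotCount P i (SecondAt P i) C
  · exact m₁.unique m₂ (p := SecondAt P i) secondAt_add_period (fun _ _ => secondAt_mod_eq hi)
      (h₁.resolve_right fun h => absurd hs (not_lt.mpr h.1)).2
      (h₂.resolve_right fun h => absurd hs (not_lt.mpr h.1)).2
  · have e₁ : FirstAt P i k₁ := notSecondAt_firstAt hi ⟨m₁.hasColour,
      (h₁.resolve_left fun h => hs h.1).2⟩
    have e₂ : FirstAt P i k₂ := notSecondAt_firstAt hi ⟨m₂.hasColour,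
      (h₂.resolve_left fun h => hs h.1).2⟩
    exact m₁.unique m₂ (p := FirstAt P i) firstAt_add_period (fun _ _ => firstAt_mod_eq hi) e₁ e₂

theorem RemoveStep.unique (hi : i ≤ n) (h₁ : RemoveStep P i C C₁) (h₂ : RemoveStep P i C C₂) :
    C₁ = C₂ := by
  obtain ⟨k₁, m₁, h₁⟩ := h₁
  obtain ⟨k₂, m₂, h₂⟩ := h₂
  by_cases hs : splitCount P i C < blockCount P i (FirstAt P i) C
  · exact m₁.unique_left m₂ (p := FirstAt P i) (fun _ _ => firstAt_mod_eq hi)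
      (h₁.resolve_right fun h => absurd hs (not_lt.mpr h.1)).2
      (h₂.resolve_right fun h => absurd hs (not_lt.mpr h.1)).2
  · have e₁ : SecondAt P i k₁ := notFirstAt_secondAt hi ⟨m₁.hasColour,
      (h₁.resolve_left fun h => hs h.1).2⟩
    have e₂ : SecondAt P i k₂ := notFirstAt_secondAt hi ⟨m₂.hasColour,
      (h₂.resolve_left fun h => hs h.1).2⟩
    exact m₁.unique_left m₂ (p := SecondAt P i) (fun _ _ => secondAt_mod_eq hi) e₁ e₂

end Counts

end YoungSlice

namespace YoungSlice

/-! ### The operators on chains -/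

/-- The `m`-fold composition of a relation with itself. -/
def iterRel {α : Type*} (R : α → α → Prop) : ℕ → α → α → Prop
  | 0, a, b => a = b
  | m + 1, a, c => ∃ b, iterRel R m a b ∧ R b c

/-! ### Reversal, uniqueness and transport of iterated relations. -/

section IterRel

variable {α : Type*} {R R' : α → α → Prop} {Q : α → Prop}

theorem iterRel_head {m : ℕ} {a b c : α} (h : R a b) (h' : iterRel R m b c) :
    iterRel R (m + 1) a c := by
  induction m generalizing c with
  | zero => exact ⟨a, rfl, by cases h'; exact h⟩
  | succ m ih =>
    obtain ⟨d, hd, hd'⟩ := h'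
    exact ⟨d, ih hd, hd'⟩

/-- Single steps can be reversed only under the invariant `Q`, which is therefore carried along from
the start. -/
theorem iterRel_swap (hR : ∀ a b, Q a → R a b → R' b a ∧ Q b) {m : ℕ} {a c : α} (ha : Q a)
    (h : iterRel R m a c) : iterRel R' m c a ∧ Q c := by
  induction m generalizing c with
  | zero => cases h; exact ⟨rfl, ha⟩
  | succ m ih =>
    obtain ⟨d, hd, hd'⟩ := h
    obtain ⟨h1, h2⟩ := ih hd
    obtain ⟨h3, h4⟩ := hR _ _ h2 hd'
    exact ⟨iterRel_head h3 h1, h4⟩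

theorem iterRel_unique (hR : ∀ a b c, R a b → R a c → b = c) {m : ℕ} {a b c : α}
    (h : iterRel R m a b) (h' : iterRel R m a c) : b = c := by
  induction m generalizing b c with
  | zero => exact h.symm.trans h'
  | succ m ih =>
    obtain ⟨d, hd, hd'⟩ := h
    obtain ⟨e, he, he'⟩ := h'
    cases ih hd he
    exact hR _ _ _ hd' he'

theorem iterRel_map {f : α → α} (hR : ∀ a b, Q a → R a b → R (f a) (f b) ∧ Q b) {m : ℕ} {a c : α}
    (ha : Q a) (h : iterRel R m a c) : iterRel R m (f a) (f c) ∧ Q c := by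
  induction m generalizing c with
  | zero => cases h; exact ⟨rfl, ha⟩
  | succ m ih =>
    obtain ⟨d, hd, hd'⟩ := h
    obtain ⟨h1, h2⟩ := ih hd
    obtain ⟨h3, h4⟩ := hR _ _ h2 hd'
    exact ⟨⟨_, h1, h3⟩, h4⟩

end IterRel

section Operators

variable {n : ℕ} {P : Pattern n} {i : ℕ} {L : ℕ} {C C' : Fin L → Column} {D D' : Fin L → Layer}

theorem AddStep.isChain (h : AddStep P i C C') : IsChain P C ∧ IsChain P C' := by
  obtain ⟨k, hm, -⟩ := h
  exact ⟨hm.1, hm.2.1⟩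

theorem RemoveStep.isChain (h : RemoveStep P i C' C) : IsChain P C ∧ IsChain P C' := by
  obtain ⟨k, hm, -⟩ := h
  exact ⟨hm.1, hm.2.1⟩

theorem preparedForm_spec (hi : i ≤ n) (hC : IsChain P C) (hne : ∀ j, C j ≠ Column.empty) :
    Splitting P i C (preparedForm P i C) ∧ lostCount (preparedForm P i C) = splitCount P i C := by
  have h := splitPiece_spec (P := P) hi
  unfold preparedForm splitCount
  cases hq : splitPiece P i with
  | none =>
    rw [hq] at h
    have := splitting_whole (P := P) (i := i) (C := C) (D := fun j => .whole (C j)) rfl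
      fun j => ⟨_, rfl⟩
    rcases h with h | h <;> rw [h] <;> exact this
  | some q =>
    rw [hq] at h
    have := splitting_splitForm h.2 hC.valid hne
    rcases h.1 with h | h <;> rw [h] <;> exact this

/-- A partially split chain to which an `i`-block can be added by the rule for `f_i`. -/
structure AddReady (P : Pattern n) (i : ℕ) (D : Fin L → Layer) : Prop where
  isChain : IsChain P (glued D)
  slotReady : SlotReady P i D
  lostCount_eq : lostCount D = splitCount P i (glued D)

/-- A partially split chain from which an `i`-block can be removed by the rule for `e_i`. -/
structure RemoveReady (P : Pattern n) (i : ℕ) (D : Fin L → Layer) : Prop where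
  isChain : IsChain P (glued D)
  blockReady : BlockReady P i D
  gainedCount_eq : gainedCount D = splitCount P i (glued D)

/-- Readiness must persist because two blocks may be added to the same split form. The tight case is
exempt, since there only one block is moved. -/
theorem AddReady.addStep (hi : i ≤ n) (hD : AddReady P i D) (h : fStep P i D = some D') :
    AddStep P i (glued D) (glued D') ∧ (mode P i ≠ .tight → AddReady P i D') := by
  obtain ⟨j, c, hc, rfl, hs, hm, hk⟩ := hD.slotReady.fStep_some hD.isChain h
  rw [hD.lostCount_eq] at hk
  have hstep : AddStep P i (glued D) (glued (Function.update D j (.whole (addBlock P i c)))) :=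
    ⟨_, hm, hk⟩
  refine ⟨hstep, fun ht => ⟨hm.2.1, hD.slotReady.update_whole ?_, ?_⟩⟩
  · have hcv : c.Valid P := by simpa [glued, hc, Layer.glue] using hD.isChain.valid j
    rw [slotAt_addBlock_iff hi hcv hs fun _ h => h.hasColour]
    exact not_secondAt_succ hi ht hs.1
  · rw [lostCount_update_whole hc, hD.lostCount_eq, hstep.splitCount_eq hi]

/-- Being stuck means that every slot of the second kind is on a broken layer, so `a ≤ splitCount`,
and that no other slot exists; then each summand of `addable` vanishes. -/
theorem AddReady.addable_eq_zero (hD : AddReady P i D) (h : fStep P i D = none) :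
    addable P i (glued D) = 0 := by
  obtain ⟨h1, h2⟩ := hD.slotReady.fStep_none hD.isChain h
  rw [hD.lostCount_eq] at h1
  unfold addable
  unfold splitCount at h1
  cases hm : mode P i <;> simp only [hm] at h1 ⊢ <;> omega

theorem RemoveReady.removeStep (hi : i ≤ n) (hD : RemoveReady P i D)
    (h : eStep P i D = some D') :
    RemoveStep P i (glued D) (glued D') ∧ (mode P i ≠ .tight → RemoveReady P i D') := by
  obtain ⟨j, c, k, hc, rfl, hI, ht, hm, hk⟩ := hD.blockReady.eStep_some hD.isChain h
  rw [hD.gainedCount_eq] at hk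
  have hstep : RemoveStep P i (glued D) (glued (Function.update D j (.whole (removeBlock P i c)))) :=
    ⟨_, hm, hk⟩
  refine ⟨hstep, fun hmode => ⟨hm.1, hD.blockReady.update_whole ?_, ?_⟩⟩
  · have hcv : c.Valid P := by simpa [glued, hc, Layer.glue] using hD.isChain.valid j
    obtain ⟨r1, r2, r3, r4⟩ := removeBlock_spec hcv hI ht
    rw [blockAt_iff_of_slot hi r1 ⟨r2 ▸ hI, r3⟩ fun _ h => h.hasColour]
    rintro ⟨m, hm, hF⟩
    refine not_hasColour_succ hi hmode hF ?_
    rw [← hm, r2]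
    exact hI
  · rw [gainedCount_update_whole hc, hD.gainedCount_eq, hstep.splitCount_eq hi]

theorem RemoveReady.removable_eq_zero (hD : RemoveReady P i D) (h : eStep P i D = none) :
    removable P i (glued D) = 0 := by
  obtain ⟨h1, h2⟩ := hD.blockReady.eStep_none hD.isChain h
  rw [hD.gainedCount_eq] at h1
  unfold removable
  unfold splitCount at h1
  cases hm : mode P i <;> simp only [hm] at h1 ⊢ <;> omega

theorem RemoveStep.removable_eq (hi : i ≤ n) (h : RemoveStep P i C' C) (hb : TightBound P i C') :
    removable P i C' = removable P i C + 1 :=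
  ((h.addStep hi hb).addable_removable hi (h.tightBound hi hb)).2.1

theorem AddReady.iterate (hi : i ≤ n) (ht : mode P i ≠ .tight) (hD : AddReady P i D) (m : ℕ) :
    (∀ D', iterOpt (fStep P i) m D = some D' →
      iterRel (AddStep P i) m (glued D) (glued D') ∧ AddReady P i D' ∧
        addable P i (glued D) = addable P i (glued D') + m) ∧
    (iterOpt (fStep P i) m D = none → addable P i (glued D) < m) := by
  have htb : ∀ C : Fin L → Column, TightBound P i C := fun C h => absurd h ht
  induction m with
  | zero =>
    refine ⟨fun D' h => ?_, fun h => by cases h⟩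
    cases h
    exact ⟨rfl, hD, rfl⟩
  | succ m ih =>
    simp only [iterOpt, Option.bind_eq_some_iff, Option.bind_eq_none_iff]
    refine ⟨?_, fun h => ?_⟩
    · rintro D' ⟨D₁, h1, h2⟩
      obtain ⟨a1, a2, a3⟩ := ih.1 D₁ h1
      obtain ⟨b1, b2⟩ := a2.addStep hi h2
      have := (b1.addable_removable hi (htb _)).1
      exact ⟨⟨_, a1, b1⟩, b2 ht, by omega⟩
    · cases h1 : iterOpt (fStep P i) m D with
      | none => exact (ih.2 h1).trans (Nat.lt_succ_self m)
      | some D₁ =>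
        obtain ⟨a1, a2, a3⟩ := ih.1 D₁ h1
        have := a2.addable_eq_zero (h D₁ h1)
        omega

theorem RemoveReady.iterate (hi : i ≤ n) (ht : mode P i ≠ .tight) (hD : RemoveReady P i D)
    (m : ℕ) :
    (∀ D', iterOpt (eStep P i) m D = some D' →
      iterRel (RemoveStep P i) m (glued D) (glued D') ∧ RemoveReady P i D' ∧
        removable P i (glued D) = removable P i (glued D') + m) ∧
    (iterOpt (eStep P i) m D = none → removable P i (glued D) < m) := by
  have htb : ∀ C : Fin L → Column, TightBound P i C := fun C h => absurd h ht
  induction m with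
  | zero =>
    refine ⟨fun D' h => ?_, fun h => by cases h⟩
    cases h
    exact ⟨rfl, hD, rfl⟩
  | succ m ih =>
    simp only [iterOpt, Option.bind_eq_some_iff, Option.bind_eq_none_iff]
    refine ⟨?_, fun h => ?_⟩
    · rintro D' ⟨D₁, h1, h2⟩
      obtain ⟨a1, a2, a3⟩ := ih.1 D₁ h1
      obtain ⟨b1, b2⟩ := a2.removeStep hi h2
      have := b1.removable_eq hi (htb _)
      exact ⟨⟨_, a1, b1⟩, b2 ht, by omega⟩
    · cases h1 : iterOpt (eStep P i) m D with
      | none => exact (ih.2 h1).trans (Nat.lt_succ_self m)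
      | some D₁ =>
        obtain ⟨a1, a2, a3⟩ := ih.1 D₁ h1
        have := a2.removable_eq_zero (h D₁ h1)
        omega

theorem blocksMoved_cases : blocksMoved P i = 1 ∨ (blocksMoved P i = 2 ∧ mode P i = .doubled) := by
  cases P with
  | A2odd hn z =>
    simp only [blocksMoved, mode]
    split_ifs with h1 h2 <;> simp
    omega
  | C1 hn =>
    simp only [blocksMoved, mode]
    split_ifs with h1 h2 <;> simp
    omega
  | _ => simp [blocksMoved]

/-- The rule for `f_i` adds `blocksMoved P i` blocks, one after the other. -/
theorem fTuple_spec (hi : i ≤ n) (hC : IsChain P C) (hne : ∀ j, C j ≠ Column.empty) :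
    (∀ t, fTuple P i C = some t → iterRel (AddStep P i) (blocksMoved P i) C t) ∧
    (fTuple P i C = none → addable P i C < blocksMoved P i) := by
  obtain ⟨h1, h2⟩ := preparedForm_spec hi hC hne
  have hD : AddReady P i (preparedForm P i C) :=
    ⟨h1.glued_eq.symm ▸ hC, h1.slotReady, h1.glued_eq.symm ▸ h2⟩
  simp only [fTuple, Option.map_eq_some_iff, Option.map_eq_none_iff]
  by_cases ht : mode P i = .tight
  · have hb : blocksMoved P i = 1 := blocksMoved_cases.resolve_right (by simp [ht])
    simp only [hb, iterOpt, Option.bind_some]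
    refine ⟨?_, fun h => ?_⟩
    · rintro t ⟨D', h, rfl⟩
      exact ⟨C, rfl, h1.glued_eq ▸ (hD.addStep hi h).1⟩
    · have := hD.addable_eq_zero h
      rw [h1.glued_eq] at this
      omega
  · have h3 := hD.iterate hi ht (blocksMoved P i)
    rw [h1.glued_eq] at h3
    refine ⟨?_, h3.2⟩
    rintro t ⟨D', h, rfl⟩
    exact (h3.1 D' h).1

/-- The rule for `e_i` removes `blocksMoved P i` blocks, one after the other. -/
theorem eTuple_spec (hi : i ≤ n) (hC : IsChain P C) (hne : ∀ j, C j ≠ Column.empty) :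
    (∀ t, eTuple P i C = some t → iterRel (RemoveStep P i) (blocksMoved P i) C t) ∧
    (eTuple P i C = none → removable P i C < blocksMoved P i) := by
  obtain ⟨h1, h2⟩ := preparedForm_spec hi hC hne
  have hD : RemoveReady P i (preparedForm P i C) :=
    ⟨h1.glued_eq.symm ▸ hC, h1.blockReady, h1.card_eq.symm.trans (h1.glued_eq.symm ▸ h2)⟩
  simp only [eTuple, Option.map_eq_some_iff, Option.map_eq_none_iff]
  by_cases ht : mode P i = .tight
  · have hb : blocksMoved P i = 1 := blocksMoved_cases.resolve_right (by simp [ht])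
    simp only [hb, iterOpt, Option.bind_some]
    refine ⟨?_, fun h => ?_⟩
    · rintro t ⟨D', h, rfl⟩
      exact ⟨C, rfl, h1.glued_eq ▸ (hD.removeStep hi h).1⟩
    · have := hD.removable_eq_zero h
      rw [h1.glued_eq] at this
      omega
  · have h3 := hD.iterate hi ht (blocksMoved P i)
    rw [h1.glued_eq] at h3
    refine ⟨?_, h3.2⟩
    rintro t ⟨D', h, rfl⟩
    exact (h3.1 D' h).1

/-! #### Compatibility with shifts -/

/-- Adding a cycle to the layers of `C` does not uncover new `i`-blocks. -/
def ShiftStable (P : Pattern n) (i : ℕ) (C : Fin L → Column) : Prop :=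
  ∀ j, C j = Column.empty → ¬ HasColour P i (P.period - 1)

theorem card_filter_shift (Q : Column → Prop) [DecidablePred Q] (C : Fin L → Column)
    (hQ : ∀ j, Q ((C j).addDelta P) ↔ Q (C j)) :
    (Finset.univ.filter fun j => Q (shift P C j)).card =
      (Finset.univ.filter fun j => Q (C j)).card := by
  cases L with
  | zero => rfl
  | succ L =>
    rw [Finset.card_filter, Finset.card_filter, Fin.sum_univ_castSucc, Fin.sum_univ_succ, add_comm]
    congr 1
    · rw [shift_apply_last (j := 0) (k := Fin.last L) rfl rfl]
      simp only [hQ]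
    · refine Finset.sum_congr rfl fun j _ => ?_
      rw [shift_apply_of_succ (j := j.succ) (k := j.castSucc) rfl]

theorem slotCount_shift {p : ℕ → Prop} (hp : ∀ k, p (k + P.period) ↔ p k) :
    slotCount P i p (shift P C) = slotCount P i p C := by
  classical
  have := card_filter_shift (P := P) (SlotAt P i p) C fun j => slotAt_addDelta hp
  unfold slotCount
  convert this

/-- Adding a cycle exposes a new top block only on the empty column, namely in the storey `P.period
- 1`. -/
theorem blockAt_addDelta {p : ℕ → Prop} (hp : ∀ k, p (k + P.period) ↔ p k) {c : Column}
    (hc : c = Column.empty → ¬ p (P.period - 1)) :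
    BlockAt P i p (c.addDelta P) ↔ BlockAt P i p c := by
  constructor
  · rintro ⟨h, hph, ht⟩
    by_cases hh : P.period ≤ h
    · obtain ⟨m, rfl⟩ := Nat.exists_eq_add_of_le' hh
      exact ⟨m, (hp m).mp hph, topAt_addDelta.mp ht⟩
    · exfalso
      have := period_pos (P := P)
      obtain ⟨k, o⟩ := c
      rcases ht with ⟨h1, h2⟩ | ⟨h1, -⟩
      · simp only [Column.addDelta] at h1 h2
        refine hc (by rw [h1, show k = 0 by omega]; rfl) ?_
        rwa [show P.period - 1 = h by omega]
      · simp only [Column.addDelta] at h1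
        omega
  · rintro ⟨h, hph, ht⟩
    exact ⟨h + P.period, (hp h).mpr hph, topAt_addDelta.mpr ht⟩

theorem blockCount_shift {p : ℕ → Prop} (hp : ∀ k, p (k + P.period) ↔ p k)
    (hpI : ∀ k, p k → HasColour P i k) (hC : ShiftStable P i C) :
    blockCount P i p (shift P C) = blockCount P i p C := by
  classical
  have := card_filter_shift (P := P) (BlockAt P i p) C fun j =>
    blockAt_addDelta hp fun h h' => hC j h (hpI _ h')
  unfold blockCount
  convert this

theorem counts_shift (hC : ShiftStable P i C) :
    slotCount P i (SecondAt P i) (shift P C) = slotCount P i (SecondAt P i) C ∧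
    slotCount P i (NotSecondAt P i) (shift P C) = slotCount P i (NotSecondAt P i) C ∧
    blockCount P i (FirstAt P i) (shift P C) = blockCount P i (FirstAt P i) C ∧
    blockCount P i (NotFirstAt P i) (shift P C) = blockCount P i (NotFirstAt P i) C :=
  ⟨slotCount_shift secondAt_add_period,
    slotCount_shift fun k => by simp [NotSecondAt, hasColour_add_period, secondAt_add_period],
    blockCount_shift firstAt_add_period (fun _ h => h.hasColour) hC,
    blockCount_shift (fun k => by simp [NotFirstAt, hasColour_add_period, firstAt_add_period])
      (fun _ h => h.1) hC⟩

theorem addable_shift (hC : ShiftStable P i C) :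
    addable P i (shift P C) = addable P i C ∧ removable P i (shift P C) = removable P i C ∧
      splitCount P i (shift P C) = splitCount P i C := by
  obtain ⟨h1, h2, h3, h4⟩ := counts_shift hC
  simp only [addable, removable, splitCount, h1, h2, h3, h4, and_self]

theorem AddStep.shift (hC : ShiftStable P i C) (h : AddStep P i C C') :
    AddStep P i (shift P C) (shift P C') ∧ ShiftStable P i C' := by
  obtain ⟨k, hm, h⟩ := h
  constructor
  · obtain ⟨k', hk', hm'⟩ := hm.shift
    refine ⟨k', hm', ?_⟩
    rw [(addable_shift hC).2.2, (counts_shift hC).1]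
    rcases hk' with rfl | rfl
    · exact h
    · rwa [secondAt_add_period]
  · obtain ⟨hC1, hC', j, hs, rfl, rfl⟩ := hm
    intro m hm
    rcases eq_or_ne m j with rfl | hmj
    · rw [Function.update_self] at hm
      rcases addBlock_cases (i := i) (hC1.valid m) with ⟨-, -, h⟩ | ⟨-, -, h⟩ | ⟨-, -, h⟩ <;>
        rw [h] at hm <;> simp [Column.empty] at hm
    · rw [Function.update_of_ne hmj] at hm
      exact hC m hm

theorem RemoveStep.shift (hi : i ≤ n) (hC : ShiftStable P i C') (h : RemoveStep P i C' C) :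
    RemoveStep P i (shift P C') (shift P C) ∧ ShiftStable P i C := by
  obtain ⟨k, hm, h⟩ := h
  constructor
  · obtain ⟨k', hk', hm'⟩ := hm.shift
    refine ⟨k', hm', ?_⟩
    rw [(addable_shift hC).2.2, (counts_shift hC).2.2.1]
    rcases hk' with rfl | rfl
    · exact h
    · rwa [firstAt_add_period]
  · obtain ⟨hC1, hC', j, hs, rfl, rfl⟩ := hm
    intro m hm
    rcases eq_or_ne m j with rfl | hmj
    -- A layer emptied by this step has lost an `i`-block from the storey `0`.
    · refine not_hasColour_last hi ?_
      have := hs.1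
      rwa [hm] at this
    · refine hC m ?_
      rw [Function.update_of_ne hmj]
      exact hm

/-! #### The extra conditions -/

theorem eq_of_hasColour {j k : ℕ} (h : HasColour P i k) (h' : HasColour P j k)
    (hk : P.storey k ≠ .halves) : i = j := by
  obtain ⟨x, hx⟩ := h
  obtain ⟨y, hy⟩ := h'
  cases hs : P.storey k with
  | halves => exact absurd hs hk
  | unit c cov supp =>
    rw [unit_spot hs] at hx hy
    split_ifs at hx hy
    omega

theorem countBlocks_addBlock {j : ℕ} (hj : ∀ k, P.storey k = .halves → 2 ≤ j) {c : Column}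
    (hc : c.Valid P) (hs : HasColour P i c.full) :
    countBlocks P j (addBlock P i c) = countBlocks P j c + if i = j then 1 else 0 := by
  have hcount : countBlocks P j ⟨c.full + 1, none⟩ = countBlocks P j c +
      if (storeySpot P (.colour j) c.full).isSome = true then 1 else 0 := by
    simp only [countBlocks, Nat.count_succ]
  have hiff : (storeySpot P (.colour j) c.full).isSome = true ↔ HasColour P j c.full := by
    rw [Option.isSome_iff_exists]; rfl
  have hne : P.storey c.full = .halves → i ≠ j ∧ ¬ HasColour P j c.full := by
    intro h
    have h1 := hj _ h
    have h2 := hs.le_one h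
    exact ⟨by omega, fun h3 => by have := h3.le_one h; omega⟩
  rcases addBlock_cases (i := i) hc with ⟨h1, h2, h⟩ | ⟨h1, h2, h⟩ | ⟨h1, h2, h⟩ <;> rw [h]
  · rw [if_neg (hne h2).1]
    rfl
  · rw [hcount]
    by_cases hij : i = j
    · rw [if_pos hij, if_pos (hiff.mpr (hij ▸ hs))]
    · rw [if_neg hij, if_neg (fun h3 => hij (eq_of_hasColour hs (hiff.mp h3) h2))]
  · rw [hcount, if_neg (hne h2).1, if_neg (fun h3 => (hne h2).2 (hiff.mp h3))]

theorem Move.sum_countBlocks {j k : ℕ} (hj : ∀ k, P.storey k = .halves → 2 ≤ j)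
    (hm : Move P i C C' k) :
    ∑ m, countBlocks P j (C' m) = ∑ m, countBlocks P j (C m) + if i = j then 1 else 0 := by
  obtain ⟨hC, -, r, hs, rfl, rfl⟩ := hm
  rw [← Finset.add_sum_erase _ _ (Finset.mem_univ r),
    ← Finset.add_sum_erase _ (fun m => countBlocks P j (C m)) (Finset.mem_univ r)]
  have : ∑ x ∈ Finset.univ.erase r, countBlocks P j (Function.update C r (addBlock P i (C r)) x) =
      ∑ x ∈ Finset.univ.erase r, countBlocks P j (C x) := by
    refine Finset.sum_congr rfl fun x hx => ?_
    rw [Function.update_of_ne (Finset.ne_of_mem_erase hx)]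
  rw [this, Function.update_self, countBlocks_addBlock hj (hC.valid r) hs.1]
  omega

theorem iterRel_sum_countBlocks {j m : ℕ} (hj : ∀ k, P.storey k = .halves → 2 ≤ j)
    (h : iterRel (fun C C' => ∃ k, Move P i C C' k) m C C') :
    ∑ r, countBlocks P j (C' r) = ∑ r, countBlocks P j (C r) + if i = j then m else 0 := by
  induction m generalizing C' with
  | zero => cases h; simp
  | succ m ih =>
    obtain ⟨C₁, h1, k, h2⟩ := h
    rw [h2.sum_countBlocks hj, ih h1]
    split_ifs <;> omega

theorem iterRel.imp {α : Type*} {R R' : α → α → Prop} (hR : ∀ a b, R a b → R' a b) {m : ℕ} {a b : α}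
    (h : iterRel R m a b) : iterRel R' m a b := by
  induction m generalizing b with
  | zero => exact h
  | succ m ih =>
    obtain ⟨c, h1, h2⟩ := h
    exact ⟨c, ih h1, hR _ _ h2⟩

theorem topIsSupportingN_iff {hn : 2 ≤ n} {c : Column} (hc : c.Valid (.D2 hn)) :
    TopIsSupportingN (.D2 hn) c ↔ BlockAt (.D2 hn) n (FirstAt (.D2 hn) n) c := by
  constructor
  · rintro ⟨x, hx, hx2⟩
    rw [Option.mem_def, topBlock_eq_some hc] at hx
    exact ⟨x.height, ⟨x, hx.1, hx2⟩, hx.2⟩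
  · rintro ⟨h, ⟨x, hx, hx2⟩, ht⟩
    have := storeySpot_height hx
    subst this
    exact ⟨x, (topBlock_eq_some hc).mpr ⟨hx, ht⟩, hx2⟩

/-- In type `D_{n+1}^(2)` the first kind is the supporting one, so the condition on slices is the
bound that makes the tight case reversible. -/
theorem extraCondition_D2_iff {hn : 2 ≤ n} (hC : IsChain (.D2 hn) C) :
    ExtraCondition (.D2 hn) C ↔ TightBound (.D2 hn) n C := by
  classical
  have hm : mode (.D2 hn) n = .tight := by simp [mode]
  simp only [ExtraCondition, TightBound, hm, true_imp_iff, blockCount, Finset.card_le_one,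
    Finset.mem_filter, Finset.mem_univ, true_and, topIsSupportingN_iff (hC.valid _)]
  constructor
  · exact fun h j hj k hk => h j k hj hk
  · exact fun h j k hj hk => h j hj k hk

theorem mode_eq_tight_iff : mode P i = .tight ↔ (∃ hn, P = .D2 hn) ∧ i = n := by
  cases P <;> simp [mode] <;> split_ifs <;> simp [*]

theorem IsSlice.tightBound (h : IsSlice P C) : TightBound P i C := by
  intro hm
  obtain ⟨⟨hn, rfl⟩, rfl⟩ := mode_eq_tight_iff.mp hm
  exact (extraCondition_D2_iff h.isChain).mp h.extra hm

end Operators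

end YoungSlice

namespace YoungSlice

/-! ### The operators on slices -/

section Slices

variable {n : ℕ} {P : Pattern n} {i : ℕ} {L : ℕ} {C C' t : Fin L → Column}

theorem half_eq_none_of_D2 {hn : 2 ≤ n} {c : Column} (hc : c.Valid (.D2 hn)) : c.half = none := by
  cases h : c.half with
  | none => rfl
  | some s =>
    have := (storey_halves_cases (hc (by simp [h]))).2
    simp at this

/-- Directly above a supporting `n`-block comes the covering `n`-block. So a layer with a slot of
another colour has no supporting `n`-block on top, and after the addition the other colour is on
top. -/
theorem Move.blockCount_of_ne {hn : 2 ≤ n} {k : ℕ} (hin : i ≠ n) (hm : Move (.D2 hn) i C C' k) :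
    blockCount (.D2 hn) n (FirstAt (.D2 hn) n) C' =
      blockCount (.D2 hn) n (FirstAt (.D2 hn) n) C := by
  classical
  obtain ⟨hC, hC', j, hs, rfl, rfl⟩ := hm
  have hhalf : (Pattern.D2 hn).storey (C j).full ≠ .halves := fun h => by
    have := (storey_halves_cases h).2
    simp at this
  have h1 : ¬ BlockAt (.D2 hn) n (FirstAt (.D2 hn) n) (addBlock (.D2 hn) i (C j)) := by
    rintro ⟨h, hF, ht⟩
    rcases addBlock_cases (i := i) (hC.valid j) with ⟨-, h2, -⟩ | ⟨-, h2, h3⟩ | ⟨-, h2, -⟩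
    · exact hhalf h2
    · rw [h3] at ht
      rcases ht with ⟨-, h4⟩ | ⟨-, s, h4, -⟩
      · simp only [Nat.add_right_cancel_iff] at h4
        subst h4
        exact hin (eq_of_hasColour hs.1 hF.hasColour hhalf)
      · simp at h4
    · exact hhalf h2
  have h2 : ¬ BlockAt (.D2 hn) n (FirstAt (.D2 hn) n) (C j) := by
    rintro ⟨h, hF, ⟨-, h4⟩ | ⟨-, s, h4, -⟩⟩
    · have := (secondAt_succ_iff (P := .D2 hn) (i := n) le_rfl (by simp [mode]) h).mpr hF
      rw [← h4] at this
      exact hin (eq_of_hasColour hs.1 this.hasColour hhalf)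
    · simp [half_eq_none_of_D2 (hC.valid j)] at h4
  have := card_filter_update (BlockAt (.D2 hn) n (FirstAt (.D2 hn) n)) C j
    (addBlock (.D2 hn) i (C j))
  rw [if_neg h1, if_neg h2] at this
  unfold blockCount
  simpa using this

/-- Blocks of the colour whose parity is prescribed are moved two at a time. -/
theorem extraCondition_iff_of_moves (hP : ∀ hn, P ≠ .D2 hn)
    (h : iterRel (fun C C' => ∃ k, Move P i C C' k) (blocksMoved P i) C C') :
    ExtraCondition P C ↔ ExtraCondition P C' := by
  cases P with
  | A2odd hn z =>
    have := iterRel_sum_countBlocks (j := n) (fun _ _ => by omega) h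
    simp only [ExtraCondition, this, blocksMoved]
    split_ifs <;> simp [Nat.even_add]
  | C1 hn =>
    have := iterRel_sum_countBlocks (j := 0)
      (fun k hk => by have := (storey_halves_cases hk).2; simp at this) h
    simp only [ExtraCondition, this, blocksMoved]
    split_ifs <;> simp [Nat.even_add]
  | D2 hn => exact absurd rfl (hP hn)
  | _ => exact Iff.rfl

theorem IsSlice.of_addSteps (hi : i ≤ n) (hC : IsSlice P C)
    (h : iterRel (AddStep P i) (blocksMoved P i) C t) : IsSlice P t := by
  have hch : IsChain P t := (iterRel_swap (R := AddStep P i) (R' := fun _ _ => True) (Q := IsChain P)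
    (fun a b _ h => ⟨trivial, h.isChain.2⟩) hC.isChain h).2
  refine hch.isSlice ?_
  by_cases hP : ∃ hn, P = .D2 hn
  · obtain ⟨hn, rfl⟩ := hP
    obtain ⟨_, rfl, h⟩ : iterRel (AddStep (.D2 hn) i) 1 C t := h
    rw [extraCondition_D2_iff hch]
    have hb := (extraCondition_D2_iff hC.isChain).mp hC.extra
    by_cases hin : i = n
    · subst hin
      exact (h.addable_removable hi hb).2.2
    · obtain ⟨k, hm, -⟩ := h
      unfold TightBound at hb ⊢
      rwa [hm.blockCount_of_ne hin]
  · exact (extraCondition_iff_of_moves (fun hn h => hP ⟨hn, h⟩)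
      (h.imp fun _ _ ⟨k, hm, _⟩ => ⟨k, hm⟩)).mp hC.extra

theorem IsSlice.of_removeSteps (hi : i ≤ n) (hC : IsSlice P C)
    (h : iterRel (RemoveStep P i) (blocksMoved P i) C t) : IsSlice P t := by
  have hch : IsChain P t := (iterRel_swap (R := RemoveStep P i) (R' := fun _ _ => True)
    (Q := IsChain P) (fun a b _ h => ⟨trivial, h.isChain.1⟩) hC.isChain h).2
  refine hch.isSlice ?_
  by_cases hP : ∃ hn, P = .D2 hn
  · obtain ⟨hn, rfl⟩ := hP
    obtain ⟨_, rfl, h⟩ : iterRel (RemoveStep (.D2 hn) i) 1 C t := h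
    rw [extraCondition_D2_iff hch]
    have hb := (extraCondition_D2_iff hC.isChain).mp hC.extra
    by_cases hin : i = n
    · subst hin
      exact h.tightBound hi hb
    · obtain ⟨k, hm, -⟩ := h
      unfold TightBound at hb ⊢
      rwa [← hm.blockCount_of_ne hin]
  · exact (extraCondition_iff_of_moves (fun hn h => hP ⟨hn, h⟩)
      (iterRel_swap (R' := fun C C' => ∃ k, Move P i C C' k) (Q := fun _ => True)
        (fun _ _ _ ⟨k, hm, _⟩ => ⟨⟨k, hm⟩, trivial⟩) trivial h).1).mpr hC.extra

theorem addSteps_iff_removeSteps (hi : i ≤ n) {m : ℕ} (hC : TightBound P i C)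
    (hC' : TightBound P i C') :
    iterRel (AddStep P i) m C C' ↔ iterRel (RemoveStep P i) m C' C :=
  ⟨fun h => (iterRel_swap (Q := TightBound P i)
      (fun _ _ hb h => ⟨h.removeStep hi hb, (h.addable_removable hi hb).2.2⟩) hC h).1,
    fun h => (iterRel_swap (Q := TightBound P i)
      (fun _ _ hb h => ⟨h.addStep hi hb, h.tightBound hi hb⟩) hC' h).1⟩

theorem addSteps_addable_removable (hi : i ≤ n) {m : ℕ} (hC : TightBound P i C)
    (h : iterRel (AddStep P i) m C C') :
    addable P i C = addable P i C' + m ∧ removable P i C' = removable P i C + m := by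
  suffices TightBound P i C' ∧
      addable P i C = addable P i C' + m ∧ removable P i C' = removable P i C + m from this.2
  induction m generalizing C' with
  | zero => cases h; exact ⟨hC, rfl, rfl⟩
  | succ m ih =>
    obtain ⟨D, h1, h2⟩ := h
    obtain ⟨a1, a2, a3⟩ := ih h1
    obtain ⟨b1, b2, b3⟩ := h2.addable_removable hi a1
    exact ⟨b3, by omega, by omega⟩

/-! #### Parity -/

/-- The `i`-storeys come in adjacent pairs with the lower one of the second kind, so the count is
odd exactly when the column ends between the two, that is, when the next storey is of the first
kind. -/
theorem even_countBlocks_iff (hi : i ≤ n) (hm : mode P i = .doubled) (c : Column) :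
    Even (countBlocks P i c) ↔ ¬ FirstAt P i c.full := by
  unfold countBlocks
  induction c.full with
  | zero => simp [not_firstAt_zero hi hm]
  | succ k ih =>
    have h1 : (storeySpot P (.colour i) k).isSome = true ↔ HasColour P i k := by
      rw [Option.isSome_iff_exists]; rfl
    have h2 := hasColour_iff (P := P) hi k
    have h3 := not_secondAt_and_firstAt (P := P) hi (by simp [hm]) k
    rw [Nat.count_succ, firstAt_succ_iff hi hm, Nat.even_add, ih]
    by_cases hS : SecondAt P i k <;> by_cases hF : FirstAt P i k <;> simp_all

theorem even_sum_countBlocks_iff (hi : i ≤ n) (hm : mode P i = .doubled) (hC : IsChain P C) :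
    Even (∑ j, countBlocks P i (C j)) ↔ Even (slotCount P i (NotSecondAt P i) C) := by
  classical
  rw [Finset.even_sum_iff_even_card_odd]
  unfold slotCount
  have : (Finset.univ.filter fun j => Odd (countBlocks P i (C j))) =
      Finset.univ.filter fun j => SlotAt P i (NotSecondAt P i) (C j) := by
    refine Finset.filter_congr fun j _ => ?_
    rw [← Nat.not_even_iff_odd, even_countBlocks_iff hi hm, not_not]
    constructor
    · intro hF
      refine ⟨⟨hF.hasColour, fun hS => not_secondAt_and_firstAt hi (by simp [hm]) _ ⟨hS, hF⟩⟩, ?_⟩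
      intro s hs
      simpa [hm] using mode_of_halves (hC.valid j (by simp [hs])) hF.hasColour
    · exact fun h => notSecondAt_firstAt hi h.1
  convert Iff.rfl using 3
  exact this.symm

/-- By parity, the number of layers ending inside a pair is even. So when fewer than `blocksMoved P
i` single moves are left, none is left, and being unable to complete a double move means a count of
zero. -/
theorem IsSlice.blocksMoved_dvd (hi : i ≤ n) (hC : IsSlice P C) :
    blocksMoved P i ∣ addable P i C ∧ blocksMoved P i ∣ removable P i C := by
  rcases blocksMoved_cases (P := P) (i := i) with h | ⟨h, hm⟩
  · simp [h]
  · have he : Even (∑ j, countBlocks P i (C j)) := by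
      have := hC.extra
      cases P with
      | A2odd hn z =>
        have : i = n := by
          by_contra hin
          simp [blocksMoved, hin] at h
        subst this
        exact hC.extra
      | C1 hn =>
        have : i = 0 := by
          by_contra hin
          simp [blocksMoved, hin] at h
        subst this
        exact hC.extra
      | _ => simp [blocksMoved] at h
    rw [even_sum_countBlocks_iff hi hm hC.isChain] at he
    have he' := he
    rw [slotCount_eq_blockCount_of_doubled hi hC.isChain hm] at he'
    rw [h]
    simp only [addable, removable, hm]
    exact ⟨dvd_add ⟨_, rfl⟩ he.two_dvd, dvd_add ⟨_, rfl⟩ he'.two_dvd⟩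

theorem blocksMoved_pos : 0 < blocksMoved P i := by
  rcases blocksMoved_cases (P := P) (i := i) with h | h <;> omega

variable {l : ℕ} {A B D : Slice P l}

theorem Slice.tightBound (A : Slice P l) : TightBound P i A.1 := A.2.tightBound

/-- `B` is obtained from `A` by the rule for `f_i`. -/
def Slice.Arrow (i : ℕ) (A B : Slice P l) : Prop :=
  iterRel (AddStep P i) (blocksMoved P i) A.1 B.1

theorem Slice.Arrow.addable_removable (hi : i ≤ n) (h : A.Arrow i B) :
    addable P i A.1 = addable P i B.1 + blocksMoved P i ∧
      removable P i B.1 = removable P i A.1 + blocksMoved P i :=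
  addSteps_addable_removable hi A.tightBound h

theorem Slice.Arrow.unique (hi : i ≤ n) (h : A.Arrow i B) (h' : A.Arrow i D) : B = D :=
  Subtype.ext (iterRel_unique (fun _ _ _ h h' => h.unique hi h') h h')

theorem Slice.Arrow.unique_left (hi : i ≤ n) (h : A.Arrow i D) (h' : B.Arrow i D) : A = B :=
  Subtype.ext (iterRel_unique (fun _ _ _ h h' => h.unique hi h')
    ((addSteps_iff_removeSteps hi A.tightBound D.tightBound).mp h)
    ((addSteps_iff_removeSteps hi B.tightBound D.tightBound).mp h'))

section Fin

variable {i : Fin (n + 1)}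

theorem Slice.f_cases (hA : A.NoEmptyLayer) :
    (∃ B, A.f i = some B ∧ A.Arrow i B) ∨ (A.f i = none ∧ addable P i A.1 = 0) := by
  have hi : (i : ℕ) ≤ n := by omega
  obtain ⟨h1, h2⟩ := fTuple_spec hi A.2.isChain hA
  cases h : fTuple P i A.1 with
  | none =>
    exact Or.inr ⟨by simp [Slice.f, h],
      Nat.eq_zero_of_dvd_of_lt (A.2.blocksMoved_dvd hi).1 (h2 h)⟩
  | some t =>
    have ht := A.2.of_addSteps hi (h1 t h)
    exact Or.inl ⟨⟨t, ht⟩, by simp [Slice.f, h, ht], h1 t h⟩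

theorem Slice.e_cases (hA : A.NoEmptyLayer) :
    (∃ B, A.e i = some B ∧ B.Arrow i A) ∨ (A.e i = none ∧ removable P i A.1 = 0) := by
  have hi : (i : ℕ) ≤ n := by omega
  obtain ⟨h1, h2⟩ := eTuple_spec hi A.2.isChain hA
  cases h : eTuple P i A.1 with
  | none =>
    exact Or.inr ⟨by simp [Slice.e, h],
      Nat.eq_zero_of_dvd_of_lt (A.2.blocksMoved_dvd hi).2 (h2 h)⟩
  | some t =>
    have ht := A.2.of_removeSteps hi (h1 t h)
    exact Or.inl ⟨⟨t, ht⟩, by simp [Slice.e, h, ht],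
      (addSteps_iff_removeSteps hi ht.tightBound A.tightBound).mpr (h1 t h)⟩

/-- Both operators are described by the one relation `Slice.Arrow`, read in opposite directions; the
axiom relating `e` and `f` comes from this. -/
theorem Slice.f_eq_some_iff (hA : A.NoEmptyLayer) : A.f i = some B ↔ A.Arrow i B := by
  have hi : (i : ℕ) ≤ n := by omega
  rcases Slice.f_cases (i := i) hA with ⟨D, h1, h2⟩ | ⟨h1, h2⟩
  · rw [h1, Option.some_inj]
    exact ⟨fun h => h ▸ h2, fun h => h2.unique hi h⟩
  · simp only [h1, reduceCtorEq, false_iff]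
    intro h
    have := (h.addable_removable hi).1
    have := blocksMoved_pos (P := P) (i := i)
    omega

theorem Slice.e_eq_some_iff (hA : A.NoEmptyLayer) : A.e i = some B ↔ B.Arrow i A := by
  have hi : (i : ℕ) ≤ n := by omega
  rcases Slice.e_cases (i := i) hA with ⟨D, h1, h2⟩ | ⟨h1, h2⟩
  · rw [h1, Option.some_inj]
    exact ⟨fun h => h ▸ h2, fun h => h2.unique_left hi h⟩
  · simp only [h1, reduceCtorEq, false_iff]
    intro h
    have := (h.addable_removable hi).2
    have := blocksMoved_pos (P := P) (i := i)
    omega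

/-! #### Compatibility with `δ` -/

theorem Slice.NoEmptyLayer.shiftStable {i : ℕ} (hA : A.NoEmptyLayer) : ShiftStable P i A.1 :=
  fun j h => absurd h (hA j)

theorem Slice.NoEmptyLayer.addDelta (hA : A.NoEmptyLayer) : A.addDelta.NoEmptyLayer := by
  intro j
  simp only [Slice.addDelta, shift]
  split_ifs
  · exact hA _
  · have := period_pos (P := P)
    simp only [Column.addDelta, Column.empty, ne_eq, Column.mk.injEq]
    omega

/-- Where `f` is defined, each step is shifted and uniqueness identifies the result; where it is
not, the count is zero, and it is also zero after the shift. -/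
theorem Slice.f_addDelta (hA : A.NoEmptyLayer) :
    A.addDelta.f i = (A.f i).map Slice.addDelta := by
  rcases Slice.f_cases (i := i) hA with ⟨D, h1, h2⟩ | ⟨h1, h2⟩
  · rw [h1, Option.map_some, Slice.f_eq_some_iff hA.addDelta]
    exact (iterRel_map (Q := ShiftStable P i) (fun _ _ hQ h => h.shift hQ) hA.shiftStable h2).1
  · rw [h1, Option.map_none]
    rcases Slice.f_cases (i := i) hA.addDelta with ⟨D, h3, h4⟩ | ⟨h3, h4⟩
    · have h5 := (h4.addable_removable (by omega)).1
      have h6 := (addable_shift (i := i) hA.shiftStable).1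
      have := blocksMoved_pos (P := P) (i := i)
      simp only [Slice.addDelta] at h5
      omega
    · exact h3

theorem Slice.e_addDelta (hA : A.NoEmptyLayer) :
    A.addDelta.e i = (A.e i).map Slice.addDelta := by
  have hi : (i : ℕ) ≤ n := by omega
  rcases Slice.e_cases (i := i) hA with ⟨D, h1, h2⟩ | ⟨h1, h2⟩
  · rw [h1, Option.map_some, Slice.e_eq_some_iff hA.addDelta]
    exact (addSteps_iff_removeSteps hi (Slice.tightBound D.addDelta)
      (Slice.tightBound A.addDelta)).mpr
      (iterRel_map (Q := ShiftStable P i) (fun _ _ hQ h => h.shift hi hQ) hA.shiftStable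
        ((addSteps_iff_removeSteps hi D.tightBound A.tightBound).mp h2)).1
  · rw [h1, Option.map_none]
    rcases Slice.e_cases (i := i) hA.addDelta with ⟨D, h3, h4⟩ | ⟨h3, h4⟩
    · have h5 := (h4.addable_removable (by omega)).2
      have h6 := (addable_shift (i := i) hA.shiftStable).2.1
      have := blocksMoved_pos (P := P) (i := i)
      simp only [Slice.addDelta] at h5
      omega
    · exact h3

end Fin

end Slices

end YoungSlice

namespace YoungSlice

/-! ### The operators on classes -/

section Iterates

variable {β : Type*} {g : β → Option β} {F : β → ℕ}

/-- `F` is a counter that drops by one with each application of `g` and vanishes where `g` stops. -/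
theorem iterOpt_eq_none_iff (h0 : ∀ x, g x = none → F x = 0)
    (h1 : ∀ x y, g x = some y → F x = F y + 1) (k : ℕ) (x : β) :
    (∀ y, iterOpt g k x = some y → F x = F y + k) ∧ (iterOpt g k x = none → F x < k) := by
  induction k with
  | zero =>
    refine ⟨fun y h => ?_, fun h => by cases h⟩
    cases h
    rfl
  | succ k ih =>
    simp only [iterOpt, Option.bind_eq_some_iff, Option.bind_eq_none_iff]
    constructor
    · rintro y ⟨z, hz, hy⟩
      have := ih.1 z hz
      have := h1 z y hy
      omega
    · intro h
      cases hz : iterOpt g k x with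
      | none => exact (ih.2 hz).trans (Nat.lt_succ_self k)
      | some z =>
        have := ih.1 z hz
        have := h0 z (h z hz)
        omega

theorem isGreatest_iterOpt (h0 : ∀ x, g x = none → F x = 0)
    (h1 : ∀ x y, g x = some y → F x = F y + 1) (x : β) :
    IsGreatest {k | iterOpt g k x ≠ none} (F x) := by
  constructor
  · exact fun h => lt_irrefl _ ((iterOpt_eq_none_iff h0 h1 _ _).2 h)
  · intro k hk
    obtain ⟨y, hy⟩ := Option.ne_none_iff_exists'.mp hk
    have := (iterOpt_eq_none_iff h0 h1 k x).1 y hy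
    omega

end Iterates

section Classes

variable {n : ℕ} {P : Pattern n} {l : ℕ} {i : Fin (n + 1)} {A B D : Slice P l}
  {x y : SliceClass P l}

theorem Slice.toClass_eq_iff :
    A.toClass = B.toClass ↔ ∃ k, B = Slice.addDelta^[k] A ∨ A = Slice.addDelta^[k] B :=
  Quotient.eq

theorem Slice.toClass_iterate (k : ℕ) (A : Slice P l) :
    (Slice.addDelta^[k] A).toClass = A.toClass :=
  Slice.toClass_eq_iff.mpr ⟨k, Or.inr rfl⟩

theorem Slice.NoEmptyLayer.iterate (hA : A.NoEmptyLayer) (k : ℕ) :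
    (Slice.addDelta^[k] A).NoEmptyLayer := by
  induction k with
  | zero => exact hA
  | succ k ih => rw [Function.iterate_succ_apply']; exact ih.addDelta

theorem Slice.operators_iterate (hA : A.NoEmptyLayer) (k : ℕ) :
    (Slice.addDelta^[k] A).f i = (A.f i).map Slice.addDelta^[k] ∧
    (Slice.addDelta^[k] A).e i = (A.e i).map Slice.addDelta^[k] ∧
    addable P i (Slice.addDelta^[k] A).1 = addable P i A.1 ∧
    removable P i (Slice.addDelta^[k] A).1 = removable P i A.1 := by
  induction k with
  | zero => simp
  | succ k ih =>
    obtain ⟨h1, h2, h3, h4⟩ := ih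
    have h5 := addable_shift (i := i) (hA.iterate k).shiftStable
    rw [Function.iterate_succ_apply', Slice.f_addDelta (hA.iterate k),
      Slice.e_addDelta (hA.iterate k), h1, h2, Option.map_map, Option.map_map,
      ← Function.iterate_succ']
    exact ⟨rfl, rfl, h5.1.trans h3, h5.2.1.trans h4⟩

/-- The rules do not depend on the representative of a class. -/
theorem Slice.operators_congr (hA : A.NoEmptyLayer) (hB : B.NoEmptyLayer)
    (h : A.toClass = B.toClass) :
    (A.f i).map Slice.toClass = (B.f i).map Slice.toClass ∧
    (A.e i).map Slice.toClass = (B.e i).map Slice.toClass ∧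
    addable P i A.1 = addable P i B.1 ∧ removable P i A.1 = removable P i B.1 := by
  have key : ∀ (D : Slice P l) (k : ℕ), D.NoEmptyLayer →
      ((Slice.addDelta^[k] D).f i).map Slice.toClass = (D.f i).map Slice.toClass ∧
      ((Slice.addDelta^[k] D).e i).map Slice.toClass = (D.e i).map Slice.toClass ∧
      addable P i (Slice.addDelta^[k] D).1 = addable P i D.1 ∧
      removable P i (Slice.addDelta^[k] D).1 = removable P i D.1 := by
    intro D k hD
    obtain ⟨h1, h2, h3, h4⟩ := Slice.operators_iterate (i := i) hD k
    have h5 : Slice.toClass ∘ Slice.addDelta^[k] = (Slice.toClass : Slice P l → _) :=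
      funext fun D => Slice.toClass_iterate k D
    rw [h1, h2, Option.map_map, Option.map_map, h5]
    exact ⟨rfl, rfl, h3, h4⟩
  obtain ⟨k, rfl | rfl⟩ := Slice.toClass_eq_iff.mp h
  · obtain ⟨h1, h2, h3, h4⟩ := key A k hA
    exact ⟨h1.symm, h2.symm, h3.symm, h4.symm⟩
  · exact key B k hB

theorem shift_iterate_apply {L : ℕ} (C : Fin L → Column) {m : ℕ} (hm : m ≤ L) (j : Fin L) :
    (shift P)^[m] C j = if h : j.val + m < L then C ⟨j.val + m, h⟩
      else (C ⟨j.val + m - L, by omega⟩).addDelta P := by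
  induction m generalizing j with
  | zero => simp
  | succ m ih =>
    rw [Function.iterate_succ_apply']
    by_cases h : j.val + 1 < L
    · rw [shift_apply_of_succ (j := ⟨j.val + 1, h⟩) rfl, ih (by omega)]
      simp only [Nat.add_assoc, Nat.add_comm 1 m]
    · rw [shift_apply_last (j := ⟨0, by omega⟩) rfl (by omega), ih (by omega), dif_pos (by simp; omega),
        dif_neg (by omega)]
      congr 2
      exact Fin.ext (by simp; omega)

theorem Slice.iterate_addDelta_apply (A : Slice P l) (m : ℕ) :
    (Slice.addDelta^[m] A).1 = (shift P)^[m] A.1 := by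
  induction m with
  | zero => rfl
  | succ m ih => rw [Function.iterate_succ_apply', Function.iterate_succ_apply', ← ih]; rfl

theorem Slice.full_iterate_layers (A : Slice P l) (j : Fin (P.layers l)) :
    ((Slice.addDelta^[P.layers l] A).1 j).full = (A.1 j).full + P.period := by
  rw [Slice.iterate_addDelta_apply, shift_iterate_apply _ le_rfl, dif_neg (by omega)]
  simp [Column.addDelta]

theorem SliceClass.toClass_rep (x : SliceClass P l) : x.rep.toClass = x := by
  rw [SliceClass.rep, Slice.toClass_iterate]
  exact Quotient.out_eq x

theorem Slice.noEmptyLayer_of_full (h : ∀ j, 1 ≤ (A.1 j).full) : A.NoEmptyLayer := by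
  intro j hj
  have := h j
  rw [hj] at this
  exact absurd this (by simp [Column.empty])

theorem SliceClass.noEmptyLayer_rep (x : SliceClass P l) : x.rep.NoEmptyLayer := by
  refine Slice.noEmptyLayer_of_full fun j => ?_
  rw [SliceClass.rep, Slice.full_iterate_layers]
  have := period_pos (P := P)
  omega

/-- The margin `3` allows for the removal of up to two blocks: every layer still has a complete
storey afterwards, so the other operator follows its rule there. -/
theorem SliceClass.exists_high (x : SliceClass P l) :
    ∃ A : Slice P l, A.toClass = x ∧ ∀ j, 3 ≤ (A.1 j).full := by
  refine ⟨Slice.addDelta^[P.layers l] x.rep, ?_, fun j => ?_⟩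
  · rw [Slice.toClass_iterate, x.toClass_rep]
  · rw [Slice.full_iterate_layers, SliceClass.rep, Slice.full_iterate_layers]
    have := period_ge_two (P := P)
    omega

theorem SliceClass.operators_toClass (hA : A.NoEmptyLayer) :
    SliceClass.e i A.toClass = (A.e i).map Slice.toClass ∧
    SliceClass.f i A.toClass = (A.f i).map Slice.toClass := by
  have h := Slice.operators_congr (i := i) (A.toClass.noEmptyLayer_rep) hA (A.toClass.toClass_rep)
  exact ⟨h.2.1, h.1⟩

theorem Move.full_bounds {i L k : ℕ} {C C' : Fin L → Column} (hm : Move P i C C' k) (j : Fin L) :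
    (C j).full ≤ (C' j).full ∧ (C' j).full ≤ (C j).full + 1 := by
  obtain ⟨hC, -, r, -, -, rfl⟩ := hm
  rcases eq_or_ne j r with rfl | hj
  · rw [Function.update_self]
    rcases addBlock_cases (i := i) (hC.valid j) with ⟨-, -, h⟩ | ⟨-, -, h⟩ | ⟨-, -, h⟩ <;>
      rw [h] <;> simp
  · rw [Function.update_of_ne hj]
    omega

theorem iterRel_full_bounds {i L m : ℕ} {C C' : Fin L → Column}
    (h : iterRel (AddStep P i) m C C') (j : Fin L) :
    (C j).full ≤ (C' j).full ∧ (C' j).full ≤ (C j).full + m := by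
  induction m generalizing C' with
  | zero => cases h; simp
  | succ m ih =>
    obtain ⟨E, h1, k, h2, -⟩ := h
    have := ih h1
    have := h2.full_bounds j
    omega

theorem Slice.Arrow.full_bounds {i : ℕ} (h : A.Arrow i B) (j : Fin (P.layers l)) :
    (A.1 j).full ≤ (B.1 j).full ∧ (B.1 j).full ≤ (A.1 j).full + 2 := by
  have h1 := iterRel_full_bounds h j
  have h2 := blocksMoved_cases (P := P) (i := i)
  omega

/-- The operators on classes, in terms of sufficiently high representatives. -/
theorem SliceClass.f_eq_some_iff : SliceClass.f i x = some y ↔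
    ∃ A B : Slice P l, A.toClass = x ∧ B.toClass = y ∧ A.Arrow i B ∧ ∀ j, 1 ≤ (A.1 j).full := by
  constructor
  · intro h
    obtain ⟨A, rfl, hA⟩ := x.exists_high
    have hA1 : ∀ j, 1 ≤ (A.1 j).full := fun j => by have := hA j; omega
    have hne := Slice.noEmptyLayer_of_full hA1
    rw [(SliceClass.operators_toClass hne).2, Option.map_eq_some_iff] at h
    obtain ⟨B, h1, h2⟩ := h
    exact ⟨A, B, rfl, h2, (Slice.f_eq_some_iff hne).mp h1, hA1⟩
  · rintro ⟨A, B, rfl, rfl, h, hA⟩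
    have hne := Slice.noEmptyLayer_of_full hA
    rw [(SliceClass.operators_toClass hne).2, (Slice.f_eq_some_iff hne).mpr h, Option.map_some]

theorem SliceClass.f_iff_e : SliceClass.f i x = some y ↔ SliceClass.e i y = some x := by
  rw [SliceClass.f_eq_some_iff]
  constructor
  · rintro ⟨A, B, rfl, rfl, h, hA⟩
    have hne : B.NoEmptyLayer := Slice.noEmptyLayer_of_full fun j => by
      have := hA j
      have := h.full_bounds j
      omega
    rw [(SliceClass.operators_toClass hne).1, (Slice.e_eq_some_iff hne).mpr h, Option.map_some]
  · intro h
    obtain ⟨B, rfl, hB⟩ := y.exists_high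
    have hne : B.NoEmptyLayer := Slice.noEmptyLayer_of_full fun j => by have := hB j; omega
    rw [(SliceClass.operators_toClass hne).1, Option.map_eq_some_iff] at h
    obtain ⟨A, h1, h2⟩ := h
    have h3 := (Slice.e_eq_some_iff hne).mp h1
    refine ⟨A, B, h2, rfl, h3, fun j => ?_⟩
    have := hB j
    have := h3.full_bounds j
    omega

/-- The number of times that `f_i` can be applied to the class `x`. -/
noncomputable def SliceClass.up (i : Fin (n + 1)) (x : SliceClass P l) : ℕ :=
  addable P i x.rep.1 / blocksMoved P i

/-- The number of times that `e_i` can be applied to the class `x`. -/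
noncomputable def SliceClass.down (i : Fin (n + 1)) (x : SliceClass P l) : ℕ :=
  removable P i x.rep.1 / blocksMoved P i

theorem SliceClass.up_toClass (hA : A.NoEmptyLayer) :
    blocksMoved P i * SliceClass.up i A.toClass = addable P i A.1 := by
  rw [SliceClass.up, (Slice.operators_congr A.toClass.noEmptyLayer_rep hA A.toClass.toClass_rep).2.2.1]
  exact Nat.mul_div_cancel' (A.2.blocksMoved_dvd (by omega)).1

theorem SliceClass.down_toClass (hA : A.NoEmptyLayer) :
    blocksMoved P i * SliceClass.down i A.toClass = removable P i A.1 := by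
  rw [SliceClass.down,
    (Slice.operators_congr A.toClass.noEmptyLayer_rep hA A.toClass.toClass_rep).2.2.2]
  exact Nat.mul_div_cancel' (A.2.blocksMoved_dvd (by omega)).2

theorem SliceClass.up_down_of_f (h : SliceClass.f i x = some y) :
    SliceClass.up i x = SliceClass.up i y + 1 ∧ SliceClass.down i y = SliceClass.down i x + 1 := by
  obtain ⟨A, B, rfl, rfl, h, hA⟩ := SliceClass.f_eq_some_iff.mp h
  have hB : ∀ j, 1 ≤ (B.1 j).full := fun j => by
    have := hA j
    have := h.full_bounds j
    omega
  obtain ⟨h1, h2⟩ := h.addable_removable (by omega)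
  have hA := Slice.noEmptyLayer_of_full hA
  have hB := Slice.noEmptyLayer_of_full hB
  rw [← SliceClass.up_toClass hA, ← SliceClass.up_toClass hB] at h1
  rw [← SliceClass.down_toClass hA, ← SliceClass.down_toClass hB] at h2
  have hm := blocksMoved_pos (P := P) (i := i)
  constructor
  · exact Nat.eq_of_mul_eq_mul_left hm (by rw [h1]; ring)
  · exact Nat.eq_of_mul_eq_mul_left hm (by rw [h2]; ring)

theorem SliceClass.isGreatest_up (i : Fin (n + 1)) (x : SliceClass P l) :
    IsGreatest {k | iterOpt (SliceClass.f i) k x ≠ none} (SliceClass.up i x) := by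
  refine isGreatest_iterOpt (fun x h => ?_) (fun x y h => (SliceClass.up_down_of_f h).1) x
  rcases Slice.f_cases (i := i) x.noEmptyLayer_rep with ⟨B, h1, -⟩ | ⟨-, h1⟩
  · simp [SliceClass.f, h1] at h
  · simp [SliceClass.up, h1]

theorem SliceClass.isGreatest_down (i : Fin (n + 1)) (x : SliceClass P l) :
    IsGreatest {k | iterOpt (SliceClass.e i) k x ≠ none} (SliceClass.down i x) := by
  refine isGreatest_iterOpt (fun x h => ?_)
    (fun x y h => (SliceClass.up_down_of_f (SliceClass.f_iff_e.mpr h)).2) x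
  rcases Slice.e_cases (i := i) x.noEmptyLayer_rep with ⟨B, h1, -⟩ | ⟨-, h1⟩
  · simp [SliceClass.e, h1] at h
  · simp [SliceClass.down, h1]

theorem SliceClass.phi_eq_up (i : Fin (n + 1)) (x : SliceClass P l) :
    SliceClass.phi i x = SliceClass.up i x := (SliceClass.isGreatest_up i x).csSup_eq

theorem SliceClass.eps_eq_down (i : Fin (n + 1)) (x : SliceClass P l) :
    SliceClass.eps i x = SliceClass.down i x := (SliceClass.isGreatest_down i x).csSup_eq

end Classes

end YoungSlice

namespace YoungSlice

/-! ### Weights -/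

section Weights

variable {n : ℕ} {P : Pattern n} {i j k L : ℕ} {C C' : Fin L → Column}

open Classical in
/-- `1` if the storey `k` has `j`-blocks, and `0` otherwise. -/
noncomputable def colourAt (P : Pattern n) (j k : ℕ) : ℤ := if HasColour P j k then 1 else 0

open Classical in
/-- The number of `j`-slots minus the number of `j`-blocks on top of a column. -/
noncomputable def columnNet (P : Pattern n) (j : ℕ) (c : Column) : ℤ :=
  (if SlotAt P j (HasColour P j) c then 1 else 0) - if BlockAt P j (HasColour P j) c then 1 else 0

/-- The number of `j`-slots minus the number of `j`-blocks on top of a tuple of columns. -/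
noncomputable def net (P : Pattern n) (j : ℕ) (C : Fin L → Column) : ℤ :=
  (slotCount P j (HasColour P j) C : ℤ) - blockCount P j (HasColour P j) C

/-- The factor by which the number of `j`-slots contributes to weights. -/
def netFactor (P : Pattern n) (j : ℕ) : ℤ :=
  match mode P j with
  | .single => 1
  | .generic => 1
  | .doubled => 2
  | .tight => 2

theorem columnNet_of_half_eq_none (m : ℕ) :
    columnNet P j ⟨m + 1, none⟩ = colourAt P j (m + 1) - colourAt P j m := by
  classical
  have h1 : SlotAt P j (HasColour P j) ⟨m + 1, none⟩ ↔ HasColour P j (m + 1) := by simp [SlotAt]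
  have h2 : BlockAt P j (HasColour P j) ⟨m + 1, none⟩ ↔ HasColour P j m := by
    simp [BlockAt, TopAt]
  simp only [columnNet, colourAt, h1, h2]

theorem columnNet_of_half_eq_some (m : ℕ) (s : Bool) (h : P.storey m = .halves) :
    columnNet P j ⟨m, some s⟩ =
      (if j ≤ 1 ∧ P.halfColour s ≠ j then 1 else 0) - if P.halfColour s = j then 1 else 0 := by
  have h1 : HasColour P j m ↔ j ≤ 1 := by simp [HasColour, storeySpot_halves h]
  have h3 := halfColour_le_one (P := P) s
  have h2 : SlotAt P j (HasColour P j) ⟨m, some s⟩ ↔ j ≤ 1 ∧ P.halfColour s ≠ j := by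
    simp [SlotAt, h1]
  have h4 : BlockAt P j (HasColour P j) ⟨m, some s⟩ ↔ P.halfColour s = j := by
    simp only [BlockAt, TopAt, reduceCtorEq, false_and, false_or, Option.some_inj]
    constructor
    · rintro ⟨-, -, -, _, rfl, h⟩
      exact h
    · intro h
      exact ⟨m, (h1.mpr (by omega)), rfl, s, rfl, h⟩
  simp only [columnNet, h2, h4]

theorem slotCount_add : slotCount P i (SecondAt P i) C +
    slotCount P i (NotSecondAt P i) C = slotCount P i (HasColour P i) C := by
  classical
  unfold slotCount
  rw [← Finset.card_union_of_disjoint]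
  · congr 1
    ext j
    simp only [Finset.mem_union, Finset.mem_filter, Finset.mem_univ, true_and]
    simp only [SlotAt, NotSecondAt]
    have := fun h : SecondAt P i (C j).full => h.hasColour
    tauto
  · rw [Finset.disjoint_filter]
    exact fun j _ h h' => h'.1.2 h.1

theorem blockCount_add : blockCount P i (FirstAt P i) C +
    blockCount P i (NotFirstAt P i) C = blockCount P i (HasColour P i) C := by
  classical
  unfold blockCount
  rw [← Finset.card_union_of_disjoint]
  · congr 1
    ext j
    simp only [Finset.mem_union, Finset.mem_filter, Finset.mem_univ, true_and]
    constructor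
    · rintro (⟨h, h1, h2⟩ | ⟨h, h1, h2⟩)
      · exact ⟨h, h1.hasColour, h2⟩
      · exact ⟨h, h1.1, h2⟩
    · rintro ⟨h, h1, h2⟩
      by_cases hF : FirstAt P i h
      · exact Or.inl ⟨h, hF, h2⟩
      · exact Or.inr ⟨h, ⟨h1, hF⟩, h2⟩
  · rw [Finset.disjoint_filter]
    rintro j - ⟨h, h1, h2⟩ ⟨h', h1', h2'⟩
    cases h2.unique h2'
    exact h1'.2 h1

/-- The truncated differences cancel: `(a - b) - (b - a)` is the integer `a - b`. In the doubled and
tight cases the terms of weight one in the two counts are equal and drop out, which leaves the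
factor `2`. -/
theorem addable_sub_removable (hi : i ≤ n) (hC : IsChain P C) :
    (addable P i C : ℤ) - removable P i C = netFactor P i * net P i C := by
  have h1 := slotCount_add (P := P) (C := C) (i := i)
  have h2 := blockCount_add (P := P) (C := C) (i := i)
  have h3 := slotCount_eq_blockCount_of_tight hi hC
  have h4 := slotCount_eq_blockCount_of_doubled hi hC
  have h5 : mode P i = .single → slotCount P i (NotSecondAt P i) C = 0 := fun h =>
    slotCount_eq_zero fun k hk => hk.2 ((secondAt_iff_firstAt hi h k).mpr (notSecondAt_firstAt hi hk))
  have h6 : mode P i = .single → blockCount P i (NotFirstAt P i) C = 0 := fun h =>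
    blockCount_eq_zero fun k hk => hk.2 ((secondAt_iff_firstAt hi h k).mp (notFirstAt_secondAt hi hk))
  unfold addable removable netFactor net
  cases h : mode P i <;>
    simp only [h, reduceCtorEq, false_imp_iff, forall_const] at h3 h4 h5 h6 ⊢ <;> omega

theorem Move.exists_net (hm : Move P i C C' k) :
    ∃ c : Column, c.Valid P ∧ SlotAt P i (HasColour P i) c ∧ (∃ r, C r = c) ∧
      ∀ j, net P j C' - net P j C = columnNet P j (addBlock P i c) - columnNet P j c := by
  classical
  obtain ⟨hC, hC', r, hs, rfl, rfl⟩ := hm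
  refine ⟨C r, hC.valid r, hs, ⟨r, rfl⟩, fun j => ?_⟩
  have h1 := card_filter_update (SlotAt P j (HasColour P j)) C r (addBlock P i (C r))
  have h2 := card_filter_update (BlockAt P j (HasColour P j)) C r (addBlock P i (C r))
  unfold net columnNet slotCount blockCount
  zify at h1 h2
  linarith

/-- The colours of the neighbours of a `b`-block in the cycles of the types `C_n^(1)`, `A_{2n}^(2)`
and `D_{n+1}^(2)`. -/
theorem neighbours_cycleC {N a b r r₁ r₂ : ℕ} (hN : N = 2 * n + 1 ∨ N = 2 * n + 2) (hn : 1 ≤ n)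
    (ha : a ≤ n) (hb : b ≤ n) (hr : r < N) (e₁ : r₁ = if r + 1 = N then 0 else r + 1)
    (e₂ : r₂ = if r₁ + 1 = N then 0 else r₁ + 1)
    (h : r₁ = (if b = 0 then 0 else N - b) ∨ r₁ = b + 1) :
    ((r₁ = (if a = 0 then 0 else N - a) ∨ r₁ = a + 1) ↔ a = b) ∧
    ((((r = (if a = 0 then 0 else N - a) ∨ r = a + 1) ↔ a = b - 1) ∧
      ((r₂ = (if a = 0 then 0 else N - a) ∨ r₂ = a + 1) ↔ a = if b = n then N - 2 - n else b + 1)) ∨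
    (((r₂ = (if a = 0 then 0 else N - a) ∨ r₂ = a + 1) ↔ a = b - 1) ∧
      ((r = (if a = 0 then 0 else N - a) ∨ r = a + 1) ↔ a = if b = n then N - 2 - n else b + 1))) := by
  -- Natural subtraction encodes the turning points: `b - 1 = 0` for `b = 0`, since the two
  -- `0`-storeys are adjacent; and `N - 2 - n` is `n - 1` for `N = 2 * n + 1` but `n` for `N = 2 * n
  -- + 2`, where the storey `n` is doubled.
  have key : ∀ x, ((x = (if a = 0 then 0 else N - a) ∨ x = a + 1) ↔
      (a = 0 ∧ x = 0) ∨ (1 ≤ a ∧ x + a = N) ∨ x = a + 1) := by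
    intro x
    split_ifs <;> omega
  have h₁ : r₁ = 0 ∧ r + 1 = N ∨ r₁ = r + 1 ∧ r + 1 < N := by split_ifs at e₁ <;> omega
  have h₂ : r₂ = 0 ∧ r₁ + 1 = N ∨ r₂ = r₁ + 1 ∧ r₁ + 1 < N := by split_ifs at e₂ <;> omega
  have h₃ : (b = 0 ∧ r₁ = 0) ∨ (1 ≤ b ∧ r₁ + b = N) ∨ r₁ = b + 1 := by split_ifs at h <;> omega
  clear e₁ e₂ h
  rw [key r, key r₁, key r₂]
  by_cases hbn : b = n
  · simp only [if_pos hbn]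
    rcases h₃ with h | h | h
    · omega
    · exact ⟨by omega, Or.inr ⟨by omega, by omega⟩⟩
    · exact ⟨by omega, Or.inl ⟨by omega, by omega⟩⟩
  · simp only [if_neg hbn]
    rcases h₃ with h | h | h
    · exact ⟨by omega, Or.inr ⟨by omega, by omega⟩⟩
    · exact ⟨by omega, Or.inr ⟨by omega, by omega⟩⟩
    · exact ⟨by omega, Or.inl ⟨by omega, by omega⟩⟩

/-- The colours of the neighbours of a `b`-block in the cycle of the types `B_n^(1)` and
`A_{2n-1}^(2)`. -/
theorem neighbours_cycleB {a b r r₁ r₂ : ℕ} (hn : 3 ≤ n) (h0 : r₁ ≠ 0)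
    (ha : a ≤ n) (hb : b ≤ n) (hr : r < 2 * n - 1)
    (e₁ : r₁ = if r + 1 = 2 * n - 1 then 0 else r + 1)
    (e₂ : r₂ = if r₁ + 1 = 2 * n - 1 then 0 else r₁ + 1)
    (h : r₁ = (if b ≤ 1 then 0 else b - 1) ∨ r₁ = if b ≤ 1 then 0 else 2 * n - b) :
    ((r₁ = (if a ≤ 1 then 0 else a - 1) ∨ r₁ = if a ≤ 1 then 0 else 2 * n - a) ↔ a = b) ∧ 2 ≤ b ∧
    ((((r = (if a ≤ 1 then 0 else a - 1) ∨ r = if a ≤ 1 then 0 else 2 * n - a) ↔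
        a + 1 = b ∨ (a = 0 ∧ b = 2)) ∧
      ((r₂ = (if a ≤ 1 then 0 else a - 1) ∨ r₂ = if a ≤ 1 then 0 else 2 * n - a) ↔
        a = if b = n then n else b + 1)) ∨
    (((r₂ = (if a ≤ 1 then 0 else a - 1) ∨ r₂ = if a ≤ 1 then 0 else 2 * n - a) ↔
        a + 1 = b ∨ (a = 0 ∧ b = 2)) ∧
      ((r = (if a ≤ 1 then 0 else a - 1) ∨ r = if a ≤ 1 then 0 else 2 * n - a) ↔
        a = if b = n then n else b + 1))) := by
  have key : ∀ x, ((x = (if a ≤ 1 then 0 else a - 1) ∨ x = if a ≤ 1 then 0 else 2 * n - a) ↔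
      (a ≤ 1 ∧ x = 0) ∨ (2 ≤ a ∧ (x + 1 = a ∨ x + a = 2 * n))) := by
    intro x
    split_ifs <;> omega
  have h₁ : r₁ = r + 1 ∧ r + 1 < 2 * n - 1 := by split_ifs at e₁ <;> omega
  have h₂ : r₂ = 0 ∧ r₁ + 1 = 2 * n - 1 ∨ r₂ = r₁ + 1 ∧ r₁ + 1 < 2 * n - 1 := by
    split_ifs at e₂ <;> omega
  have hb2 : 2 ≤ b := by
    by_contra hb2
    rw [if_pos (by omega), if_pos (by omega)] at h
    omega
  rw [if_neg (by omega), if_neg (by omega)] at h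
  clear e₁ e₂
  rw [key r, key r₁, key r₂]
  by_cases hbn : b = n
  · simp only [if_pos hbn]
    rcases h with h | h
    · exact ⟨by omega, hb2, Or.inl ⟨by omega, by omega⟩⟩
    · exact ⟨by omega, hb2, Or.inr ⟨by omega, by omega⟩⟩
  · simp only [if_neg hbn]
    rcases h with h | h
    · exact ⟨by omega, hb2, Or.inl ⟨by omega, by omega⟩⟩
    · exact ⟨by omega, hb2, Or.inr ⟨by omega, by omega⟩⟩

-- The cycle passes a colour upwards or downwards, so the two neighbours may occur in either order;
-- the second difference does not see the order.
open Classical in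
theorem colourAt_sum {a k₀ k₁ k₂ : ℕ} {p q s : Prop} (h₁ : HasColour P a k₁ ↔ s)
    (h : ((HasColour P a k₀ ↔ p) ∧ (HasColour P a k₂ ↔ q)) ∨
      ((HasColour P a k₂ ↔ p) ∧ (HasColour P a k₀ ↔ q))) :
    colourAt P a k₂ - 2 * colourAt P a k₁ + colourAt P a k₀ =
      (if p then 1 else 0) + (if q then 1 else 0) - 2 * if s then 1 else 0 := by
  unfold colourAt
  rcases h with ⟨h, h'⟩ | ⟨h, h'⟩ <;> simp only [h, h', h₁] <;> ring

/-- Predecessor and successor contribute `1` each; for `n = 1` they coincide, which accounts for the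
entry `-2`. -/
theorem cartan_A1 {hn : 1 ≤ n} {s : Fin (n + 1)} (a b : Fin (n + 1)) (m : ℕ)
    (hI : HasColour (.A1 hn s) b (m + 1)) :
    colourAt (.A1 hn s) a (m + 2) - 2 * colourAt (.A1 hn s) a (m + 1) + colourAt (.A1 hn s) a m =
      -(Pattern.A1 hn s).cartan a b := by
  have e : ∀ (i : Fin (n + 1)) k, HasColour (.A1 hn s) i k ↔ (s.val + k) % (n + 1) = i := by
    intro i k
    rw [(colour_iff_mod (by omega) k).2.2]
    simp only [Pattern.period, secondRes, firstRes, or_self]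
    exact (add_mod_eq_iff s.isLt i.isLt).symm
  have e1 := add_one_mod_eq (Nat.succ_pos n) (s.val + m)
  have e2 := add_one_mod_eq (Nat.succ_pos n) (s.val + (m + 1))
  have e3 := Nat.mod_lt (s.val + m) (Nat.succ_pos n)
  have e4 := add_one_mod_eq (Nat.succ_pos n) a
  have e5 := add_one_mod_eq (Nat.succ_pos n) b
  rw [e] at hI
  simp only [Nat.add_assoc, Nat.reduceAdd, Nat.succ_eq_add_one, Nat.mod_eq_of_lt a.isLt,
    Nat.mod_eq_of_lt b.isLt] at e1 e2 e3 e4 e5 hI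
  classical
  rw [colourAt_sum (s := a = b) (p := ((a : ℕ) + 1) % (n + 1) = b)
    (q := ((b : ℕ) + 1) % (n + 1) = a)]
  · simp only [Pattern.cartan, Fin.ext_iff]
    rw [e4, e5]
    obtain ⟨a, ha⟩ := a
    obtain ⟨b, hb⟩ := b
    simp only
    split_ifs <;> omega
  · rw [e, hI, Fin.ext_iff, eq_comm]
  · left
    rw [e, e, e4, e5]
    constructor
    · split_ifs at * <;> omega
    · split_ifs at * <;> omega

theorem colourAt_cycleC (a b : Fin (n + 1)) (m : ℕ) (hn : 1 ≤ n)
    (hP : P.period = 2 * n + 1 ∨ P.period = 2 * n + 2)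
    (hres : ∀ i, secondRes P i = (if i = 0 then 0 else P.period - i) ∧ firstRes P i = i + 1)
    (hI : HasColour P b (m + 1)) :
    colourAt P a (m + 2) - 2 * colourAt P a (m + 1) + colourAt P a m =
      (if a.val = b.val - 1 then 1 else 0) +
        (if a.val = (if b.val = n then P.period - 2 - n else b.val + 1) then 1 else 0) -
        2 * if a = b then 1 else 0 := by
  have e : ∀ (i : Fin (n + 1)) k, HasColour P i k ↔
      k % P.period = (if i.val = 0 then 0 else P.period - i.val) ∨ k % P.period = i.val + 1 := by
    intro i k
    rw [(colour_iff_mod (by omega) k).2.2, (hres i).1, (hres i).2]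
  have h := neighbours_cycleC (a := a) hP hn (by omega) (by omega)
    (Nat.mod_lt m period_pos) (add_one_mod_eq period_pos m) (add_one_mod_eq period_pos (m + 1))
    ((e b (m + 1)).mp hI)
  simp only [← e, ← Fin.ext_iff] at h
  rw [colourAt_sum h.1 h.2]
  congr 2 <;> congr

theorem colourAt_cycleB (a b : Fin (n + 1)) (m : ℕ) (hn : 3 ≤ n) (hP : P.period = 2 * n - 1)
    (hres : ∀ i, secondRes P i = (if i ≤ 1 then 0 else i - 1) ∧
      firstRes P i = if i ≤ 1 then 0 else 2 * n - i)
    (hI : HasColour P b (m + 1)) (hm : (m + 1) % P.period ≠ 0) : 2 ≤ b.val ∧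
    colourAt P a (m + 2) - 2 * colourAt P a (m + 1) + colourAt P a m =
      (if a.val + 1 = b ∨ (a.val = 0 ∧ b.val = 2) then 1 else 0) +
        (if a.val = (if b.val = n then n else b.val + 1) then 1 else 0) -
        2 * if a = b then 1 else 0 := by
  have e : ∀ (i : Fin (n + 1)) k, HasColour P i k ↔
      k % P.period = (if i.val ≤ 1 then 0 else i.val - 1) ∨
      k % P.period = if i.val ≤ 1 then 0 else 2 * n - i.val := by
    intro i k
    rw [(colour_iff_mod (by omega) k).2.2, (hres i).1, (hres i).2]
  have h := neighbours_cycleB (a := a) (r := m % P.period) (r₂ := (m + 2) % P.period) hn hm (by omega) (by omega)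
    (by rw [← hP]; exact Nat.mod_lt m period_pos) (by rw [← hP]; exact add_one_mod_eq period_pos m)
    (by rw [← hP]; exact add_one_mod_eq period_pos (m + 1)) ((e b (m + 1)).mp hI)
  simp only [← e, ← Fin.ext_iff] at h
  refine ⟨h.2.1, ?_⟩
  rw [colourAt_sum h.1 h.2.2]
  congr 2 <;> congr

set_option maxHeartbeats 1000000 in
/-- The effect of a block of unit depth on the weight. -/
theorem cartan_of_unit (a b : Fin (n + 1)) (m : ℕ) (hm : P.storey (m + 1) ≠ .halves)
    (hI : HasColour P b (m + 1)) :
    netFactor P a * blocksMoved P b *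
      (colourAt P a (m + 2) - 2 * colourAt P a (m + 1) + colourAt P a m) =
      -(blocksMoved P a * P.cartan a b) := by
  have hB : ∀ r, Pattern.cycleB n r ≠ .halves → r ≠ 0 := by
    rintro _ h rfl
    exact h rfl
  cases P with
  | A1 hn s => simpa [netFactor, mode, blocksMoved] using cartan_A1 a b m hI
  | B1 hn z =>
    obtain ⟨hb, h⟩ := colourAt_cycleB a b m hn rfl (fun i => ⟨rfl, rfl⟩) hI (hB _ hm)
    rw [h]
    obtain ⟨a, ha⟩ := a
    obtain ⟨b, hb'⟩ := b
    have e : netFactor (.B1 hn z) a = if a = n then 2 else 1 := by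
      simp only [netFactor, mode]
      split_ifs <;> first | rfl | omega
    simp only [e, blocksMoved, Pattern.cartan, Fin.mk.injEq] at hb ⊢
    by_cases h1 : b = n
    · simp only [if_pos h1]
      split_ifs <;> simp <;> omega
    · simp only [if_neg h1]
      split_ifs <;> simp <;> omega
  | A2odd hn z =>
    obtain ⟨hb, h⟩ := colourAt_cycleB a b m hn rfl (fun i => ⟨rfl, rfl⟩) hI (hB _ hm)
    rw [h]
    obtain ⟨a, ha⟩ := a
    obtain ⟨b, hb'⟩ := b
    have e : netFactor (.A2odd hn z) a = if a = n then 2 else 1 := by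
      simp only [netFactor, mode]
      split_ifs <;> first | rfl | omega
    simp only [e, blocksMoved, Pattern.cartan, Fin.mk.injEq] at hb ⊢
    by_cases h1 : b = n
    · simp only [if_pos h1]
      split_ifs <;> simp <;> omega
    · simp only [if_neg h1]
      split_ifs <;> simp <;> omega
  | C1 hn =>
    rw [colourAt_cycleC a b m (by omega) (Or.inl rfl) (fun i => ⟨rfl, rfl⟩) hI]
    obtain ⟨a, ha⟩ := a
    obtain ⟨b, hb'⟩ := b
    have e : netFactor (.C1 hn) a = if a = 0 then 2 else 1 := by
      simp only [netFactor, mode]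
      split_ifs <;> first | rfl | omega
    simp only [e, blocksMoved, Pattern.cartan, Pattern.period, Fin.mk.injEq]
    by_cases h1 : b = n
    · simp only [if_pos h1]
      split_ifs <;> simp <;> omega
    · simp only [if_neg h1]
      split_ifs <;> simp <;> omega
  | A2even hn =>
    rw [colourAt_cycleC a b m (by omega) (Or.inl rfl) (fun i => ⟨rfl, rfl⟩) hI]
    obtain ⟨a, ha⟩ := a
    obtain ⟨b, hb'⟩ := b
    have e : netFactor (.A2even hn) a = if a = 0 then 2 else 1 := by
      simp only [netFactor, mode]
      split_ifs <;> first | rfl | omega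
    simp only [e, blocksMoved, Pattern.cartan, Pattern.period, Fin.mk.injEq]
    by_cases h1 : b = n
    · simp only [if_pos h1]
      split_ifs <;> simp <;> omega
    · simp only [if_neg h1]
      split_ifs <;> simp <;> omega
  | D2 hn =>
    rw [colourAt_cycleC a b m (by omega) (Or.inr rfl) (fun i => ⟨rfl, rfl⟩) hI]
    obtain ⟨a, ha⟩ := a
    obtain ⟨b, hb'⟩ := b
    have e : netFactor (.D2 hn) a = if a = 0 ∨ a = n then 2 else 1 := by
      simp only [netFactor, mode]
      split_ifs <;> first | rfl | omega
    simp only [e, blocksMoved, Pattern.cartan, Pattern.period, Fin.mk.injEq]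
    by_cases h1 : b = n
    · simp only [if_pos h1]
      split_ifs <;> simp <;> omega
    · simp only [if_neg h1]
      split_ifs <;> simp <;> omega

/-- The effect of a block of half-unit depth on the weight. -/
theorem cartan_of_halves (a b : Fin (n + 1)) (m : ℕ) (hm : P.storey (m + 1) = .halves)
    (hb : b.val ≤ 1) :
    netFactor P a * blocksMoved P b *
      (colourAt P a m - (if a = b then 2 else 0)) = -(blocksMoved P a * P.cartan a b) ∧
    colourAt P a m = colourAt P a (m + 2) := by
  obtain ⟨h0, h⟩ := storey_halves_cases hm
  have hres : ∃ hn : 3 ≤ n, P.period = 2 * n - 1 ∧ secondRes P a = (if a.val ≤ 1 then 0 else a.val - 1) ∧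
      firstRes P a = if a.val ≤ 1 then 0 else 2 * n - a.val := by
    rcases h with ⟨hn, z, rfl⟩ | ⟨hn, z, rfl⟩ <;> exact ⟨hn, rfl, rfl, rfl⟩
  obtain ⟨hn, hp, hs, hf⟩ := hres
  have e1 := add_one_mod_eq (period_pos (P := P)) m
  have e2 := add_one_mod_eq (period_pos (P := P)) (m + 1)
  have e3 := Nat.mod_lt m (period_pos (P := P))
  have e : ∀ k, HasColour P a k ↔ k % P.period = (if a.val ≤ 1 then 0 else a.val - 1) ∨
      k % P.period = if a.val ≤ 1 then 0 else 2 * n - a.val := by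
    intro k
    rw [(colour_iff_mod (by omega) k).2.2, hs, hf]
  have h1 : HasColour P a m ↔ a.val = 2 := by
    have h5 : m % P.period = 2 * n - 2 := by
      rw [h0] at e1
      split_ifs at e1
      omega
    rw [e, h5]
    split_ifs <;> omega
  have h2 : HasColour P a (m + 2) ↔ a.val = 2 := by
    rw [e, show (m + 2) % P.period = 1 by rw [e2, h0, if_neg (by omega)]]
    split_ifs <;> first | omega | (simp; omega)
  classical
  have h3 : colourAt P a m = if a.val = 2 then 1 else 0 := by simp only [colourAt, h1]
  have h4 : colourAt P a (m + 2) = if a.val = 2 then 1 else 0 := by simp only [colourAt, h2]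
  refine ⟨?_, h3.trans h4.symm⟩
  rw [h3]
  obtain ⟨a, ha⟩ := a
  obtain ⟨b, hb'⟩ := b
  simp only at hb
  have e4 : netFactor P a = if a = n then 2 else 1 := by
    rcases h with ⟨hn, z, rfl⟩ | ⟨hn, z, rfl⟩ <;> simp only [netFactor, mode] <;>
      split_ifs <;> first | rfl | omega
  clear e e1 e2 e3 h0 h1 h2 h3 h4 hs hf
  rw [e4]
  rcases h with ⟨hn, z, rfl⟩ | ⟨hn, z, rfl⟩ <;>
    simp only [blocksMoved, Pattern.cartan, Fin.mk.injEq, show ¬ b = n by omega, if_false,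
      and_false] <;>
    split_ifs <;> simp <;> omega

/-- The effect of an additional block on the weight. -/
theorem cartan_of_addBlock (a b : Fin (n + 1)) {c : Column} (hc : c.Valid P)
    (hs : SlotAt P b (HasColour P b) c) (h1 : 1 ≤ c.full) :
    netFactor P a * blocksMoved P b * (columnNet P a (addBlock P b c) - columnNet P a c) =
      -(blocksMoved P a * P.cartan a b) := by
  obtain ⟨k, o⟩ := c
  obtain ⟨m, rfl⟩ : ∃ m, k = m + 1 := ⟨k - 1, by simp at h1; omega⟩
  rcases addBlock_cases (i := (b : ℕ)) hc with ⟨rfl, h2, h3⟩ | ⟨rfl, h2, h3⟩ | ⟨⟨s, rfl⟩, h2, h3⟩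
  · have hb := hs.1.le_one h2
    rw [h3, ← (cartan_of_halves a b m h2 hb).1, columnNet_of_half_eq_none,
      columnNet_of_half_eq_some _ _ h2, halfColour_sideOf hb]
    congr 1
    have h4 : colourAt P a (m + 1) = if a.val ≤ 1 then 1 else 0 := by
      simp [colourAt, HasColour, storeySpot_halves h2]
    rw [h4]
    simp only [Fin.ext_iff]
    split_ifs <;> omega
  -- For blocks of unit depth the change is a difference of differences of `colourAt` over three
  -- consecutive storeys; this needs a storey below, hence `1 ≤ c.full`.
  · rw [h3, ← cartan_of_unit a b m h2 hs.1, columnNet_of_half_eq_none, columnNet_of_half_eq_none]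
    ring
  · have hb := hs.1.le_one h2
    have h5 := hs.2 s rfl
    have h6 := halfColour_le_one (P := P) s
    obtain ⟨e1, e2⟩ := cartan_of_halves a b m h2 hb
    rw [h3, ← e1, e2, columnNet_of_half_eq_none, columnNet_of_half_eq_some _ _ h2]
    congr 1
    have h4 : colourAt P a (m + 1) = if a.val ≤ 1 then 1 else 0 := by
      simp [colourAt, HasColour, storeySpot_halves h2]
    rw [h4]
    simp only [Fin.ext_iff, Nat.add_assoc, Nat.reduceAdd]
    split_ifs <;> omega

end Weights

/-! ### Weights of classes and the crystal axioms. -/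

section Crystal

variable {n : ℕ} {P : Pattern n} {l : ℕ} {i : Fin (n + 1)} {A B : Slice P l}
  {x y : SliceClass P l}

theorem SliceClass.wt_toClass (hA : A.NoEmptyLayer) (j : Fin (n + 1)) :
    blocksMoved P j * SliceClass.wt A.toClass j = netFactor P j * net P j A.1 := by
  rw [← addable_sub_removable (by omega) A.2.isChain, ← SliceClass.up_toClass hA,
    ← SliceClass.down_toClass hA, SliceClass.wt, SliceClass.phi_eq_up, SliceClass.eps_eq_down]
  push_cast
  ring

/-- Each of the `m` blocks contributes the same amount; the intermediate columns stay off the ground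
because heights never decrease. -/
theorem net_addSteps {L m : ℕ} {C C' : Fin L → Column} (hC : ∀ r, 1 ≤ (C r).full)
    (h : iterRel (AddStep P i) m C C') (j : Fin (n + 1)) :
    netFactor P j * blocksMoved P i * (net P j C' - net P j C) =
      -(m * (blocksMoved P j * P.cartan j i)) := by
  induction m generalizing C' with
  | zero => cases h; simp
  | succ m ih =>
    obtain ⟨D, h1, k, h2, -⟩ := h
    obtain ⟨c, hc, hs, ⟨r, rfl⟩, h3⟩ := h2.exists_net
    have h4 := cartan_of_addBlock j i hc hs ((hC r).trans (iterRel_full_bounds h1 r).1)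
    rw [← h3 j] at h4
    have := ih h1
    push_cast
    linear_combination this + h4

theorem SliceClass.wt_of_f (h : SliceClass.f i x = some y) :
    SliceClass.wt y = SliceClass.wt x - simpleRoot P.cartan i := by
  obtain ⟨A, B, rfl, rfl, h, hA⟩ := SliceClass.f_eq_some_iff.mp h
  have hB : ∀ j, 1 ≤ (B.1 j).full := fun j => by
    have := hA j
    have := h.full_bounds j
    omega
  funext j
  have h1 := net_addSteps hA h j
  have h2 := SliceClass.wt_toClass (Slice.noEmptyLayer_of_full hA) j
  have h3 := SliceClass.wt_toClass (Slice.noEmptyLayer_of_full hB) j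
  -- Weights are known only after multiplication by `blocksMoved P j`, and the change of `net` only
  -- after multiplication by `blocksMoved P i`; both factors are cancelled at once.
  have h4 : (blocksMoved P i * blocksMoved P j : ℤ) ≠ 0 := by
    have := blocksMoved_pos (P := P) (i := i)
    have := blocksMoved_pos (P := P) (i := j)
    positivity
  refine mul_left_cancel₀ h4 ?_
  simp only [Pi.sub_apply, simpleRoot]
  linear_combination (blocksMoved P i : ℤ) * (h3 - h2) + h1

/-- The classes of slices form a classical crystal. -/
theorem isClassicalCrystal : IsClassicalCrystal (B := SliceClass P l) P.cartan SliceClass.wt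
    (fun i x => ((SliceClass.eps i x : ℤ) : WithBot ℤ))
    (fun i x => ((SliceClass.phi i x : ℤ) : WithBot ℤ))
    SliceClass.e SliceClass.f := by
  have key : ∀ (i : Fin (n + 1)) (x y : SliceClass P l), SliceClass.f i x = some y →
      SliceClass.phi i x = SliceClass.phi i y + 1 ∧ SliceClass.eps i y = SliceClass.eps i x + 1 := by
    intro i x y h
    simp only [SliceClass.phi_eq_up, SliceClass.eps_eq_down]
    exact SliceClass.up_down_of_f h
  refine ⟨fun i x => ?_, fun i x y h => ?_, fun i x y h => SliceClass.wt_of_f h,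
    fun i x y h => ?_, fun i x y h => ?_, fun i x y h => ?_, fun i x y h => ?_,
    fun i x y => SliceClass.f_iff_e, fun i x h => ?_⟩
  · rw [← WithBot.coe_add, WithBot.coe_inj]
    simp [coroot, SliceClass.wt]
  · rw [SliceClass.wt_of_f (SliceClass.f_iff_e.mpr h)]
    simp
  · rw [← WithBot.coe_add, WithBot.coe_inj]
    have := key i y x (SliceClass.f_iff_e.mpr h)
    omega
  · rw [← WithBot.coe_add, WithBot.coe_inj]
    have := key i y x (SliceClass.f_iff_e.mpr h)
    omega
  · rw [← WithBot.coe_add, WithBot.coe_inj]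
    have := key i x y h
    omega
  · rw [← WithBot.coe_add, WithBot.coe_inj]
    have := key i x y h
    omega
  · exact absurd h WithBot.coe_ne_bot

end Crystal

end YoungSlice

/-! ### The main theorem. -/

theorem mainTheorem3 (n : ℕ) (P : Pattern n) (l : ℕ) (hl : 1 ≤ l) :
    -- the operators are well defined on slices and on classes
    (∀ (i : Fin (n + 1)) (C : Slice P l), C.NoEmptyLayer →
      (∀ t, eTuple P i C.1 = some t → IsSlice P t) ∧
      (∀ t, fTuple P i C.1 = some t → IsSlice P t) ∧
      SliceClass.e i C.toClass = (C.e i).map Slice.toClass ∧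
      SliceClass.f i C.toClass = (C.f i).map Slice.toClass) ∧
    -- the maxima defining `ε_i` and `φ_i` exist
    (∀ (i : Fin (n + 1)) (x : SliceClass P l),
      IsGreatest {k | iterOpt (SliceClass.e i) k x ≠ none} (SliceClass.eps i x) ∧
      IsGreatest {k | iterOpt (SliceClass.f i) k x ≠ none} (SliceClass.phi i x)) ∧
    -- the crystal axioms hold
    IsClassicalCrystal (B := SliceClass P l) P.cartan SliceClass.wt
      (fun i x => ((SliceClass.eps i x : ℤ) : WithBot ℤ))
      (fun i x => ((SliceClass.phi i x : ℤ) : WithBot ℤ))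
      SliceClass.e SliceClass.f := by
  refine ⟨fun i C hC => ?_, fun i x => ?_, isClassicalCrystal⟩
  · have hi : (i : ℕ) ≤ n := by omega
    exact ⟨fun t h => C.2.of_removeSteps hi ((eTuple_spec hi C.2.isChain hC).1 t h),
      fun t h => C.2.of_addSteps hi ((fTuple_spec hi C.2.isChain hC).1 t h),
      (SliceClass.operators_toClass hC).1, (SliceClass.operators_toClass hC).2⟩
  · rw [SliceClass.eps_eq_down, SliceClass.phi_eq_up]
    exact ⟨SliceClass.isGreatest_down i x, SliceClass.isGreatest_up i x⟩
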